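/- An instance of matroid-constrained fair maximum coverage, $(\mathrm{M},\mathrm{F})$-MaxCov, is $\mathcal I=(G,[r],f,t,k,\varepsilon,\mathcal M)$, where $G=(A\uplus B,E)$ is a finite bipartite graph with $|A|=n$, $|B|=m$; $f:B\to[r]$ is a surjective colouring; $t_j\in\mathbb N$ is the demand of colour $j\in[r]$; $k\in\mathbb N$; $\varepsilon\in(0,1)$ is rational; and $\mathcal M$ is a matroid on the ground set $A$, accessible only through an independence oracle that answers a query "is $P\subseteq A$ independent?" in one step. For $S\subseteq A$ let $N_j(S)$ be the set of vertices of colour $j$ in $B$ adjacent to at least one vertex of $S$. $\mathcal I$ is a yes-instance if there is an independent set $S\subseteq A$ of $\mathcal M$ with $|S|\le k$ and $|N_j(S)|\ge t_j$ for all $j\in[r]$; otherwise it is a no-instance. For $d\in\mathbb N$, $G$ is $K_{d,d}$-free if no $d$ vertices of $A$ have $d$ common neighbours in $B$. Put $\mathsf T_{\mathrm{small}}=\{j\in[r]: t_j\le 2k^2d/\varepsilon\}$ and $\mathsf T_{\mathrm{large}}=[r]\setminus \mathsf T_{\mathrm{small}}$. **Theorem.** There are a randomized algorithm and a constant $C$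 such that, for every $d$ and every instance $\mathcal I$ of $(\mathrm M,\mathrm F)$-MaxCov in which $G$ is $K_{d,d}$-free, the algorithm, given $\mathcal I$ and $d$, always halts within $$C\cdot 2^{\,C\,k^3 r d\log_2(r+1)/\varepsilon}\,(n+m+1)^{C}$$ steps, where a step is one operation of a random-access machine with addition and subtraction of natural numbers, one fair coin flip, or one oracle query, and: * if $\mathcal I$ is a yes-instance, then with probability at least $e^{-2k^3dr/\varepsilon}$ it returns a set $S\subseteq A$ of size at most $k$ that is independent in $\mathcal M$ and satisfies $|N_j(S)|\ge(1-\varepsilon)t_j$ for every $j\in\mathsf T_{\mathrm{large}}$ and $|N_j(S)|\ge t_j$ for every $j\in\mathsf T_{\mathrm{small}}$; * if $\mathcal I$ is a no-instance, then it always returns either NO or a set $S\subseteq A$ of size at most $k$ that is independent in $\mathcal M$ and satisfies $|N_j(S)|\ge(1-\varepsilon)t_j$ for every $j\in[r]$. -/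

import Mathlib

namespace MFCov

/-! ### Instances of matroid-constrained fair maximum coverage -/

/-- An instance: a bipartite graph `(A ⊎ B, E)` with `A = Fin n` and `B = Fin m`, a surjective
colouring `f` of `B` with `r` colours, a demand `t j` for each colour, a budget `k`, an accuracy
`0 < ε < 1`, and a matroid `M` with ground set `A`. -/
structure Inst where
  n : ℕ
  m : ℕ
  r : ℕ
  k : ℕ
  ε : ℚ
  E : Finset (Fin n × Fin m)
  f : Fin m → Fin r
  t : Fin r → ℕ
  M : Matroid (Fin n)
  ε_pos : 0 < ε
  ε_lt_one : ε < 1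
  f_surj : Function.Surjective f
  ground_eq : M.E = Set.univ

/-- `N_j(S)`: the vertices of colour `j` adjacent to at least one vertex of `S`. -/
def Inst.nbr (I : Inst) (j : Fin I.r) (S : Finset (Fin I.n)) : Finset (Fin I.m) :=
  Finset.univ.filter fun b => I.f b = j ∧ ∃ a ∈ S, (a, b) ∈ I.E

/-- The graph is `K_{d,d}`-free: no `d` vertices of `A` have `d` common neighbours in `B`. -/
def Inst.KFree (I : Inst) (d : ℕ) : Prop :=
  ¬ ∃ (X : Finset (Fin I.n)) (Y : Finset (Fin I.m)),
    X.card = d ∧ Y.card = d ∧ ∀ a ∈ X, ∀ b ∈ Y, (a, b) ∈ I.E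

/-- `S` is admissible: at most `k` vertices, independent in the matroid. -/
def Inst.Admissible (I : Inst) (S : Finset (Fin I.n)) : Prop :=
  S.card ≤ I.k ∧ I.M.Indep (S : Set (Fin I.n))

/-- Yes-instances: some admissible set meets all demands. -/
def Inst.IsYes (I : Inst) : Prop :=
  ∃ S : Finset (Fin I.n), I.Admissible S ∧ ∀ j, I.t j ≤ (I.nbr j S).card

/-- The colours with small demand, `t_j ≤ 2k²d/ε`. -/
def Inst.Small (I : Inst) (d : ℕ) (j : Fin I.r) : Prop :=
  (I.t j : ℚ) ≤ 2 * (I.k : ℚ) ^ 2 * d / I.ε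

/-- `S` covers at least `(1-ε) t_j` vertices of colour `j`. -/
def Inst.ApproxCovers (I : Inst) (S : Finset (Fin I.n)) (j : Fin I.r) : Prop :=
  (1 - I.ε) * (I.t j : ℚ) ≤ ((I.nbr j S).card : ℚ)

/-- `S` is admissible, meets every small demand exactly, and every large demand up to the
factor `1-ε`. -/
def Inst.Good (I : Inst) (d : ℕ) (S : Finset (Fin I.n)) : Prop :=
  I.Admissible S ∧
    (∀ j, ¬ I.Small d j → I.ApproxCovers S j) ∧
    (∀ j, I.Small d j → I.t j ≤ (I.nbr j S).card)

/-! ### Randomized random-access programs with an oracle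

The memory of a program consists of arrays of natural numbers, of which a program text mentions
finitely many. The arithmetic operations are addition and truncated subtraction, multiplication is
not a primitive. Executing an assignment, a test, a coin flip or an oracle query takes one step. -/

/-- Expressions; `get x i` is entry `i` of array `x`. -/
inductive Expr where
  | const (c : ℕ)
  | get (x : ℕ) (i : Expr)
  | add (e₁ e₂ : Expr)
  | sub (e₁ e₂ : Expr)

/-- Programs. -/
inductive Prog where
  | skip
  /-- `x[i] := e` -/
  | assign (x : ℕ) (i e : Expr)
  /-- `x[i] :=` a fresh random bit -/
  | flip (x : ℕ) (i : Expr)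
  /-- `x[i] :=` the answer of the oracle to the query written in array `y` -/
  | query (x : ℕ) (i : Expr) (y : ℕ)
  | seq (p q : Prog)
  /-- if `e₁ < e₂` then `p` else `q` -/
  | ite (e₁ e₂ : Expr) (p q : Prog)
  /-- while `e₁ < e₂` do `p` -/
  | loop (e₁ e₂ : Expr) (p : Prog)

/-- A memory content, together with the number of random bits consumed so far. -/
structure State where
  arr : ℕ → ℕ → ℕ
  coins : ℕ

/-- The state after `x[i] := v`. -/
def State.set (s : State) (x i v : ℕ) : State :=
  { s with arr := Function.update s.arr x (Function.update (s.arr x) i v) }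

/-- The state after the consumption of one random bit. -/
def State.tick (s : State) : State :=
  { s with coins := s.coins + 1 }

/-- The value of an expression. -/
def Expr.eval (s : State) : Expr → ℕ
  | const c => c
  | get x i => s.arr x (i.eval s)
  | add e₁ e₂ => e₁.eval s + e₂.eval s
  | sub e₁ e₂ => e₁.eval s - e₂.eval s

/-- `Exec O ω p s c s'`: with the oracle `O` and the sequence `ω` of random bits, the program `p`
started in `s` halts in `s'` after exactly `c` steps. -/
inductive Exec (O : (ℕ → ℕ) → Bool) (ω : ℕ → Bool) : Prog → State → ℕ → State → Prop where
  | skip (s : State) : Exec O ω Prog.skip s 1 s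
  | assign (x : ℕ) (i e : Expr) (s : State) :
      Exec O ω (Prog.assign x i e) s 1 (s.set x (i.eval s) (e.eval s))
  | flip (x : ℕ) (i : Expr) (s : State) :
      Exec O ω (Prog.flip x i) s 1 (s.set x (i.eval s) (ω s.coins).toNat).tick
  | query (x : ℕ) (i : Expr) (y : ℕ) (s : State) :
      Exec O ω (Prog.query x i y) s 1 (s.set x (i.eval s) (O (s.arr y)).toNat)
  | seq {p q : Prog} {s s₁ s₂ : State} {c₁ c₂ : ℕ} :
      Exec O ω p s c₁ s₁ → Exec O ω q s₁ c₂ s₂ → Exec O ω (Prog.seq p q) s (c₁ + c₂) s₂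
  | ite_true {e₁ e₂ : Expr} {p q : Prog} {s s₁ : State} {c : ℕ} :
      e₁.eval s < e₂.eval s → Exec O ω p s c s₁ → Exec O ω (Prog.ite e₁ e₂ p q) s (c + 1) s₁
  | ite_false {e₁ e₂ : Expr} {p q : Prog} {s s₁ : State} {c : ℕ} :
      ¬ e₁.eval s < e₂.eval s → Exec O ω q s c s₁ → Exec O ω (Prog.ite e₁ e₂ p q) s (c + 1) s₁
  | loop_true {e₁ e₂ : Expr} {p : Prog} {s s₁ s₂ : State} {c₁ c₂ : ℕ} :
      e₁.eval s < e₂.eval s → Exec O ω p s c₁ s₁ → Exec O ω (Prog.loop e₁ e₂ p) s₁ c₂ s₂ →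
      Exec O ω (Prog.loop e₁ e₂ p) s (c₁ + c₂ + 1) s₂
  | loop_false {e₁ e₂ : Expr} {p : Prog} {s : State} :
      ¬ e₁.eval s < e₂.eval s → Exec O ω (Prog.loop e₁ e₂ p) s 1 s

/-- Once the random bits are fixed, a program has at most one run. -/
theorem Exec.unique {O : (ℕ → ℕ) → Bool} {ω : ℕ → Bool} {p : Prog} {s s' : State} {c : ℕ}
    (h : Exec O ω p s c s') : ∀ {c₁ : ℕ} {s₁ : State}, Exec O ω p s c₁ s₁ → c₁ = c ∧ s₁ = s' := by
  induction h with
  | skip | assign | flip | query => intro _ _ h; cases h; exact ⟨rfl, rfl⟩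
  | seq _ _ ih₁ ih₂ =>
    intro _ _ h
    cases h with
    | seq a b =>
      obtain ⟨rfl, rfl⟩ := ih₁ a
      obtain ⟨rfl, rfl⟩ := ih₂ b
      exact ⟨rfl, rfl⟩
  | ite_true hc _ ih =>
    intro _ _ h
    cases h with
    | ite_true _ a => obtain ⟨rfl, rfl⟩ := ih a; exact ⟨rfl, rfl⟩
    | ite_false hn _ => exact absurd hc hn
  | ite_false hc _ ih =>
    intro _ _ h
    cases h with
    | ite_true hn _ => exact absurd hn hc
    | ite_false _ a => obtain ⟨rfl, rfl⟩ := ih a; exact ⟨rfl, rfl⟩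
  | loop_true hc _ _ ih₁ ih₂ =>
    intro _ _ h
    cases h with
    | loop_true _ a b =>
      obtain ⟨rfl, rfl⟩ := ih₁ a
      obtain ⟨rfl, rfl⟩ := ih₂ b
      exact ⟨rfl, rfl⟩
    | loop_false hn => exact absurd hc hn
  | loop_false hc =>
    intro _ _ h
    cases h with
    | loop_true hn _ _ => exact absurd hn hc
    | loop_false _ => exact ⟨rfl, rfl⟩

/-- The distribution of a sequence of independent fair coin flips. -/
noncomputable def fairCoins : MeasureTheory.Measure (ℕ → Bool) :=
  MeasureTheory.Measure.infinitePi fun _ : ℕ => (PMF.uniformOfFintype Bool).toMeasure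

/-! ### Input and output -/

/-- The independence oracle: a query is a characteristic vector of a subset of `A`. -/
noncomputable def Inst.oracle (I : Inst) (v : ℕ → ℕ) : Bool :=
  @decide (I.M.Indep {a : Fin I.n | v a ≠ 0}) (Classical.propDecidable _)

/-- The initial memory. Array `0` holds the numbers `n, m, r, k, d` and the numerator and the
denominator of `ε`, array `1` the demands, array `2` the colours, and array `3` the biadjacency
matrix, row by row. All other entries are zero. The matroid is not part of the memory. -/
def Inst.init (I : Inst) (d : ℕ) : State where
  coins := 0
  arr := fun x i =>
    match x with
    | 0 => [I.n, I.m, I.r, I.k, d, I.ε.num.toNat, I.ε.den].getD i 0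
    | 1 => if h : i < I.r then I.t ⟨i, h⟩ else 0
    | 2 => if h : i < I.m then (I.f ⟨i, h⟩ : ℕ) else 0
    | 3 => if ∃ e ∈ I.E, i = (e.1 : ℕ) * I.m + (e.2 : ℕ) then 1 else 0
    | _ => 0

/-- The output read off a final state: `none` (the answer NO) if entry `0` of array `4` is zero,
and otherwise the set whose characteristic vector is array `5`. -/
def Inst.output (I : Inst) (s : State) : Option (Finset (Fin I.n)) :=
  if s.arr 4 0 = 0 then none else some (Finset.univ.filter fun a : Fin I.n => s.arr 5 a ≠ 0)

/-- On the instance `I`, with the parameter `d` and the random bits `ω`, the program `P` halts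
within `T` steps with output `o`. -/
def Inst.Outputs (I : Inst) (d : ℕ) (P : Prog) (T : ℕ) (ω : ℕ → Bool)
    (o : Option (Finset (Fin I.n))) : Prop :=
  ∃ (c : ℕ) (s : State), c ≤ T ∧ Exec I.oracle ω P (I.init d) c s ∧ I.output s = o

end MFCov

/-! Small colours are handled by colour coding, large ones by rounding, and the matroid by
layers of maximal independent sets.

*Types.* Every vertex of `B` of a small colour receives a random label below `k`. The type of a
vertex `a` of `A` records, for each small colour `j` and each label, how many neighbours of `a` have
this colour and label, capped at `t_j`, and, for each large colour, the number of neighbours, capped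
at `t_j` and rounded to multiples of a unit just below `ε t_j / 2k`. Types are numbers written in a
fixed base (`Inst.code`).

*Layers.* For each type, `L = Inst.depth` successive layers are chosen greedily: each layer is a
maximal admissible set of vertices of this type outside the earlier layers (`Inst.Layered`). If a
vertex `x` of a solution lies in no layer, then every layer of its type contains a vertex that can
replace `x` without loss of independence (`Inst.Layered.exists_exchange`), so there are `L` distinct
candidates. Since the graph has no biclique `K_{d,d}`, double counting bounds the number of vertices
whose overlap with the rest of the solution exceeds the unit of some large colour
(`Inst.KFree.card_le`) by less than `L`. Hence some candidate loses at most two units in every large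
colour (`Inst.exists_replacement`). Replacing the at most `k` vertices of a solution one at a time
loses less than `ε t_j`. In a small colour nothing is lost if the labels are right: choose `t_j`
covered vertices of each small colour as witnesses, and let the label of each witness be the index
of a vertex of the solution that covers it. Vertices of equal type have equally many neighbours with
the label of their index, and neighbours with different labels are different
(`Inst.Witness.exists_thr_le`).

*Search.* It remains to try all sets of at most `k` vertices in layers. There are at most `k` such
vertices per layer and type, which bounds the running time (`Inst.tuples_le`). A set is output only
after it has been tested, so every output is a solution up to the factor `1 - ε`.

*Probability.* A witness has the right label if `k` coins show prescribed values, and there are at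
most `2k²dr/ε` witnesses (`Inst.Witness.exp_le_prob`).

*Programs.* Correctness is proved by a Hoare logic (`Runs`) whose time bound is read off the program
text: if no loop is iterated more than `G` times, then the running time is polynomial in `G`
(`Prog.exists_bnd_le`). What a program leaves unchanged is read off its text as well
(`Runs.frame`). -/

namespace MFCov

/-! ### A program logic with a syntactic time bound -/

instance : Add Expr := ⟨Expr.add⟩
instance : Sub Expr := ⟨Expr.sub⟩

/-- The scalar variable `x`, stored as entry `0` of array `x`. -/
def var (x : ℕ) : Expr := Expr.get x (Expr.const 0)

/-- The literal `c`. -/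
def lit (c : ℕ) : Expr := Expr.const c

/-- Assignment to the scalar variable `x`. -/
def put (x : ℕ) (e : Expr) : Prog := Prog.assign x (Expr.const 0) e

/-- Sequential composition. -/
infixr:50 " ;; " => Prog.seq

@[simp] theorem Expr.eval_add' (s : State) (e₁ e₂ : Expr) :
    (e₁ + e₂).eval s = e₁.eval s + e₂.eval s := rfl
@[simp] theorem Expr.eval_sub' (s : State) (e₁ e₂ : Expr) :
    (e₁ - e₂).eval s = e₁.eval s - e₂.eval s := rfl
@[simp] theorem Expr.eval_get (s : State) (x : ℕ) (e : Expr) :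
    (Expr.get x e).eval s = s.arr x (e.eval s) := rfl
@[simp] theorem Expr.eval_const (s : State) (c : ℕ) : (Expr.const c).eval s = c := rfl
@[simp] theorem eval_var (s : State) (x : ℕ) : (var x).eval s = s.arr x 0 := rfl
@[simp] theorem eval_lit (s : State) (c : ℕ) : (lit c).eval s = c := rfl

@[simp] theorem State.set_arr (s : State) (x i v y j : ℕ) :
    (s.set x i v).arr y j = if y = x ∧ j = i then v else s.arr y j := by
  by_cases h : y = x
  · subst h
    by_cases h' : j = i
    · subst h'; simp [State.set]
    · simp [State.set, h']
  · simp [State.set, h]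

theorem State.set_arr_ne (s : State) {x y : ℕ} (i v : ℕ) (h : y ≠ x) :
    (s.set x i v).arr y = s.arr y := by
  simp [State.set, h]

@[simp] theorem State.set_coins (s : State) (x i v : ℕ) : (s.set x i v).coins = s.coins := rfl
@[simp] theorem State.tick_arr (s : State) : s.tick.arr = s.arr := rfl
@[simp] theorem State.tick_coins (s : State) : s.tick.coins = s.coins + 1 := rfl

theorem State.ext' {s s' : State} (h : ∀ y j, s.arr y j = s'.arr y j) (h' : s.coins = s'.coins) :
    s = s' := by
  cases s; cases s'
  simp only [State.mk.injEq]
  exact ⟨funext fun y => funext fun j => h y j, h'⟩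

/-- Whether array `y` is the target of an instruction of the program. -/
def Prog.writes (y : ℕ) : Prog → Bool
  | skip => false
  | assign x _ _ => x == y
  | flip x _ => x == y
  | query x _ _ => x == y
  | seq p q => p.writes y || q.writes y
  | ite _ _ p q => p.writes y || q.writes y
  | loop _ _ p => p.writes y

/-- Whether every array read by the expression is left alone by the program. -/
def Expr.stable (p : Prog) : Expr → Bool
  | const _ => true
  | get x i => !p.writes x && i.stable p
  | add e₁ e₂ => e₁.stable p && e₂.stable p
  | sub e₁ e₂ => e₁.stable p && e₂.stable p

/-- Whether the program flips coins. -/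
def Prog.flips : Prog → Bool
  | flip _ _ => true
  | seq p q => p.flips || q.flips
  | ite _ _ p q => p.flips || q.flips
  | loop _ _ p => p.flips
  | _ => false

/-- A bound on the running time that holds if every loop is iterated at most `G` times each time
it is entered. -/
def Prog.bnd (G : ℕ) : Prog → ℕ
  | skip => 1
  | assign _ _ _ => 1
  | flip _ _ => 1
  | query _ _ _ => 1
  | seq p q => p.bnd G + q.bnd G
  | ite _ _ p q => p.bnd G + q.bnd G + 1
  | loop _ _ p => G * (p.bnd G + 1) + 1

/-- For a fixed program, the time bound is polynomial in `G`. -/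
theorem Prog.exists_bnd_le (p : Prog) : ∃ c : ℕ, ∀ G : ℕ, 1 ≤ G → p.bnd G ≤ c * G ^ c := by
  have mono : ∀ {a b G : ℕ}, a ≤ b → 1 ≤ G → a * G ^ a ≤ b * G ^ b := fun hab hG =>
    Nat.mul_le_mul hab (Nat.pow_le_pow_right hG hab)
  have one : ∀ G : ℕ, 1 ≤ G → 1 ≤ 1 * G ^ 1 := fun G hG => by simpa using hG
  have comb : ∀ {x y a b G : ℕ}, 1 ≤ G → x ≤ a * G ^ a → y ≤ b * G ^ b →
      x + y + 1 ≤ (a + b + 1) * G ^ (a + b + 1) := by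
    intro x y a b G hG hx hy
    have h1 : x ≤ a * G ^ (a + b + 1) :=
      hx.trans (Nat.mul_le_mul_left _ (Nat.pow_le_pow_right hG (by omega)))
    have h2 : y ≤ b * G ^ (a + b + 1) :=
      hy.trans (Nat.mul_le_mul_left _ (Nat.pow_le_pow_right hG (by omega)))
    have h3 : 1 ≤ G ^ (a + b + 1) := Nat.one_le_pow _ _ hG
    nlinarith
  induction p with
  | skip | assign | flip | query => exact ⟨1, one⟩
  | seq p q hp hq =>
    obtain ⟨a, ha⟩ := hp
    obtain ⟨b, hb⟩ := hq
    exact ⟨a + b + 1, fun G hG => (Nat.le_succ _).trans (comb hG (ha G hG) (hb G hG))⟩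
  | ite _ _ p q hp hq =>
    obtain ⟨a, ha⟩ := hp
    obtain ⟨b, hb⟩ := hq
    exact ⟨a + b + 1, fun G hG => comb hG (ha G hG) (hb G hG)⟩
  | loop _ _ p hp =>
    obtain ⟨a, ha⟩ := hp
    refine ⟨a + 2, fun G hG => ?_⟩
    have h1 : p.bnd G ≤ a * G ^ a := ha G hG
    have h2 : 1 ≤ G ^ a := Nat.one_le_pow _ _ hG
    have h3 : G * (p.bnd G + 1) ≤ G * ((a + 1) * G ^ a) := Nat.mul_le_mul_left _ (by nlinarith)
    have h4 : G ^ (a + 1) ≤ G ^ (a + 2) := Nat.pow_le_pow_right hG (by omega)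
    have h5 : 1 ≤ G ^ (a + 2) := Nat.one_le_pow _ _ hG
    calc G * (p.bnd G + 1) + 1 ≤ (a + 1) * G ^ (a + 1) + 1 := by
          rw [pow_succ]; nlinarith
      _ ≤ (a + 2) * G ^ (a + 2) := by nlinarith

section

variable {O : (ℕ → ℕ) → Bool} {ω : ℕ → Bool}

/-- Arrays that a program does not write keep their contents. -/
theorem Exec.arr_eq {p : Prog} {s s' : State} {c : ℕ} (h : Exec O ω p s c s') :
    ∀ y, p.writes y = false → s'.arr y = s.arr y := by
  induction h with
  | skip => intros; rfl
  | assign | flip | query =>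
    intro y hy
    simp only [Prog.writes, beq_eq_false_iff_ne] at hy
    simp [State.set_arr_ne _ _ _ hy.symm]
  | seq _ _ ih₁ ih₂ =>
    intro y hy
    simp only [Prog.writes, Bool.or_eq_false_iff] at hy
    rw [ih₂ y hy.2, ih₁ y hy.1]
  | ite_true _ _ ih =>
    intro y hy
    simp only [Prog.writes, Bool.or_eq_false_iff] at hy
    exact ih y hy.1
  | ite_false _ _ ih =>
    intro y hy
    simp only [Prog.writes, Bool.or_eq_false_iff] at hy
    exact ih y hy.2
  | loop_true _ _ _ ih₁ ih₂ =>
    intro y hy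
    rw [ih₂ y hy, ih₁ y hy]
  | loop_false => intros; rfl

theorem Exec.coins_eq {p : Prog} {s s' : State} {c : ℕ} (h : Exec O ω p s c s') :
    p.flips = false → s'.coins = s.coins := by
  induction h with
  | skip | assign | query | loop_false => intros; rfl
  | flip => intro h; simp [Prog.flips] at h
  | seq _ _ ih₁ ih₂ =>
    intro h
    simp only [Prog.flips, Bool.or_eq_false_iff] at h
    rw [ih₂ h.2, ih₁ h.1]
  | ite_true _ _ ih =>
    intro h
    simp only [Prog.flips, Bool.or_eq_false_iff] at h
    exact ih h.1
  | ite_false _ _ ih =>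
    intro h
    simp only [Prog.flips, Bool.or_eq_false_iff] at h
    exact ih h.2
  | loop_true _ _ _ ih₁ ih₂ =>
    intro h
    rw [ih₂ h, ih₁ h]

/-- The value of an expression depends only on the arrays that it reads. -/
theorem Expr.eval_eq_of_stable {p : Prog} {s s' : State}
    (h : ∀ y, p.writes y = false → s'.arr y = s.arr y) :
    ∀ e : Expr, e.stable p = true → e.eval s' = e.eval s
  | const _, _ => rfl
  | get x i, he => by
    simp only [Expr.stable, Bool.and_eq_true, Bool.not_eq_true'] at he
    simp only [Expr.eval]
    rw [Expr.eval_eq_of_stable h i he.2, h x he.1]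
  | add e₁ e₂, he => by
    simp only [Expr.stable, Bool.and_eq_true] at he
    simp only [Expr.eval]
    rw [Expr.eval_eq_of_stable h e₁ he.1, Expr.eval_eq_of_stable h e₂ he.2]
  | sub e₁ e₂, he => by
    simp only [Expr.stable, Bool.and_eq_true] at he
    simp only [Expr.eval]
    rw [Expr.eval_eq_of_stable h e₁ he.1, Expr.eval_eq_of_stable h e₂ he.2]

/-- Total correctness with a time bound: started in `s`, the program halts within `p.bnd G` steps
in a state that satisfies `Q`. -/
def Runs (O : (ℕ → ℕ) → Bool) (ω : ℕ → Bool) (G : ℕ) (p : Prog) (s : State) (Q : State → Prop) :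
    Prop :=
  ∃ c s', c ≤ p.bnd G ∧ Exec O ω p s c s' ∧ Q s'

variable {G : ℕ} {p q : Prog} {s : State} {Q : State → Prop}

/-- The postcondition of a triple may be strengthened by everything the program text shows to be
unchanged. -/
theorem Runs.frame {R : State → Prop} (h : Runs O ω G p s R)
    (hQ : ∀ s', R s' → (∀ y, p.writes y = false → s'.arr y = s.arr y) →
      (p.flips = false → s'.coins = s.coins) → Q s') : Runs O ω G p s Q := by
  obtain ⟨c, s', hc, he, hR⟩ := h
  exact ⟨c, s', hc, he, hQ s' hR he.arr_eq he.coins_eq⟩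

theorem Runs.mono {R : State → Prop} (h : Runs O ω G p s R) (hQ : ∀ s', R s' → Q s') :
    Runs O ω G p s Q :=
  h.frame fun s' hs _ _ => hQ s' hs

theorem Runs.skip (h : Q s) : Runs O ω G Prog.skip s Q := ⟨1, s, le_rfl, .skip s, h⟩

theorem Runs.assign {x : ℕ} {i e : Expr} (h : Q (s.set x (i.eval s) (e.eval s))) :
    Runs O ω G (Prog.assign x i e) s Q := ⟨1, _, le_rfl, .assign x i e s, h⟩

theorem Runs.put {x : ℕ} {e : Expr} (h : Q (s.set x 0 (e.eval s))) :
    Runs O ω G (put x e) s Q := Runs.assign h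

theorem Runs.flip {x : ℕ} {i : Expr} (h : Q (s.set x (i.eval s) (ω s.coins).toNat).tick) :
    Runs O ω G (Prog.flip x i) s Q := ⟨1, _, le_rfl, .flip x i s, h⟩

theorem Runs.query {x y : ℕ} {i : Expr} (h : Q (s.set x (i.eval s) (O (s.arr y)).toNat)) :
    Runs O ω G (Prog.query x i y) s Q := ⟨1, _, le_rfl, .query x i y s, h⟩

theorem Runs.seq (h : Runs O ω G p s fun s' => Runs O ω G q s' Q) :
    Runs O ω G (Prog.seq p q) s Q := by
  obtain ⟨c₁, s₁, h₁, e₁, c₂, s₂, h₂, e₂, hQ⟩ := h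
  exact ⟨_, s₂, Nat.add_le_add h₁ h₂, .seq e₁ e₂, hQ⟩

theorem Runs.ite {e₁ e₂ : Expr} (ht : e₁.eval s < e₂.eval s → Runs O ω G p s Q)
    (hf : ¬ e₁.eval s < e₂.eval s → Runs O ω G q s Q) : Runs O ω G (Prog.ite e₁ e₂ p q) s Q := by
  by_cases h : e₁.eval s < e₂.eval s
  · obtain ⟨c, s', hc, he, hQ⟩ := ht h
    exact ⟨c + 1, s', by simp only [Prog.bnd]; omega, .ite_true h he, hQ⟩
  · obtain ⟨c, s', hc, he, hQ⟩ := hf h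
    exact ⟨c + 1, s', by simp only [Prog.bnd]; omega, .ite_false h he, hQ⟩

/-- The rule for loops: an invariant `Inv i` for the state after `i` iterations, of which there are
at most `G`. -/
theorem Runs.loop {e₁ e₂ : Expr} (Inv : ℕ → State → Prop) (h0 : Inv 0 s)
    (hstep : ∀ i s₁, (∀ y, p.writes y = false → s₁.arr y = s.arr y) → Inv i s₁ →
      e₁.eval s₁ < e₂.eval s₁ → i < G ∧ Runs O ω G p s₁ (Inv (i + 1)))
    (hQ : ∀ i s₁, (∀ y, p.writes y = false → s₁.arr y = s.arr y) → Inv i s₁ →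
      ¬ e₁.eval s₁ < e₂.eval s₁ → Q s₁) :
    Runs O ω G (Prog.loop e₁ e₂ p) s Q := by
  have key : ∀ n i s₁, n + i = G → (∀ y, p.writes y = false → s₁.arr y = s.arr y) → Inv i s₁ →
      ∃ c s', c ≤ n * (p.bnd G + 1) + 1 ∧ Exec O ω (Prog.loop e₁ e₂ p) s₁ c s' ∧ Q s' := by
    intro n
    induction n with
    | zero =>
      intro i s₁ hn hf hI
      by_cases hc : e₁.eval s₁ < e₂.eval s₁
      · exact absurd (hstep i s₁ hf hI hc).1 (by omega)
      · exact ⟨1, s₁, by simp, .loop_false hc, hQ i s₁ hf hI hc⟩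
    | succ n ih =>
      intro i s₁ hn hf hI
      by_cases hc : e₁.eval s₁ < e₂.eval s₁
      · obtain ⟨-, c₁, s₂, hc₁, he₁, hI₂⟩ := hstep i s₁ hf hI hc
        obtain ⟨c₂, s₃, hc₂, he₂, hQ₃⟩ := ih (i + 1) s₂ (by omega)
          (fun y hy => (he₁.arr_eq y hy).trans (hf y hy)) hI₂
        refine ⟨c₁ + c₂ + 1, s₃, ?_, .loop_true hc he₁ he₂, hQ₃⟩
        rw [Nat.succ_mul]; omega
      · exact ⟨1, s₁, by omega, .loop_false hc, hQ i s₁ hf hI hc⟩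
  exact key G 0 s rfl (fun _ _ => rfl) h0

/-- `for x := 0, …, e - 1 do p`. -/
def forP (x : ℕ) (e : Expr) (p : Prog) : Prog :=
  put x (lit 0) ;; Prog.loop (var x) e (p ;; put x (var x + lit 1))

/-- The rule for counting loops. The syntactic side conditions say that the body changes neither
the counter nor the bound. -/
theorem Runs.forP {x N : ℕ} {e : Expr} (Inv : ℕ → State → Prop)
    (hx : p.writes x = false) (hs : e.stable (forP x e p) = true)
    (hN : e.eval s = N) (hG : N ≤ G) (h0 : Inv 0 (s.set x 0 0))
    (hstep : ∀ i s₁, i < N → (∀ y, (MFCov.forP x e p).writes y = false → s₁.arr y = s.arr y) →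
      s₁.arr x 0 = i → Inv i s₁ → Runs O ω G p s₁ fun s₂ => Inv (i + 1) (s₂.set x 0 (i + 1)))
    (hQ : ∀ s₁, (∀ y, (MFCov.forP x e p).writes y = false → s₁.arr y = s.arr y) → Inv N s₁ → Q s₁) :
    Runs O ω G (MFCov.forP x e p) s Q := by
  have hw : ∀ y, (MFCov.forP x e p).writes y = ((x == y) || p.writes y) := by
    intro y
    simp only [MFCov.forP, Prog.writes, MFCov.put]
    cases (x == y) <;> cases p.writes y <;> rfl
  refine Runs.seq (Runs.put ?_)
  have hfr : ∀ s₁ : State, (∀ y, (p ;; MFCov.put x (var x + lit 1)).writes y = false →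
      s₁.arr y = (s.set x 0 0).arr y) →
      ∀ y, (MFCov.forP x e p).writes y = false → s₁.arr y = s.arr y := by
    intro s₁ h y hy
    rw [hw, Bool.or_eq_false_iff] at hy
    rw [h y (by simp [Prog.writes, MFCov.put, hy.1, hy.2])]
    exact State.set_arr_ne _ _ _ (by simpa using (beq_eq_false_iff_ne.1 hy.1).symm)
  have hev : ∀ s₁ : State, (∀ y, (MFCov.forP x e p).writes y = false → s₁.arr y = s.arr y) →
      e.eval s₁ = N := fun s₁ h => (Expr.eval_eq_of_stable h e hs).trans hN
  refine Runs.loop (fun i s₁ => i ≤ N ∧ s₁.arr x 0 = i ∧ Inv i s₁) ⟨Nat.zero_le _, by simp, h0⟩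
    ?_ ?_
  · rintro i s₁ hf ⟨hi, hxi, hI⟩ hc
    have hf' := hfr s₁ hf
    rw [hev s₁ hf', eval_var, hxi] at hc
    refine ⟨by omega, Runs.seq ((hstep i s₁ hc hf' hxi hI).frame fun s₂ h₂ hf₂ _ => Runs.put ?_)⟩
    have : s₂.arr x 0 = i := by rw [hf₂ x hx, hxi]
    simp only [Expr.eval_add', eval_var, eval_lit, this]
    exact ⟨hc, by simp, h₂⟩
  · rintro i s₁ hf ⟨hi, hxi, hI⟩ hc
    have hf' := hfr s₁ hf
    rw [hev s₁ hf', eval_var, hxi] at hc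
    obtain rfl : i = N := by omega
    exact hQ s₁ hf' hI

/-- `z := a * b`, with the counter `x`. -/
def mulP (x z : ℕ) (a b : Expr) : Prog :=
  put z (lit 0) ;; forP x b (put z (var z + a))

theorem Runs.mulP {x z : ℕ} {a b : Expr} (hxz : (z == x) = false)
    (ha : a.stable (MFCov.mulP x z a b) = true) (hb : b.stable (MFCov.mulP x z a b) = true)
    (hG : b.eval s ≤ G)
    (h : Q ((s.set z 0 (a.eval s * b.eval s)).set x 0 (b.eval s))) :
    Runs O ω G (MFCov.mulP x z a b) s Q := by
  have hzx : z ≠ x := by simpa using hxz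
  have hw : ∀ y, (MFCov.mulP x z a b).writes y = ((z == y) || (x == y)) := by
    intro y
    simp only [MFCov.mulP, MFCov.forP, Prog.writes, MFCov.put]
    cases (x == y) <;> cases (z == y) <;> rfl
  have hw' : ∀ y, (MFCov.forP x b (MFCov.put z (var z + a))).writes y = ((z == y) || (x == y)) := by
    intro y
    simp only [MFCov.forP, Prog.writes, MFCov.put]
    cases (x == y) <;> cases (z == y) <;> rfl
  have st : ∀ e : Expr, e.stable (MFCov.mulP x z a b) =
      e.stable (MFCov.forP x b (MFCov.put z (var z + a))) := by
    intro e
    induction e with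
    | const => rfl
    | get y i ih => simp only [Expr.stable, ih, hw, hw']
    | add _ _ h1 h2 => simp only [Expr.stable, h1, h2]
    | sub _ _ h1 h2 => simp only [Expr.stable, h1, h2]
  have hset : ∀ (s₁ : State) (e : Expr), e.stable (MFCov.mulP x z a b) = true →
      (∀ y, (MFCov.mulP x z a b).writes y = false → s₁.arr y = s.arr y) → e.eval s₁ = e.eval s :=
    fun s₁ e he hs₁ => Expr.eval_eq_of_stable hs₁ e he
  have hz : ∀ y, (MFCov.mulP x z a b).writes y = false → (s.set z 0 0).arr y = s.arr y := by
    intro y hy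
    rw [hw, Bool.or_eq_false_iff] at hy
    exact State.set_arr_ne _ _ _ (beq_eq_false_iff_ne.1 hy.1).symm
  refine Runs.seq (Runs.put ?_)
  simp only [eval_lit]
  refine Runs.forP (N := b.eval s)
    (fun i s₁ => s₁ = (s.set z 0 (a.eval s * i)).set x 0 i)
    (by simpa [MFCov.put, Prog.writes] using hxz)
    (by rw [← st]; exact hb) (hset _ b hb hz) hG (by simp) ?_ ?_
  · rintro i s₁ hi hf hx rfl
    refine Runs.put ?_
    have hav : a.eval ((s.set z 0 (a.eval s * i)).set x 0 i) = a.eval s := by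
      apply hset _ a ha
      intro y hy
      rw [← hz y hy]
      exact hf y (by rw [hw']; rw [hw] at hy; exact hy)
    refine State.ext' (fun y j => ?_) (by simp)
    simp only [State.set_arr, Expr.eval_add', eval_var, hav, hzx]
    split_ifs <;> simp_all
    ring
  · rintro s₁ - rfl
    exact h

/-- `z := a / b`, leaving the remainder in `x`. -/
def divP (x z : ℕ) (a b : Expr) : Prog :=
  put z (lit 0) ;; put x a ;;
  Prog.loop b (var x + lit 1) (put x (var x - b) ;; put z (var z + lit 1))

theorem Runs.divP {x z : ℕ} {a b : Expr} (hxz : (z == x) = false)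
    (ha : a.stable (MFCov.divP x z a b) = true) (hb : b.stable (MFCov.divP x z a b) = true)
    (hpos : 0 < b.eval s) (hG : a.eval s / b.eval s ≤ G)
    (h : Q ((s.set z 0 (a.eval s / b.eval s)).set x 0 (a.eval s % b.eval s))) :
    Runs O ω G (MFCov.divP x z a b) s Q := by
  have hzx : z ≠ x := by simpa using hxz
  have hw : ∀ y, (MFCov.divP x z a b).writes y = ((z == y) || (x == y)) := by
    intro y
    simp only [MFCov.divP, Prog.writes, MFCov.put]
    cases (x == y) <;> cases (z == y) <;> rfl
  have hev : ∀ (e : Expr) (u v : ℕ), e.stable (MFCov.divP x z a b) = true →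
      e.eval ((s.set z 0 u).set x 0 v) = e.eval s := by
    intro e u v he
    refine Expr.eval_eq_of_stable (fun y hy => ?_) e he
    rw [hw, Bool.or_eq_false_iff] at hy
    rw [State.set_arr_ne _ _ _ (beq_eq_false_iff_ne.1 hy.2).symm,
      State.set_arr_ne _ _ _ (beq_eq_false_iff_ne.1 hy.1).symm]
  have hev' : ∀ (e : Expr) (u : ℕ), e.stable (MFCov.divP x z a b) = true →
      e.eval (s.set z 0 u) = e.eval s := by
    intro e u he
    refine Expr.eval_eq_of_stable (fun y hy => ?_) e he
    rw [hw, Bool.or_eq_false_iff] at hy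
    rw [State.set_arr_ne _ _ _ (beq_eq_false_iff_ne.1 hy.1).symm]
  refine Runs.seq (Runs.put (Runs.seq (Runs.put ?_)))
  simp only [eval_lit, hev' a 0 ha]
  set A := a.eval s
  set B := b.eval s
  refine Runs.loop (fun i s₁ => ∃ v, v + B * i = A ∧ s₁ = (s.set z 0 i).set x 0 v)
    ⟨A, by simp, rfl⟩ ?_ ?_
  · rintro i s₁ hf ⟨v, hv, rfl⟩ hc
    rw [hev b _ _ hb] at hc
    simp only [Expr.eval_add', eval_var, eval_lit, State.set_arr] at hc
    simp only [and_self, if_true] at hc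
    have hi : i + 1 ≤ A / B := by
      rw [Nat.le_div_iff_mul_le hpos]
      nlinarith
    refine ⟨by omega, Runs.seq (Runs.put (Runs.put ⟨v - B, ?_, ?_⟩))⟩
    · rw [← hv, Nat.mul_succ]; omega
    · refine State.ext' (fun y j => ?_) (by simp)
      simp only [State.set_arr, Expr.eval_add', Expr.eval_sub', eval_var, eval_lit,
        hev b _ _ hb, hzx]
      split_ifs <;> simp_all
      rfl
  · rintro i s₁ - ⟨v, hv, rfl⟩ hc
    rw [hev b _ _ hb] at hc
    simp only [Expr.eval_add', eval_var, eval_lit, State.set_arr] at hc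
    simp only [and_self, if_true] at hc
    have hvB : v < B := by omega
    have h1 : A / B = i := by
      rw [← hv, Nat.add_mul_div_left _ _ hpos, Nat.div_eq_of_lt hvB, zero_add]
    have h2 : A % B = v := by
      rw [← hv, Nat.add_mul_mod_self_left, Nat.mod_eq_of_lt hvB]
    rwa [h1, h2] at h

end

/-! ### Units, thresholds and types -/

namespace Inst

variable (I : Inst) (d : ℕ)

/-- The demand of colour `j`, zero for `j ≥ r`. -/
def dem (j : ℕ) : ℕ := if h : j < I.r then I.t ⟨j, h⟩ else 0

/-- `⌈ε t_j / 2k⌉ - 1`, the largest integer below `ε t_j / 2k`. -/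
def raw (j : ℕ) : ℕ := (I.ε.num.toNat * I.dem j - 1) / (I.ε.den * (I.k + I.k))

/-- The granularity to which the contribution of a vertex to colour `j` is recorded: contributions
to small colours are recorded exactly. -/
def unit (j : ℕ) : ℕ := if I.raw j < I.k * d then 1 else I.raw j

/-- The coverage of colour `j` that is required of an output. -/
def thr (j : ℕ) : ℕ :=
  if I.raw j < I.k * d then I.dem j else I.dem j - (I.k + I.k) * I.raw j

/-- The integer `⌊1 / ε⌋ + 1`, which lies between `1 / ε` and `2 / ε`. -/
def inv : ℕ := I.ε.den / I.ε.num.toNat + 1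

/-- The product of `r`, `k`, `d` and the integer `inv` that stands for `1 / ε`. -/
def scale : ℕ := I.r * I.k * d * I.inv

/-- A strict upper bound for all recorded contributions. -/
def base : ℕ := 1 + 4 * (I.scale d * I.k)

/-- The number of layers. -/
def depth : ℕ := 2 ^ (6 * I.scale d)

/-- The number of neighbours of `v` of colour `j` and label `i`. -/
def cnt (lab : Fin I.m → ℕ) (v : Fin I.n) (j i : ℕ) : ℕ :=
  (Finset.univ.filter fun b : Fin I.m => (v, b) ∈ I.E ∧ (I.f b : ℕ) = j ∧ lab b = i).card

/-- The recorded contribution of `v` to colour `j` and label `i`. -/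
def wt (lab : Fin I.m → ℕ) (v : Fin I.n) (j i : ℕ) : ℕ :=
  min (I.cnt lab v j i) (I.dem j) / I.unit d j

end Inst

/-- The number with digits `w 0, …, w (p - 1)` in base `B`, most significant digit first. -/
def horner (B : ℕ) (w : ℕ → ℕ) : ℕ → ℕ
  | 0 => 0
  | p + 1 => horner B w p * B + w p

theorem horner_lt {B : ℕ} {w : ℕ → ℕ} (hw : ∀ p, w p < B) : ∀ p, horner B w p < B ^ p
  | 0 => by simp [horner]
  | p + 1 => by
    have h1 := horner_lt hw p
    have h2 := hw p
    simp only [horner]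
    calc horner B w p * B + w p < horner B w p * B + B := by omega
      _ = (horner B w p + 1) * B := by ring
      _ ≤ B ^ p * B := Nat.mul_le_mul_right _ h1
      _ = B ^ (p + 1) := (pow_succ _ _).symm

theorem horner_inj {B : ℕ} {w w' : ℕ → ℕ} (hw : ∀ p, w p < B) (hw' : ∀ p, w' p < B) :
    ∀ p, horner B w p = horner B w' p → ∀ q < p, w q = w' q
  | 0, _, q, hq => absurd hq (Nat.not_lt_zero q)
  | p + 1, h, q, hq => by
    have hB : 0 < B := (Nat.zero_le _).trans_lt (hw 0)
    simp only [horner] at h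
    have h1 : w p = w' p := by
      have := congrArg (· % B) h
      simpa [Nat.add_mod, Nat.mod_eq_of_lt (hw p),
        Nat.mod_eq_of_lt (hw' p)] using this
    rcases Nat.lt_succ_iff_lt_or_eq.1 hq with hq | rfl
    · refine horner_inj hw hw' p ?_ q hq
      rw [h1] at h
      exact Nat.eq_of_mul_eq_mul_right hB (Nat.add_right_cancel h)
    · exact h1

namespace Inst

variable (I : Inst) (d : ℕ)

/-- The type of a vertex: its recorded contributions to all colours and labels, encoded as a
number. -/
def code (lab : Fin I.m → ℕ) (v : Fin I.n) : ℕ :=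
  horner (I.base d) (fun p => I.wt d lab v (p / I.k) (p % I.k)) (I.r * I.k)

variable {I d}

theorem num_pos : 0 < I.ε.num.toNat := by
  have := Rat.num_pos.2 I.ε_pos
  omega

theorem num_lt_den : I.ε.num.toNat < I.ε.den := by
  have h := I.ε_lt_one
  rw [← Rat.num_lt_denom_iff] at h
  have := I.ε.den_pos
  omega

theorem eps_eq : I.ε = (I.ε.num.toNat : ℚ) / I.ε.den := by
  have h : ((I.ε.num.toNat : ℤ) : ℚ) = I.ε.num := by
    rw [Int.toNat_of_nonneg (Rat.num_pos.2 I.ε_pos).le]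
  rw [← Int.cast_natCast I.ε.num.toNat, h, Rat.num_div_den]

theorem den_le_num_mul_inv : I.ε.den ≤ I.ε.num.toNat * I.inv :=
  (Nat.lt_mul_div_succ _ num_pos).le

/-- The integer `raw + 1` is at least `ε t_j / 2k`. -/
theorem num_mul_dem_le (hk : 0 < I.k) (j : ℕ) :
    I.ε.num.toNat * I.dem j ≤ (I.raw j + 1) * (I.ε.den * (I.k + I.k)) := by
  have hq : 0 < I.ε.den * (I.k + I.k) := Nat.mul_pos I.ε.den_pos (by omega)
  have := Nat.lt_mul_div_succ (I.ε.num.toNat * I.dem j - 1) hq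
  change _ < _ * (I.raw j + 1) at this
  rw [Nat.mul_comm (_ * _)] at this
  omega

/-- The integer `raw` is less than `ε t_j / 2k`. -/
theorem lt_num_mul_dem {j : ℕ} (h : 0 < I.raw j) :
    I.raw j * (I.ε.den * (I.k + I.k)) < I.ε.num.toNat * I.dem j := by
  have h1 := Nat.div_mul_le_self (I.ε.num.toNat * I.dem j - 1) (I.ε.den * (I.k + I.k))
  change I.raw j * _ ≤ _ at h1
  have h2 : I.ε.num.toNat * I.dem j - 1 ≠ 0 := by
    intro h0
    rw [raw, h0, Nat.zero_div] at h
    exact lt_irrefl _ h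
  omega

theorem raw_le (j : ℕ) : I.raw j ≤ I.dem j := by
  rcases Nat.eq_zero_or_pos (I.raw j) with h | h
  · omega
  by_contra! hlt
  have h1 := lt_num_mul_dem h
  have hk : 0 < I.k := by
    by_contra hk
    have : I.k = 0 := by omega
    rw [raw, this] at h
    simp at h
  have h2 : I.ε.num.toNat * I.dem j ≤ I.ε.den * I.raw j :=
    Nat.mul_le_mul num_lt_den.le hlt.le
  have h3 : I.ε.den * I.raw j * 1 ≤ I.ε.den * I.raw j * (I.k + I.k) :=
    Nat.mul_le_mul_left _ (by omega)
  nlinarith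

theorem small_iff (hk : 0 < I.k) (hd : 0 < d) (j : Fin I.r) :
    I.Small d j ↔ I.raw j < I.k * d := by
  have hden : (0 : ℚ) < I.ε.den := by exact_mod_cast I.ε.den_pos
  have hdem : I.dem j = I.t j := by simp [dem]
  have hq : 0 < I.ε.den * (I.k + I.k) := Nat.mul_pos I.ε.den_pos (by omega)
  have hkd : 0 < I.k * d * (I.ε.den * (I.k + I.k)) := Nat.mul_pos (Nat.mul_pos hk hd) hq
  have h1 : I.raw j < I.k * d ↔
      I.ε.num.toNat * I.t j ≤ I.k * d * (I.ε.den * (I.k + I.k)) := by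
    rw [raw, hdem, Nat.div_lt_iff_lt_mul hq]
    omega
  rw [h1, Small, le_div_iff₀ I.ε_pos]
  conv_lhs => rw [eps_eq]
  rw [mul_div_assoc', div_le_iff₀ hden, ← Nat.cast_le (α := ℚ)]
  push_cast
  constructor <;> intro h <;> linarith

/-- Meeting all thresholds is enough, since `2k · raw < ε t_j` for the large colours. -/
theorem good_of_thr_le (hk : 0 < I.k) (hd : 0 < d) {S : Finset (Fin I.n)} (hS : I.Admissible S)
    (h : ∀ j : Fin I.r, I.thr d j ≤ (I.nbr j S).card) : I.Good d S := by
  refine ⟨hS, fun j hj => ?_, fun j hj => ?_⟩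
  · rw [small_iff hk hd] at hj
    have h1 := h j
    rw [thr, if_neg hj] at h1
    have hpos : 0 < I.raw j := (Nat.mul_pos hk hd).trans_le (not_lt.1 hj)
    have h2 := lt_num_mul_dem hpos
    have hden : (0 : ℚ) < I.ε.den := by exact_mod_cast I.ε.den_pos
    have hdem : I.dem j = I.t j := by simp [dem]
    rw [hdem] at h1 h2
    have h3 : I.t j ≤ (I.nbr j S).card + (I.k + I.k) * I.raw j := by omega
    have h4 : ((I.k + I.k : ℕ) * I.raw j : ℚ) ≤ I.ε * I.t j := by
      conv_rhs => rw [eps_eq]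
      rw [div_mul_eq_mul_div, le_div_iff₀ hden]
      have := h2.le
      have h5 : (I.k + I.k) * I.raw j * I.ε.den ≤ I.ε.num.toNat * I.t j := by nlinarith
      exact_mod_cast h5
    have h6 : (I.t j : ℚ) ≤ (I.nbr j S).card + (I.k + I.k : ℕ) * I.raw j := by exact_mod_cast h3
    unfold ApproxCovers
    linarith
  · rw [small_iff hk hd] at hj
    have h1 := h j
    rw [thr, if_pos hj] at h1
    simpa [dem] using h1

theorem Good.approxCovers {S : Finset (Fin I.n)} (h : I.Good d S) (j : Fin I.r) :
    I.ApproxCovers S j := by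
  by_cases hj : I.Small d j
  · have h1 : (I.t j : ℚ) ≤ (I.nbr j S).card := by exact_mod_cast h.2.2 j hj
    have h2 : 0 ≤ I.ε * I.t j := mul_nonneg I.ε_pos.le (Nat.cast_nonneg _)
    unfold ApproxCovers
    linarith
  · exact h.2.1 j hj

theorem unit_pos (hk : 0 < I.k) (hd : 0 < d) (j : ℕ) : 0 < I.unit d j := by
  unfold unit
  split_ifs with h
  · exact Nat.one_pos
  · exact (Nat.mul_pos hk hd).trans_le (not_lt.1 h)

theorem dem_le (hk : 0 < I.k) (j : ℕ) : I.dem j ≤ 2 * I.k * I.inv * (I.raw j + 1) := by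
  have h1 := num_mul_dem_le hk j
  have h2 : (I.raw j + 1) * (I.ε.den * (I.k + I.k)) ≤
      (I.raw j + 1) * (I.ε.num.toNat * I.inv * (I.k + I.k)) :=
    Nat.mul_le_mul_left _ (Nat.mul_le_mul_right _ den_le_num_mul_inv)
  refine Nat.le_of_mul_le_mul_left ?_ (num_pos (I := I))
  nlinarith

theorem inv_pos : 0 < I.inv := Nat.succ_pos _

theorem wt_lt (hk : 0 < I.k) (hr : 0 < I.r) (hd : 0 < d) (lab : Fin I.m → ℕ) (v : Fin I.n)
    (j i : ℕ) : I.wt d lab v j i < I.base d := by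
  have h1 : I.wt d lab v j i ≤ I.dem j / I.unit d j :=
    Nat.div_le_div_right (min_le_right _ _)
  have h2 := dem_le hk j
  have hX := I.inv_pos
  have h4 : I.k * I.inv * (I.k * d) ≤ I.scale d * I.k := by
    unfold scale
    calc I.k * I.inv * (I.k * d) = 1 * (I.k * d * I.inv * I.k) := by ring
      _ ≤ I.r * (I.k * d * I.inv * I.k) := Nat.mul_le_mul_right _ hr
      _ = _ := by ring
  have hkd : 0 < I.k * d := Nat.mul_pos hk hd
  have h6 : I.k * I.inv * 1 ≤ I.k * I.inv * (I.k * d) := Nat.mul_le_mul_left _ hkd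
  have h3 : I.dem j / I.unit d j ≤ 4 * (I.scale d * I.k) := by
    unfold unit
    split_ifs with h
    · rw [Nat.div_one]
      have h5 : 2 * I.k * I.inv * (I.raw j + 1) ≤ 2 * I.k * I.inv * (I.k * d) :=
        Nat.mul_le_mul_left _ h
      nlinarith
    · have hpos : 0 < I.raw j := hkd.trans_le (not_lt.1 h)
      refine Nat.div_le_of_le_mul ?_
      have h5 : 2 * I.k * I.inv * (I.raw j + 1) ≤ 2 * I.k * I.inv * (I.raw j + I.raw j) :=
        Nat.mul_le_mul_left _ (by omega)
      have h7 : I.raw j * (I.k * I.inv) ≤ I.raw j * (I.scale d * I.k) :=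
        Nat.mul_le_mul_left _ (by omega)
      nlinarith
  unfold base
  omega

theorem code_lt (hk : 0 < I.k) (hr : 0 < I.r) (hd : 0 < d) (lab : Fin I.m → ℕ) (v : Fin I.n) :
    I.code d lab v < I.base d ^ (I.r * I.k) :=
  horner_lt (fun _ => wt_lt hk hr hd _ _ _ _) _

theorem wt_eq_of_code_eq (hk : 0 < I.k) (hr : 0 < I.r) (hd : 0 < d) {lab : Fin I.m → ℕ}
    {v v' : Fin I.n} (h : I.code d lab v = I.code d lab v') {j i : ℕ} (hj : j < I.r)
    (hi : i < I.k) : I.wt d lab v j i = I.wt d lab v' j i := by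
  have h1 : j * I.k + i < I.r * I.k := by nlinarith
  have h2 := horner_inj (fun _ => wt_lt hk hr hd _ _ _ _) (fun _ => wt_lt hk hr hd _ _ _ _) _ h _ h1
  have h3 : (j * I.k + i) / I.k = j := by
    rw [mul_comm, Nat.mul_add_div hk, Nat.div_eq_of_lt hi, Nat.add_zero]
  have h4 : (j * I.k + i) % I.k = i := by
    rw [mul_comm, Nat.mul_add_mod, Nat.mod_eq_of_lt hi]
  simpa only [h3, h4] using h2

end Inst

namespace Inst

variable {I : Inst} {d : ℕ}

/-! ### Vertices of large overlap in a biclique-free graph -/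

theorem KFree.pos (hK : I.KFree d) : 0 < d := by
  rcases Nat.eq_zero_or_pos d with rfl | h
  · exact absurd ⟨∅, ∅, by simp⟩ hK
  · exact h

/-- Double counting the pairs of a vertex of `V` and a `d`-subset of its neighbourhood in `Z`: a
`d`-subset belongs to fewer than `d` vertices. -/
theorem KFree.card_mul_choose_le (hK : I.KFree d) (Z : Finset (Fin I.m)) (V : Finset (Fin I.n))
    (c : ℕ) (hV : ∀ v ∈ V, c ≤ (Z.filter fun b => (v, b) ∈ I.E).card) :
    V.card * c.choose d ≤ Z.card.choose d * (d - 1) := by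
  classical
  have h := Finset.sum_card_bipartiteAbove_eq_sum_card_bipartiteBelow
    (s := V) (t := Z.powersetCard d) fun v T => ∀ b ∈ T, (v, b) ∈ I.E
  calc V.card * c.choose d
      ≤ ∑ v ∈ V, ((Z.powersetCard d).bipartiteAbove (fun v T => ∀ b ∈ T, (v, b) ∈ I.E) v).card := by
        rw [← smul_eq_mul]
        refine Finset.card_nsmul_le_sum _ _ _ fun v hv => ?_
        calc c.choose d ≤ (Z.filter fun b => (v, b) ∈ I.E).card.choose d :=
              Nat.choose_le_choose d (hV v hv)
          _ = ((Z.filter fun b => (v, b) ∈ I.E).powersetCard d).card :=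
              (Finset.card_powersetCard _ _).symm
          _ ≤ _ := by
              refine Finset.card_le_card fun T hT => ?_
              rw [Finset.mem_powersetCard] at hT
              rw [Finset.mem_bipartiteAbove, Finset.mem_powersetCard]
              exact ⟨⟨hT.1.trans (Finset.filter_subset _ _), hT.2⟩,
                fun b hb => (Finset.mem_filter.1 (hT.1 hb)).2⟩
    _ = _ := h
    _ ≤ (Z.powersetCard d).card * (d - 1) := by
        rw [← smul_eq_mul]
        refine Finset.sum_le_card_nsmul _ _ _ fun T hT => ?_
        by_contra! hlt
        obtain ⟨X, hX, hXd⟩ := Finset.exists_subset_card_eq (n := d)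
          (s := V.bipartiteBelow (fun v T => ∀ b ∈ T, (v, b) ∈ I.E) T) (by omega)
        exact hK ⟨X, T, hXd, (Finset.mem_powersetCard.1 hT).2, fun a ha =>
          ((Finset.mem_bipartiteBelow _).1 (hX ha)).2⟩
    _ = _ := by rw [Finset.card_powersetCard]

/-- Only few vertices have more than `u` neighbours in a set of size at most `w (u + 1)`. -/
theorem KFree.card_le (hK : I.KFree d) {Z : Finset (Fin I.m)} {V : Finset (Fin I.n)} {u w : ℕ}
    (hu : 2 * d ≤ u) (hZ : Z.card ≤ w * (u + 1))
    (hV : ∀ v ∈ V, u < (Z.filter fun b => (v, b) ∈ I.E).card) :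
    V.card ≤ (2 * w) ^ d * (d - 1) := by
  have h1 := hK.card_mul_choose_le Z V (u + 1) hV
  have h2 : V.card * (u + 1).descFactorial d ≤ Z.card.descFactorial d * (d - 1) := by
    rw [Nat.descFactorial_eq_factorial_mul_choose, Nat.descFactorial_eq_factorial_mul_choose]
    calc _ = d.factorial * (V.card * (u + 1).choose d) := by ring
      _ ≤ d.factorial * (Z.card.choose d * (d - 1)) := Nat.mul_le_mul_left _ h1
      _ = _ := by ring
  have h3 : (u + 1 + 1 - d) ^ d ≤ (u + 1).descFactorial d := Nat.pow_sub_le_descFactorial _ _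
  have h4 : Z.card.descFactorial d ≤ (2 * w) ^ d * (u + 1 + 1 - d) ^ d := by
    refine (Nat.descFactorial_le_pow _ _).trans ?_
    rw [← mul_pow]
    refine Nat.pow_le_pow_left (hZ.trans ?_) d
    calc w * (u + 1) ≤ w * (2 * (u + 1 + 1 - d)) := Nat.mul_le_mul_left _ (by omega)
      _ = _ := by ring
  have h5 : 0 < (u + 1 + 1 - d) ^ d := Nat.pow_pos (by omega)
  refine Nat.le_of_mul_le_mul_right ?_ h5
  calc V.card * (u + 1 + 1 - d) ^ d ≤ V.card * (u + 1).descFactorial d := Nat.mul_le_mul_left _ h3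
    _ ≤ _ := h2
    _ ≤ (2 * w) ^ d * (u + 1 + 1 - d) ^ d * (d - 1) := Nat.mul_le_mul_right _ h4
    _ = _ := by ring

/-- The number of layers exceeds the number of vertices that the layers have to avoid. -/
theorem mul_lt_depth (hk : 0 < I.k) (hr : 0 < I.r) (hd : 0 < d) :
    I.r * ((2 * (2 * I.k * I.inv)) ^ d * (d - 1)) < I.depth d := by
  have hX := I.inv_pos
  have e1 : I.r ≤ I.scale d := by
    have : 1 ≤ I.k * d * I.inv := Nat.mul_pos (Nat.mul_pos hk hd) hX
    unfold scale; nlinarith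
  have e2 : d ≤ I.scale d := by
    have : 1 ≤ I.r * I.k * I.inv := Nat.mul_pos (Nat.mul_pos hr hk) hX
    unfold scale; nlinarith
  have e3 : 2 * (2 * I.k * I.inv) * d ≤ 4 * I.scale d := by
    have : 1 * (I.k * d * I.inv) ≤ I.r * (I.k * d * I.inv) := Nat.mul_le_mul_right _ hr
    unfold scale; nlinarith
  have h1 : I.r < 2 ^ I.scale d := e1.trans_lt Nat.lt_two_pow_self
  have h2 : d - 1 < 2 ^ I.scale d := by
    have := e2.trans_lt (Nat.lt_two_pow_self (n := I.scale d)); omega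
  have h3 : (2 * (2 * I.k * I.inv)) ^ d ≤ 2 ^ (4 * I.scale d) := by
    calc (2 * (2 * I.k * I.inv)) ^ d ≤ (2 ^ (2 * (2 * I.k * I.inv))) ^ d :=
          Nat.pow_le_pow_left Nat.lt_two_pow_self.le d
      _ = 2 ^ (2 * (2 * I.k * I.inv) * d) := (pow_mul _ _ _).symm
      _ ≤ _ := Nat.pow_le_pow_right (by norm_num) e3
  calc I.r * ((2 * (2 * I.k * I.inv)) ^ d * (d - 1))
      ≤ I.r * (2 ^ (4 * I.scale d) * 2 ^ I.scale d) :=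
        Nat.mul_le_mul_left _ (Nat.mul_le_mul h3 h2.le)
    _ < 2 ^ I.scale d * (2 ^ (4 * I.scale d) * 2 ^ I.scale d) :=
        Nat.mul_lt_mul_of_pos_right h1 (by positivity)
    _ = I.depth d := by rw [depth, ← pow_add, ← pow_add]; congr 1; ring

/-! ### Layers of independent sets -/

theorem Admissible.mono {S T : Finset (Fin I.n)} (h : I.Admissible T) (hS : S ⊆ T) :
    I.Admissible S :=
  ⟨(Finset.card_le_card hS).trans h.1, h.2.subset (by exact_mod_cast hS)⟩

theorem admissible_empty : I.Admissible ∅ := ⟨by simp, by simp⟩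

variable (I) in
/-- The vertices of type `κ` in layer `l`. Layer `0` holds the vertices that were not put into any
layer. -/
def layer (code lay : Fin I.n → ℕ) (l κ : ℕ) : Finset (Fin I.n) :=
  Finset.univ.filter fun a => lay a = l ∧ code a = κ

theorem mem_layer {code lay : Fin I.n → ℕ} {l κ : ℕ} {a : Fin I.n} :
    a ∈ I.layer code lay l κ ↔ lay a = l ∧ code a = κ := by
  simp [layer]

variable (I) in
/-- For each type, the layers `1, …, L` are successively chosen maximal admissible sets of
vertices of this type. -/
structure Layered (code lay : Fin I.n → ℕ) (L : ℕ) : Prop where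
  le : ∀ a, lay a ≤ L
  adm : ∀ l κ, 1 ≤ l → I.Admissible (I.layer code lay l κ)
  max : ∀ a, lay a = 0 → ∀ l, 1 ≤ l → l ≤ L →
    ¬ I.Admissible (insert a (I.layer code lay l (code a)))

/-- Each layer of the type of `x` contains a vertex that can replace `x`. -/
theorem Layered.exists_exchange {code lay : Fin I.n → ℕ} {L : ℕ} (h : I.Layered code lay L)
    {Y : Finset (Fin I.n)} {x : Fin I.n} (hxY : x ∉ Y) (hx : I.Admissible (insert x Y))
    (hx0 : lay x = 0) {l : ℕ} (hl : 1 ≤ l) (hlL : l ≤ L) :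
    ∃ a, lay a = l ∧ code a = code x ∧ a ∉ Y ∧ I.Admissible (insert a Y) := by
  classical
  set P := I.layer code lay l (code x) with hP
  have hPadm : I.Admissible P := h.adm l _ hl
  have hmax := h.max x hx0 l hl hlL
  have hcard : Y.card + 1 ≤ I.k := by
    have := hx.1
    rwa [Finset.card_insert_of_notMem hxY] at this
  have hYind : I.M.Indep (Y : Set (Fin I.n)) := hx.2.subset (by simp)
  suffices hs : ∃ a ∈ P, a ∉ Y ∧ I.M.Indep (insert a (Y : Set (Fin I.n))) by
    obtain ⟨a, haP, haY, ha⟩ := hs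
    obtain ⟨h1, h2⟩ := mem_layer.1 haP
    refine ⟨a, h1, h2, haY, ?_, by simpa using ha⟩
    rwa [Finset.card_insert_of_notMem haY]
  have hxE : x ∈ I.M.E := by rw [I.ground_eq]; trivial
  by_cases hPx : I.M.Indep (insert x (P : Set (Fin I.n)))
  · have hPk : I.k ≤ P.card := by
      by_contra! hlt
      refine hmax ⟨?_, by simpa using hPx⟩
      exact (Finset.card_insert_le _ _).trans hlt
    obtain ⟨a, ha, hi⟩ := hYind.augment hPadm.2 (by
      rw [Set.encard_coe_eq_coe_finsetCard, Set.encard_coe_eq_coe_finsetCard]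
      exact_mod_cast (by omega : Y.card < P.card))
    exact ⟨a, by simpa using ha.1, by simpa using ha.2, hi⟩
  · by_contra! hno
    have hsub : (P : Set (Fin I.n)) ⊆ I.M.closure Y := by
      intro a ha
      have haE : a ∈ I.M.E := by rw [I.ground_eq]; trivial
      by_cases haY : a ∈ Y
      · exact I.M.mem_closure_of_mem (by simpa using haY) (by rw [I.ground_eq]; simp)
      · by_contra hcl
        exact hno a (by simpa using ha) haY
          ((hYind.notMem_closure_iff_of_notMem (by simpa using haY) haE).1 hcl)
    have hxcl : x ∈ I.M.closure P := by
      by_contra hcl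
      exact hPx ((hPadm.2.notMem_closure_iff hxE).1 hcl).1
    have hxY' : x ∈ I.M.closure Y := by
      have := I.M.closure_subset_closure_of_subset_closure hsub
      exact this hxcl
    exact ((hYind.notMem_closure_iff_of_notMem (by simpa using hxY) hxE).2
      (by simpa using hx.2)) hxY'

end Inst

namespace Inst

variable {I : Inst} {d : ℕ}

/-! ### Replacing a solution by vertices in layers -/

theorem mem_nbr {j : Fin I.r} {S : Finset (Fin I.n)} {b : Fin I.m} :
    b ∈ I.nbr j S ↔ I.f b = j ∧ ∃ a ∈ S, (a, b) ∈ I.E := by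
  simp [nbr]

theorem nbr_mono (j : Fin I.r) {S T : Finset (Fin I.n)} (h : S ⊆ T) : I.nbr j S ⊆ I.nbr j T := by
  intro b hb
  obtain ⟨h1, a, ha, h2⟩ := mem_nbr.1 hb
  exact mem_nbr.2 ⟨h1, a, h ha, h2⟩

theorem nbr_insert (j : Fin I.r) (a : Fin I.n) (S : Finset (Fin I.n)) :
    I.nbr j (insert a S) = I.nbr j {a} ∪ I.nbr j S := by
  ext b
  simp only [mem_nbr, Finset.mem_union, Finset.mem_insert, Finset.mem_singleton]
  constructor
  · rintro ⟨h, c, rfl | hc, hcb⟩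
    · exact Or.inl ⟨h, _, rfl, hcb⟩
    · exact Or.inr ⟨h, c, hc, hcb⟩
  · rintro (⟨h, c, rfl, hcb⟩ | ⟨h, c, hc, hcb⟩)
    · exact ⟨h, _, Or.inl rfl, hcb⟩
    · exact ⟨h, c, Or.inr hc, hcb⟩

theorem card_nbr_insert (j : Fin I.r) (a : Fin I.n) (S : Finset (Fin I.n)) :
    (I.nbr j (insert a S)).card + ((I.nbr j S).filter fun b => (a, b) ∈ I.E).card =
      (I.nbr j {a}).card + (I.nbr j S).card := by
  rw [nbr_insert, ← Finset.card_union_add_card_inter (I.nbr j {a})]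
  congr 2
  ext b
  simp only [mem_nbr, Finset.mem_inter, Finset.mem_filter, Finset.mem_singleton, exists_eq_left]
  tauto

/-- Labels that ignore large colours: the vertices of large colours have label `0`. -/
def LabelsSmall (I : Inst) (d : ℕ) (lab : Fin I.m → ℕ) : Prop :=
  ∀ b, ¬ I.raw (I.f b) < I.k * d → lab b = 0

/-- Vertices of the same type have almost the same number of neighbours of a large colour. -/
theorem min_card_nbr_le (hk : 0 < I.k) (hr : 0 < I.r) (hd : 0 < d) {lab : Fin I.m → ℕ}
    (hlab : I.LabelsSmall d lab) {x a : Fin I.n} (h : I.code d lab a = I.code d lab x)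
    {j : Fin I.r} (hj : ¬ I.raw j < I.k * d) :
    min (I.nbr j {x}).card (I.dem j) ≤ (I.nbr j {a}).card + I.raw j := by
  have hc : ∀ v, I.cnt lab v j 0 = (I.nbr j {v}).card := by
    intro v
    unfold cnt
    congr 1
    ext b
    simp only [Finset.mem_filter, Finset.mem_univ, true_and, mem_nbr, Finset.mem_singleton,
      exists_eq_left, Fin.val_inj]
    constructor
    · rintro ⟨h1, h2, -⟩; exact ⟨h2, h1⟩
    · rintro ⟨h2, h1⟩
      exact ⟨h1, h2, hlab b (by rwa [h2])⟩
  have hpos : 0 < I.raw j := (Nat.mul_pos hk hd).trans_le (not_lt.1 hj)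
  have h1 := wt_eq_of_code_eq hk hr hd h j.2 hk
  simp only [wt, hc, unit, if_neg hj] at h1
  have h2 := Nat.lt_mul_div_succ (min (I.nbr j {x}).card (I.dem j)) hpos
  rw [← h1, Nat.mul_succ] at h2
  have h3 := Nat.mul_div_le (min (I.nbr j {a}).card (I.dem j)) (I.raw j)
  have h4 := min_le_left (I.nbr j {a}).card (I.dem j)
  omega

/-- A vertex of a solution can be replaced by a vertex of the same type in some layer, at a small
loss in the large colours: there are more layers than vertices with a large overlap with the rest
of the solution. -/
theorem exists_replacement (hk : 0 < I.k) (hr : 0 < I.r) (hK : I.KFree d) {lab : Fin I.m → ℕ}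
    (hlab : I.LabelsSmall d lab) {lay : Fin I.n → ℕ}
    (h : I.Layered (I.code d lab) lay (I.depth d)) {Y : Finset (Fin I.n)} {x : Fin I.n}
    (hxY : x ∉ Y) (hx : I.Admissible (insert x Y)) (hx0 : lay x = 0) :
    ∃ a, lay a ≠ 0 ∧ I.code d lab a = I.code d lab x ∧ a ∉ Y ∧ I.Admissible (insert a Y) ∧
      ∀ j : Fin I.r, ¬ I.raw j < I.k * d →
        min (I.nbr j (insert x Y)).card (I.dem j) ≤
          (I.nbr j (insert a Y)).card + 2 * I.raw j := by
  classical
  have hd := hK.pos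
  have hex : ∀ l : ℕ, ∃ a, 1 ≤ l → l ≤ I.depth d →
      lay a = l ∧ I.code d lab a = I.code d lab x ∧ a ∉ Y ∧ I.Admissible (insert a Y) := by
    intro l
    by_cases hl : 1 ≤ l ∧ l ≤ I.depth d
    · obtain ⟨a, ha⟩ := h.exists_exchange hxY hx hx0 hl.1 hl.2
      exact ⟨a, fun _ _ => ha⟩
    · exact ⟨x, fun h1 h2 => absurd ⟨h1, h2⟩ hl⟩
  choose u hu using hex
  have hinj : Set.InjOn u (Finset.Icc 1 (I.depth d) : Set ℕ) := by
    intro l hl l' hl' he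
    simp only [Finset.coe_Icc, Set.mem_Icc] at hl hl'
    rw [← (hu l hl.1 hl.2).1, ← (hu l' hl'.1 hl'.2).1, he]
  have hcard : ((Finset.Icc 1 (I.depth d)).image u).card = I.depth d := by
    rw [Finset.card_image_of_injOn hinj, Nat.card_Icc, Nat.add_sub_cancel]
  set bad : Fin I.r → Finset (Fin I.n) := fun j =>
    Finset.univ.filter fun v => ¬ I.raw j < I.k * d ∧ (I.nbr j Y).card < I.dem j ∧
      I.raw j < ((I.nbr j Y).filter fun b => (v, b) ∈ I.E).card with hbad
  have hbadcard : ∀ j, (bad j).card ≤ (2 * (2 * I.k * I.inv)) ^ d * (d - 1) := by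
    intro j
    by_cases hj : ¬ I.raw j < I.k * d ∧ (I.nbr j Y).card < I.dem j
    swap
    · rw [Finset.card_eq_zero.2 (Finset.filter_eq_empty_iff.2 fun v _ hv => hj ⟨hv.1, hv.2.1⟩)]
      exact Nat.zero_le _
    have hYk : Y.card + 1 ≤ I.k := by
      have := hx.1
      rwa [Finset.card_insert_of_notMem hxY] at this
    rcases Nat.lt_or_ge I.k 2 with hk2 | hk2
    -- for `k = 1` nothing is left of the solution, and there is no overlap
    · have hY : Y = ∅ := Finset.card_eq_zero.1 (by omega)
      rw [Finset.card_eq_zero.2 (Finset.filter_eq_empty_iff.2 fun v _ hv => ?_)]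
      · exact Nat.zero_le _
      · have := hv.2.2
        simp [hY, nbr] at this
    -- for `k ≥ 2` a large colour has `raw ≥ k d ≥ 2 d`
    · refine hK.card_le (Z := I.nbr j Y) (u := I.raw j) ?_ (hj.2.le.trans (dem_le hk j))
        fun v hv => (Finset.mem_filter.1 hv).2.2.2
      exact (Nat.mul_le_mul_right d hk2).trans (not_lt.1 hj.1)
  have hall : (Finset.univ.biUnion bad).card < I.depth d := by
    refine (Finset.card_biUnion_le.trans ?_).trans_lt (mul_lt_depth hk hr hd)
    refine (Finset.sum_le_card_nsmul _ _ _ fun j _ => hbadcard j).trans ?_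
    simp
  obtain ⟨a, ha, hna⟩ := Finset.exists_mem_notMem_of_card_lt_card (hall.trans_eq hcard.symm)
  obtain ⟨l, hl, rfl⟩ := Finset.mem_image.1 ha
  rw [Finset.mem_Icc] at hl
  obtain ⟨hal, hac, haY, haadm⟩ := hu l hl.1 hl.2
  refine ⟨u l, by omega, hac, haY, haadm, fun j hj => ?_⟩
  rcases Nat.lt_or_ge (I.nbr j Y).card (I.dem j) with hlt | hge
  · have h1 : ¬ I.raw j < ((I.nbr j Y).filter fun b => (u l, b) ∈ I.E).card := by
      intro hov
      exact hna (Finset.mem_biUnion.2 ⟨j, Finset.mem_univ _,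
        Finset.mem_filter.2 ⟨Finset.mem_univ _, hj, hlt, hov⟩⟩)
    have h2 := card_nbr_insert j (u l) Y
    have h3 := card_nbr_insert j x Y
    have h4 := min_card_nbr_le hk hr hd hlab hac hj
    omega
  · have := Finset.card_le_card (nbr_mono j (Finset.subset_insert (u l) Y))
    omega

/-- The vertices of a solution are replaced one at a time. -/
theorem exists_transversal (hk : 0 < I.k) (hr : 0 < I.r) (hK : I.KFree d) {lab : Fin I.m → ℕ}
    (hlab : I.LabelsSmall d lab) {lay : Fin I.n → ℕ}
    (h : I.Layered (I.code d lab) lay (I.depth d)) {p : ℕ} {v : Fin p → Fin I.n}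
    (hv : Function.Injective v) (hadm : I.Admissible (Finset.univ.image v)) :
    ∀ T ≤ p, ∃ x : Fin p → Fin I.n, Function.Injective x ∧ I.Admissible (Finset.univ.image x) ∧
      (∀ i, I.code d lab (x i) = I.code d lab (v i)) ∧ (∀ i : Fin p, (i : ℕ) < T → lay (x i) ≠ 0) ∧
      ∀ j : Fin I.r, ¬ I.raw j < I.k * d →
        min (I.nbr j (Finset.univ.image v)).card (I.dem j) ≤
          (I.nbr j (Finset.univ.image x)).card + 2 * I.raw j * T
  | 0, _ => ⟨v, hv, hadm, fun _ => rfl, fun i hi => absurd hi (Nat.not_lt_zero _), fun j _ =>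
      (min_le_left _ _).trans (Nat.le_add_right _ _)⟩
  | T + 1, hT => by
    classical
    obtain ⟨x, hxi, hxa, hxc, hxl, hxn⟩ :=
      exists_transversal hk hr hK hlab h hv hadm T (Nat.le_of_succ_le hT)
    set i₀ : Fin p := ⟨T, hT⟩ with hi₀
    by_cases h0 : lay (x i₀) = 0
    swap
    · refine ⟨x, hxi, hxa, hxc, fun i hi => ?_, fun j hj => (hxn j hj).trans ?_⟩
      · rcases Nat.lt_succ_iff_lt_or_eq.1 hi with hi | hi
        · exact hxl i hi
        · obtain rfl : i = i₀ := Fin.ext hi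
          exact h0
      · exact Nat.add_le_add_left (Nat.mul_le_mul_left _ (Nat.le_succ T)) _
    set Y := (Finset.univ.erase i₀).image x with hY
    have hins : ∀ y : Fin p → Fin I.n, (∀ i, i ≠ i₀ → y i = x i) →
        Finset.univ.image y = insert (y i₀) Y := by
      intro y hy
      rw [← Finset.insert_erase (Finset.mem_univ i₀), Finset.image_insert, hY,
        Finset.image_congr fun i hi => hy i (Finset.ne_of_mem_erase hi)]
    have hxY : x i₀ ∉ Y := by
      rw [hY, Finset.mem_image]
      rintro ⟨i, hi, he⟩
      exact Finset.ne_of_mem_erase hi (hxi he)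
    obtain ⟨a, hal, hac, haY, haa, han⟩ := exists_replacement hk hr hK hlab h hxY
      (by rw [← hins x fun _ _ => rfl]; exact hxa) h0
    have hup : Finset.univ.image (Function.update x i₀ a) = insert a Y := by
      rw [hins _ fun i hi => Function.update_of_ne hi _ _, Function.update_self]
    refine ⟨Function.update x i₀ a, ?_, by rwa [hup], fun i => ?_, fun i hi => ?_, fun j hj => ?_⟩
    · have hne : ∀ i, i ≠ i₀ → x i ≠ a := fun i hi he =>
        haY (he ▸ Finset.mem_image_of_mem x (Finset.mem_erase.2 ⟨hi, Finset.mem_univ _⟩))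
      intro i i' he
      by_cases hi : i = i₀ <;> by_cases hi' : i' = i₀
      · rw [hi, hi']
      · subst hi
        rw [Function.update_self, Function.update_of_ne hi'] at he
        exact absurd he.symm (hne i' hi')
      · subst hi'
        rw [Function.update_self, Function.update_of_ne hi] at he
        exact absurd he (hne i hi)
      · rw [Function.update_of_ne hi, Function.update_of_ne hi'] at he
        exact hxi he
    · by_cases hi : i = i₀
      · subst hi
        rw [Function.update_self, hac, hxc]
      · rw [Function.update_of_ne hi, hxc]
    · by_cases hi' : i = i₀
      · subst hi'
        rwa [Function.update_self]
      · rw [Function.update_of_ne hi']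
        refine hxl i (lt_of_le_of_ne (Nat.le_of_lt_succ hi) fun he => hi' (Fin.ext he))
    · have h1 := hxn j hj
      have h2 := han j hj
      rw [← hins x fun _ _ => rfl] at h2
      rw [hup]
      have h3 : 2 * I.raw j * (T + 1) = 2 * I.raw j * T + 2 * I.raw j := by ring
      omega

/-- A solution `v` together with, for every small colour, as many witnesses of its coverage as are
demanded, each of them assigned to the index of a vertex that covers it. -/
structure Witness (I : Inst) (d : ℕ) where
  p : ℕ
  v : Fin p → Fin I.n
  inj : Function.Injective v
  adm : I.Admissible (Finset.univ.image v)
  dem_le : ∀ j : Fin I.r, I.dem j ≤ (I.nbr j (Finset.univ.image v)).card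
  W : Finset (Fin I.m)
  idx : Fin I.m → ℕ
  idx_spec : ∀ b ∈ W, ∃ i : Fin p, idx b = i ∧ (v i, b) ∈ I.E
  card_W : ∀ j : Fin I.r, I.raw j < I.k * d → (W.filter fun b => I.f b = j).card = I.dem j
  small : ∀ b ∈ W, I.raw (I.f b) < I.k * d

theorem Witness.p_le (w : I.Witness d) : w.p ≤ I.k := by
  have := w.adm.1
  rwa [Finset.card_image_of_injective _ w.inj, Finset.card_univ, Fintype.card_fin] at this

theorem IsYes.nonempty_witness (h : I.IsYes) : Nonempty (I.Witness d) := by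
  classical
  obtain ⟨S, hS, hcov⟩ := h
  set e := S.equivFin with he
  have himg : (Finset.univ.image fun i => ((e.symm i : S) : Fin I.n)) = S := by
    ext a
    simp only [Finset.mem_image, Finset.mem_univ, true_and]
    exact ⟨fun ⟨i, hi⟩ => hi ▸ (e.symm i).2, fun ha => ⟨e ⟨a, ha⟩, by simp⟩⟩
  have hcov' : ∀ j : Fin I.r, I.dem j ≤ (I.nbr j S).card := fun j => by
    simpa [dem] using hcov j
  choose U hU hUc using fun j : Fin I.r => Finset.exists_subset_card_eq (hcov' j)
  have hidx : ∀ b : Fin I.m, ∃ i : ℕ, b ∈ I.nbr (I.f b) S →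
      ∃ i' : Fin S.card, i = i' ∧ (((e.symm i' : S) : Fin I.n), b) ∈ I.E := by
    intro b
    by_cases hb : b ∈ I.nbr (I.f b) S
    · obtain ⟨-, a, ha, hab⟩ := mem_nbr.1 hb
      exact ⟨e ⟨a, ha⟩, fun _ => ⟨e ⟨a, ha⟩, rfl, by simpa using hab⟩⟩
    · exact ⟨0, fun h => absurd h hb⟩
  choose idx hidx using hidx
  have hUf : ∀ j, ∀ b ∈ U j, I.f b = j := fun j b hb => (mem_nbr.1 (hU j hb)).1
  refine ⟨⟨S.card, fun i => e.symm i, fun i i' h => e.symm.injective (Subtype.ext h), ?_, ?_,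
    Finset.univ.filter fun b => b ∈ U (I.f b) ∧ I.raw (I.f b) < I.k * d, idx, ?_, ?_, ?_⟩⟩
  · rwa [himg]
  · rwa [himg]
  · intro b hb
    exact hidx b (hU _ (Finset.mem_filter.1 hb).2.1)
  · intro j hj
    rw [← hUc j]
    congr 1
    ext b
    simp only [Finset.mem_filter, Finset.mem_univ, true_and]
    constructor
    · rintro ⟨⟨h1, -⟩, rfl⟩; exact h1
    · intro hb
      obtain rfl := hUf j b hb
      exact ⟨⟨hb, hj⟩, rfl⟩
  · intro b hb
    exact (Finset.mem_filter.1 hb).2.2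

/-- If the labels agree with the assignment of the witnesses, then the layers contain a set that
meets all thresholds. For the small colours this holds since vertices of the same type have the
same number of neighbours with the label of their index, and neighbourhoods restricted to different
labels are disjoint. -/
theorem Witness.exists_thr_le (w : I.Witness d) (hk : 0 < I.k) (hr : 0 < I.r) (hK : I.KFree d)
    {lab : Fin I.m → ℕ} (hlab : I.LabelsSmall d lab) (hw : ∀ b ∈ w.W, lab b = w.idx b)
    {lay : Fin I.n → ℕ} (h : I.Layered (I.code d lab) lay (I.depth d)) :
    ∃ x : Fin w.p → Fin I.n, (∀ i, lay (x i) ≠ 0) ∧ I.Admissible (Finset.univ.image x) ∧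
      ∀ j : Fin I.r, I.thr d j ≤ (I.nbr j (Finset.univ.image x)).card := by
  classical
  obtain ⟨x, -, hxa, hxc, hxl, hxn⟩ :=
    exists_transversal hk hr hK hlab h w.inj w.adm w.p le_rfl
  refine ⟨x, fun i => hxl i i.2, hxa, fun j => ?_⟩
  unfold thr
  split_ifs with hj
  -- a small colour: `N y i` is the part with label `i` of the neighbourhood of `y i`
  · set N : (Fin w.p → Fin I.n) → Fin w.p → Finset (Fin I.m) := fun y i =>
      Finset.univ.filter fun b => (y i, b) ∈ I.E ∧ (I.f b : ℕ) = j ∧ lab b = i with hN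
    have h1 : ∑ i, (N x i).card ≤ (I.nbr j (Finset.univ.image x)).card := by
      rw [← Finset.card_biUnion]
      · refine Finset.card_le_card fun b hb => ?_
        obtain ⟨i, -, hi⟩ := Finset.mem_biUnion.1 hb
        obtain ⟨-, h1, h2, -⟩ := Finset.mem_filter.1 hi
        exact mem_nbr.2 ⟨Fin.ext h2, x i, Finset.mem_image_of_mem _ (Finset.mem_univ _), h1⟩
      · intro i _ i' _ hne
        rw [Function.onFun, Finset.disjoint_left]
        intro b hb hb'
        have e1 := (Finset.mem_filter.1 hb).2.2.2
        have e2 := (Finset.mem_filter.1 hb').2.2.2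
        exact hne (Fin.ext (e1.symm.trans e2))
    have h2 : I.dem j ≤ ∑ i, (N w.v i).card := by
      rw [← w.card_W j hj]
      refine (Finset.card_le_card fun b hb => ?_).trans Finset.card_biUnion_le
      obtain ⟨hb, hbj⟩ := Finset.mem_filter.1 hb
      obtain ⟨i, hi, hadj⟩ := w.idx_spec b hb
      exact Finset.mem_biUnion.2 ⟨i, Finset.mem_univ _, Finset.mem_filter.2
        ⟨Finset.mem_univ _, hadj, by rw [hbj], by rw [hw b hb, hi]⟩⟩
    have h3 : ∀ i, min (N x i).card (I.dem j) = min (N w.v i).card (I.dem j) := by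
      intro i
      have := wt_eq_of_code_eq hk hr hK.pos (hxc i) j.2 (i.2.trans_le w.p_le)
      simpa [wt, unit, hj, Nat.div_one, cnt] using this
    by_cases hbig : ∃ i, I.dem j ≤ (N x i).card
    · obtain ⟨i, hi⟩ := hbig
      exact hi.trans ((Finset.single_le_sum (f := fun i => (N x i).card)
        (fun _ _ => Nat.zero_le _) (Finset.mem_univ i)).trans h1)
    · push Not at hbig
      refine h2.trans (le_trans (le_of_eq (Finset.sum_congr rfl fun i _ => ?_)) h1)
      have e1 := h3 i
      have e2 := hbig i
      omega
  · have h1 := hxn j hj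
    rw [min_eq_right (w.dem_le j)] at h1
    have h2 : 2 * I.raw j * w.p ≤ 2 * I.raw j * I.k := Nat.mul_le_mul_left _ w.p_le
    have h3 : (I.k + I.k) * I.raw j = 2 * I.raw j * I.k := by ring
    omega

theorem Witness.card_W_eq_sum (w : I.Witness d) :
    w.W.card = ∑ j : Fin I.r, if I.raw j < I.k * d then I.dem j else 0 := by
  classical
  rw [Finset.card_eq_sum_card_fiberwise (f := I.f) (t := Finset.univ) fun _ _ => by simp]
  refine Finset.sum_congr rfl fun j _ => ?_
  split_ifs with hj
  · exact w.card_W j hj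
  · refine Finset.card_eq_zero.2 (Finset.filter_eq_empty_iff.2 fun b hb he => hj ?_)
    rw [← he]
    exact w.small b hb

/-- There are few witnesses, since they belong to small colours. -/
theorem Witness.card_mul_le (w : I.Witness d) (hk : 0 < I.k) (hd : 0 < d) :
    ((I.k * w.W.card : ℕ) : ℚ) ≤ 2 * (I.k : ℚ) ^ 3 * d * I.r / I.ε := by
  have h1 : (w.W.card : ℚ) ≤ I.r * (2 * (I.k : ℚ) ^ 2 * d / I.ε) := by
    rw [w.card_W_eq_sum, Nat.cast_sum]
    refine (Finset.sum_le_card_nsmul _ _ (2 * (I.k : ℚ) ^ 2 * d / I.ε) fun j _ => ?_).trans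
      (by simp)
    split_ifs with hj
    · have := (small_iff hk hd j).2 hj
      simpa [dem, Small] using this
    · have := I.ε_pos
      simp only [Nat.cast_zero]
      positivity
  push_cast
  calc (I.k : ℚ) * w.W.card ≤ I.k * (I.r * (2 * (I.k : ℚ) ^ 2 * d / I.ε)) :=
        mul_le_mul_of_nonneg_left h1 (Nat.cast_nonneg _)
    _ = _ := by ring

end Inst

/-! ### Memory layout -/

/-! The arrays are named by their numbers. Names in `v` denote arrays of which only entry `0` is
used, as a scalar variable: counters of loops (`vI` for labels, `vJ` for colours, `vU` and `vV` for
vertices of `A`, `vB` for vertices of `B`, `vL` for layers, `vC` for tuples), parameters of the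
instance, and intermediate results. Names in `a` denote arrays indexed by colours (`aUnit`, `aThr`,
`aLarge`, `aCov`), by vertices of `B` (`aLab`), by vertices of `A` (`aCode`, `aLay` and the query
`aQuery`), or by positions (`aList`, the list of the `vLen` vertices in layers). -/

notation "vTmp" => (10 : ℕ)
notation "vInv" => (11 : ℕ)
notation "vAcc" => (12 : ℕ)
notation "vScale" => (13 : ℕ)
notation "vBase" => (14 : ℕ)
notation "vDepth" => (15 : ℕ)
notation "vQuot" => (16 : ℕ)
notation "vSmall" => (17 : ℕ)
notation "vI" => (18 : ℕ)
notation "vJ" => (19 : ℕ)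
notation "vU" => (20 : ℕ)
notation "vB" => (21 : ℕ)
notation "vRaw" => (22 : ℕ)
notation "vCoin" => (23 : ℕ)
notation "vOff" => (24 : ℕ)
notation "vCnt" => (25 : ℕ)
notation "vLen" => (26 : ℕ)
notation "vAns" => (27 : ℕ)
notation "vBad" => (28 : ℕ)
notation "vTuples" => (29 : ℕ)
notation "vV" => (30 : ℕ)
notation "vL" => (31 : ℕ)
notation "vWidth" => (32 : ℕ)
notation "vC" => (33 : ℕ)
notation "aUnit" => (40 : ℕ)
notation "aThr" => (41 : ℕ)
notation "aLarge" => (42 : ℕ)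
notation "aLab" => (43 : ℕ)
notation "aCode" => (44 : ℕ)
notation "aLay" => (45 : ℕ)
notation "aList" => (46 : ℕ)
notation "aQuery" => (47 : ℕ)
notation "aCov" => (48 : ℕ)

/-- The number `n` of vertices of `A`, read from the input. -/
def eN : Expr := Expr.get 0 (lit 0)
/-- The number `m` of vertices of `B`, read from the input. -/
def eM : Expr := Expr.get 0 (lit 1)
/-- The number `r` of colours, read from the input. -/
def eR : Expr := Expr.get 0 (lit 2)
/-- The budget `k`, read from the input. -/
def eK : Expr := Expr.get 0 (lit 3)
/-- The parameter `d`, read from the input. -/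
def eD : Expr := Expr.get 0 (lit 4)
/-- The numerator of `ε`, read from the input. -/
def eNum : Expr := Expr.get 0 (lit 5)
/-- The denominator of `ε`, read from the input. -/
def eDen : Expr := Expr.get 0 (lit 6)

@[simp] theorem eval_eN (s : State) : eN.eval s = s.arr 0 0 := rfl
@[simp] theorem eval_eM (s : State) : eM.eval s = s.arr 0 1 := rfl
@[simp] theorem eval_eR (s : State) : eR.eval s = s.arr 0 2 := rfl
@[simp] theorem eval_eK (s : State) : eK.eval s = s.arr 0 3 := rfl
@[simp] theorem eval_eD (s : State) : eD.eval s = s.arr 0 4 := rfl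
@[simp] theorem eval_eNum (s : State) : eNum.eval s = s.arr 0 5 := rfl
@[simp] theorem eval_eDen (s : State) : eDen.eval s = s.arr 0 6 := rfl

/-- The input arrays still hold the instance. -/
structure Reads (I : Inst) (d : ℕ) (s : State) : Prop where
  n : s.arr 0 0 = I.n
  m : s.arr 0 1 = I.m
  r : s.arr 0 2 = I.r
  k : s.arr 0 3 = I.k
  d : s.arr 0 4 = d
  num : s.arr 0 5 = I.ε.num.toNat
  den : s.arr 0 6 = I.ε.den
  dem : ∀ j, s.arr 1 j = I.dem j
  col : ∀ b : Fin I.m, s.arr 2 b = I.f b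
  adj : ∀ (a : Fin I.n) (b : Fin I.m), s.arr 3 (a * I.m + b) = if (a, b) ∈ I.E then 1 else 0

theorem reads_init (I : Inst) (d : ℕ) : Reads I d (I.init d) where
  n := rfl
  m := rfl
  r := rfl
  k := rfl
  d := rfl
  num := rfl
  den := rfl
  dem _ := rfl
  col b := by simp [Inst.init]
  adj a b := by
    have key : (∃ e ∈ I.E, (a : ℕ) * I.m + b = (e.1 : ℕ) * I.m + (e.2 : ℕ)) ↔ (a, b) ∈ I.E := by
      constructor
      · rintro ⟨⟨a', b'⟩, he, h⟩
        have hm : 0 < I.m := (Nat.zero_le _).trans_lt b.2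
        have h1 := congrArg (· / I.m) h
        have h2 := congrArg (· % I.m) h
        simp only [mul_comm _ I.m, Nat.mul_add_div hm, Nat.mul_add_mod, Nat.div_eq_of_lt b.2,
          Nat.div_eq_of_lt b'.2, Nat.mod_eq_of_lt b.2, Nat.mod_eq_of_lt b'.2, add_zero] at h1 h2
        rwa [Fin.ext h1, Fin.ext h2]
      · exact fun h => ⟨(a, b), h, rfl⟩
    simp only [Inst.init, key]

theorem Reads.congr {I : Inst} {d : ℕ} {s s' : State} (h : Reads I d s) (h0 : s'.arr 0 = s.arr 0)
    (h1 : s'.arr 1 = s.arr 1) (h2 : s'.arr 2 = s.arr 2) (h3 : s'.arr 3 = s.arr 3) :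
    Reads I d s' := by
  constructor <;> simp only [h0, h1, h2, h3]
  exacts [h.n, h.m, h.r, h.k, h.d, h.num, h.den, h.dem, h.col, h.adj]

/-- `G` bounds the number of iterations of all loops. -/
structure Big (I : Inst) (d G : ℕ) : Prop where
  n : I.n ≤ G
  m : I.m ≤ G
  r : I.r ≤ G
  k : I.k + I.k ≤ G
  inv : I.inv ≤ G
  scale : 6 * I.scale d ≤ G
  depth : I.depth d ≤ G
  base : I.base d ≤ G
  deg : d ≤ G
  tuples : (I.k * I.depth d * I.base d ^ (I.r * I.k) + 1) ^ I.k ≤ G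

/-! ### Parameters, units and thresholds -/

/-- Computes `base` (`vBase`), `depth` (`vDepth`), the denominator `2k · den` of `raw` (`vQuot`)
and the bound `k d` by which small colours are recognized (`vSmall`). -/
def paramsP : Prog :=
  divP vTmp vInv eDen eNum ;; put vInv (var vInv + lit 1) ;;
  mulP vTmp vAcc eR eK ;; mulP vTmp vRaw (var vAcc) eD ;; mulP vTmp vScale (var vRaw) (var vInv) ;;
  mulP vTmp vAcc (var vScale) eK ;;
  put vBase (lit 1 + (var vAcc + var vAcc + (var vAcc + var vAcc))) ;;
  mulP vTmp vQuot eDen (eK + eK) ;; mulP vTmp vSmall eK eD ;; put vDepth (lit 1) ;;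
  forP vI (var vScale + var vScale + (var vScale + var vScale) + (var vScale + var vScale))
    (put vDepth (var vDepth + var vDepth))

/-- Computes units and thresholds and marks the large colours. -/
def unitsP : Prog :=
  forP vJ eR
    (mulP vTmp vAcc eNum (Expr.get 1 (var vJ)) ;;
    divP vTmp vRaw (var vAcc - lit 1) (var vQuot) ;;
    mulP vTmp vAcc (eK + eK) (var vRaw) ;;
    Prog.ite (var vRaw) (var vSmall)
      (Prog.assign aUnit (var vJ) (lit 1) ;;
        Prog.assign aThr (var vJ) (Expr.get 1 (var vJ)) ;;
        Prog.assign aLarge (var vJ) (lit 0))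
      (Prog.assign aUnit (var vJ) (var vRaw) ;;
        Prog.assign aThr (var vJ) (Expr.get 1 (var vJ) - var vAcc) ;;
        Prog.assign aLarge (var vJ) (lit 1)))

section

variable {O : (ℕ → ℕ) → Bool} {ω : ℕ → Bool} {G : ℕ} {I : Inst} {d : ℕ} {s : State}

theorem runs_paramsP (h : Reads I d s) (hG : Big I d G) :
    Runs O ω G paramsP s fun s' =>
      s'.arr vBase 0 = I.base d ∧ s'.arr vDepth 0 = I.depth d ∧
      s'.arr vQuot 0 = I.ε.den * (I.k + I.k) ∧ s'.arr vSmall 0 = I.k * d := by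
  have hinv : I.ε.den / I.ε.num.toNat + 1 ≤ G := hG.inv
  have hk := hG.k
  unfold paramsP
  refine Runs.seq (Runs.divP rfl rfl rfl ?_ ?_ ?_)
  · simpa [h.num] using Inst.num_pos (I := I)
  · simp only [eval_eDen, eval_eNum, h.den, h.num]; omega
  refine Runs.seq (Runs.put (Runs.seq (Runs.mulP rfl rfl rfl ?_ ?_)))
  · simp [h.k]; omega
  refine Runs.seq (Runs.mulP rfl rfl rfl ?_ ?_)
  · simpa [h.d] using hG.deg
  refine Runs.seq (Runs.mulP rfl rfl rfl ?_ ?_)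
  · simpa [h.den, h.num] using hinv
  refine Runs.seq (Runs.mulP rfl rfl rfl ?_ ?_)
  · simp [h.k]; omega
  refine Runs.seq (Runs.put (Runs.seq (Runs.mulP rfl rfl rfl ?_ ?_)))
  · simpa [h.k] using hG.k
  refine Runs.seq (Runs.mulP rfl rfl rfl ?_ ?_)
  · simpa [h.d] using hG.deg
  refine Runs.seq (Runs.put ?_)
  refine Runs.forP (N := 6 * I.scale d) (fun i s' => s'.arr vDepth 0 = 2 ^ i) rfl rfl ?_
    hG.scale ?_ ?_ ?_
  · simp [h.den, h.num, h.k, h.d, h.r, Inst.scale, Inst.inv]; ring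
  · simp
  · intro i s₁ hi hf hx hI
    refine Runs.put ?_
    simp [hI, pow_succ]; ring
  · intro s₁ hf hI
    refine ⟨?_, hI, ?_, ?_⟩
    · rw [hf vBase rfl]
      simp [h.den, h.num, h.k, h.d, h.r, Inst.scale, Inst.inv, Inst.base]; ring
    · rw [hf vQuot rfl]
      simp [h.den, h.k]
    · rw [hf vSmall rfl]
      simp [h.d, h.k]

theorem runs_unitsP (h : Reads I d s) (hG : Big I d G) (hk : 0 < I.k)
    (hdem : ∀ j, I.dem j ≤ I.m)
    (hq : s.arr vQuot 0 = I.ε.den * (I.k + I.k)) (hs : s.arr vSmall 0 = I.k * d) :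
    Runs O ω G unitsP s fun s' => ∀ j < I.r, s'.arr aUnit j = I.unit d j ∧
      s'.arr aThr j = I.thr d j ∧ s'.arr aLarge j = if I.raw j < I.k * d then 0 else 1 := by
  unfold unitsP
  refine Runs.forP (N := I.r) (fun i s' => ∀ j < i, s'.arr aUnit j = I.unit d j ∧
    s'.arr aThr j = I.thr d j ∧ s'.arr aLarge j = if I.raw j < I.k * d then 0 else 1)
    rfl rfl (by simp [h.r]) hG.r (fun j hj => absurd hj (Nat.not_lt_zero j)) ?_ fun _ _ hI => hI
  intro i s₁ hi hf hx hI
  have h1 : Reads I d s₁ := h.congr (hf 0 rfl) (hf 1 rfl) (hf 2 rfl) (hf 3 rfl)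
  have hq1 : s₁.arr vQuot 0 = I.ε.den * (I.k + I.k) := by rw [hf vQuot rfl, hq]
  have hs1 : s₁.arr vSmall 0 = I.k * d := by rw [hf vSmall rfl, hs]
  have hm := (hdem i).trans hG.m
  have hraw : I.raw i ≤ G := (Inst.raw_le i).trans hm
  have e1 : (I.ε.num.toNat * I.dem i - 1) / (I.ε.den * (I.k + I.k)) = I.raw i := rfl
  refine Runs.seq (Runs.mulP rfl rfl rfl ?_ ?_)
  · simpa [hx, h1.dem] using hm
  refine Runs.seq (Runs.divP rfl rfl rfl ?_ ?_ ?_)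
  · simpa [hq1] using ⟨I.ε.den_pos, hk⟩
  · simpa [hx, h1.dem, h1.num, hq1, e1] using hraw
  refine Runs.seq (Runs.mulP rfl rfl rfl ?_ ?_)
  · simpa [hx, h1.dem, h1.num, hq1, e1] using hraw
  refine Runs.ite (fun hc => ?_) (fun hc => ?_)
  · simp [hx, h1.dem, h1.num, hq1, hs1, e1] at hc
    refine Runs.seq (Runs.assign (Runs.seq (Runs.assign (Runs.assign ?_))))
    intro j hj
    by_cases hji : j = i
    · subst hji
      simp [hx, h1.dem, Inst.unit, Inst.thr, hc]
    · simpa [hx, hji] using hI j (by omega)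
  · simp [hx, h1.dem, h1.num, hq1, hs1, e1] at hc
    refine Runs.seq (Runs.assign (Runs.seq (Runs.assign (Runs.assign ?_))))
    intro j hj
    by_cases hji : j = i
    · subst hji
      simp [hx, h1.dem, h1.num, h1.k, hq1, e1, Inst.unit, Inst.thr, not_lt.2 hc]
    · simpa [hx, hji] using hI j (by omega)

end

/-! ### Random labels -/

/-- The last index `i < p` with `ω (b + i) = true`, or zero if there is none. -/
def lastHead (ω : ℕ → Bool) (b : ℕ) : ℕ → ℕ
  | 0 => 0
  | i + 1 => if ω (b + i) then i else lastHead ω b i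

theorem lastHead_eq {ω : ℕ → Bool} {b i₀ : ℕ} : ∀ {p : ℕ}, i₀ < p →
    (∀ i < p, ω (b + i) = decide (i = i₀)) → lastHead ω b p = i₀
  | 0, h, _ => absurd h (Nat.not_lt_zero _)
  | p + 1, h, hω => by
    have hp := hω p p.lt_succ_self
    by_cases e : p = i₀
    · rw [lastHead, hp, decide_eq_true e, if_pos rfl, e]
    · simp only [lastHead, hp, e, decide_false, Bool.false_eq_true, if_false]
      exact lastHead_eq (by omega) fun i hi => hω i (by omega)

/-- The random label of a vertex. The vertices of large colours have label zero. -/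
def Inst.label (I : Inst) (d : ℕ) (ω : ℕ → Bool) (b : Fin I.m) : ℕ :=
  if I.raw (I.f b) < I.k * d then lastHead ω (b * I.k) I.k else 0

/-- Chooses the labels. A coin is flipped for every vertex of `B` and every `i < k`, whatever the
colour, so that the coin for `b` and `i` has number `b k + i`. -/
def labelsP : Prog :=
  forP vB eM (forP vI eK (Prog.flip vCoin (lit 0) ;;
    Prog.ite (Expr.get aLarge (Expr.get 2 (var vB))) (var vCoin)
      (Prog.assign aLab (var vB) (var vI)) Prog.skip))

theorem runs_labelsP {O : (ℕ → ℕ) → Bool} {ω : ℕ → Bool} {G : ℕ} {I : Inst} {d : ℕ} {s : State}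
    (h : Reads I d s) (hG : Big I d G) (hcoins : s.coins = 0) (hlab : ∀ b, s.arr aLab b = 0)
    (hlarge : ∀ j < I.r, s.arr aLarge j = if I.raw j < I.k * d then 0 else 1) :
    Runs O ω G labelsP s fun s' => ∀ b : Fin I.m, s'.arr aLab b = I.label d ω b := by
  unfold labelsP
  refine Runs.forP (N := I.m) (fun i s' => s'.coins = i * I.k ∧ (∀ b ≥ i, s'.arr aLab b = 0) ∧
    ∀ b : Fin I.m, (b : ℕ) < i → s'.arr aLab b = I.label d ω b)
    rfl rfl (by simp [h.m]) hG.m (by simp [hcoins, hlab]) ?_ fun _ _ hI b => hI.2.2 b b.2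
  rintro i s₁ hi hf hx ⟨hc1, hz1, hl1⟩
  have h1 : Reads I d s₁ := h.congr (hf 0 rfl) (hf 1 rfl) (hf 2 rfl) (hf 3 rfl)
  have hla1 : s₁.arr aLarge = s.arr aLarge := hf aLarge rfl
  set b₀ : Fin I.m := ⟨i, hi⟩ with hb₀
  refine Runs.forP (N := I.k) (fun p s' => s'.coins = i * I.k + p ∧
    (∀ b, b ≠ i → s'.arr aLab b = s₁.arr aLab b) ∧
    s'.arr aLab i = if I.raw (I.f b₀) < I.k * d then lastHead ω (i * I.k) p else 0)
    rfl rfl (by simp [h1.k]) ((Nat.le_add_left _ _).trans hG.k) (by simp [hc1, lastHead, hz1]) ?_ ?_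
  · rintro p s₂ hp hf2 hx2 ⟨hc2, ho2, hl2⟩
    have hcol : s₂.arr 2 i = I.f b₀ := by rw [hf2 2 rfl]; exact h1.col b₀
    have hla : s₂.arr aLarge (I.f b₀) = if I.raw (I.f b₀) < I.k * d then 0 else 1 := by
      rw [hf2 aLarge rfl, hla1, hlarge _ (I.f b₀).2]
    have hB : s₂.arr vB 0 = i := by rw [hf2 vB rfl, hx]
    refine Runs.seq (Runs.flip (Runs.ite (fun hc => ?_) (fun hc => ?_)))
    · simp [hB, hcol, hla, hc2] at hc
      refine Runs.assign ?_
      by_cases hsm : I.raw (I.f b₀) < I.k * d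
      · have hω : ω (i * I.k + p) = true := by
          cases hω : ω (i * I.k + p) <;> simp_all
        simp only [hsm, if_true] at hl2
        refine ⟨by simp [hc2]; ring, fun b hb => by simp [hB, hb, ho2 b hb], ?_⟩
        simp [hB, hx2, hsm, lastHead, hω]
      · simp [hsm] at hc
        have := Bool.toNat_le (ω (i * I.k + p))
        omega
    · simp [hB, hcol, hla, hc2] at hc
      refine Runs.skip ?_
      refine ⟨by simp [hc2]; ring, fun b hb => by simp [ho2 b hb], ?_⟩
      by_cases hsm : I.raw (I.f b₀) < I.k * d
      · simp [hsm] at hc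
        simp [hl2, hsm, lastHead, hc]
      · simp [hl2, hsm]
  · rintro s₂ hf2 ⟨hc2, ho2, hl2⟩
    refine ⟨by simp [hc2]; ring, fun b hb => ?_, fun b hb => ?_⟩
    · simp [ho2 b (by omega), hz1 b (by omega)]
    · by_cases hbi : (b : ℕ) = i
      · have : b = b₀ := Fin.ext hbi
        subst this
        simp [hl2, Inst.label, hb₀]
      · simp [ho2 b hbi, hl1 b (by omega)]

/-! ### Types -/

theorem card_filter_lt_succ {N : ℕ} (q : Fin N → Prop) [DecidablePred q] {i : ℕ} (hi : i < N) :
    (Finset.univ.filter fun b : Fin N => (b : ℕ) < i + 1 ∧ q b).card =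
      (Finset.univ.filter fun b : Fin N => (b : ℕ) < i ∧ q b).card +
        if q ⟨i, hi⟩ then 1 else 0 := by
  have h : (Finset.univ.filter fun b : Fin N => (b : ℕ) < i + 1 ∧ q b) =
      (Finset.univ.filter fun b : Fin N => (b : ℕ) < i ∧ q b) ∪
        if q ⟨i, hi⟩ then {⟨i, hi⟩} else ∅ := by
    ext b
    rw [Finset.mem_union, Finset.mem_filter, Finset.mem_filter]
    by_cases hb : b = ⟨i, hi⟩
    · subst hb
      split_ifs with hq <;> simp [hq]
    · have hb' : (b : ℕ) ≠ i := fun h => hb (Fin.ext h)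
      have : (b : ℕ) < i + 1 ↔ (b : ℕ) < i := by omega
      split_ifs <;> simp [this, hb]
  rw [h, Finset.card_union_of_disjoint]
  · split_ifs <;> simp
  · split_ifs <;> simp

theorem card_filter_lt_top {N : ℕ} (q : Fin N → Prop) [DecidablePred q] :
    (Finset.univ.filter fun b : Fin N => (b : ℕ) < N ∧ q b).card =
      (Finset.univ.filter q).card := by
  congr 1
  ext b
  simp

/-- The distance `|e₁ - e₂|`. -/
def eDist (e₁ e₂ : Expr) : Expr := (e₁ - e₂) + (e₂ - e₁)

@[simp] theorem eval_eDist (s : State) (e₁ e₂ : Expr) :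
    (eDist e₁ e₂).eval s = (e₁.eval s - e₂.eval s) + (e₂.eval s - e₁.eval s) := rfl

/-- Counts the neighbours of the current vertex of the current colour and label. The entries of the
biadjacency matrix are `0` and `1`, so that the single comparison holds if and only if the entry is
`1` and both distances vanish. -/
def countP : Prog :=
  put vCnt (lit 0) ;;
  forP vB eM (Prog.ite
    (eDist (Expr.get 2 (var vB)) (var vJ) + eDist (Expr.get aLab (var vB)) (var vI))
    (Expr.get 3 (var vOff + var vB)) (put vCnt (var vCnt + lit 1)) Prog.skip)

/-- Computes the types of all vertices. -/
def codesP : Prog :=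
  forP vV eN
    (mulP vTmp vOff eM (var vV) ;;
    Prog.assign aCode (var vV) (lit 0) ;;
    forP vJ eR (forP vI eK
      (countP ;;
      Prog.ite (Expr.get 1 (var vJ)) (var vCnt) (put vCnt (Expr.get 1 (var vJ))) Prog.skip ;;
      divP vTmp vRaw (var vCnt) (Expr.get aUnit (var vJ)) ;;
      mulP vTmp vAcc (Expr.get aCode (var vV)) (var vBase) ;;
      Prog.assign aCode (var vV) (var vAcc + var vRaw))))

section

variable {O : (ℕ → ℕ) → Bool} {ω : ℕ → Bool} {G : ℕ} {I : Inst} {d : ℕ} {s : State}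
  {lab : Fin I.m → ℕ}

theorem runs_countP (h : Reads I d s) (hG : Big I d G) {v : Fin I.n}
    (hoff : s.arr vOff 0 = v * I.m) (hlab : ∀ b : Fin I.m, s.arr aLab b = lab b) :
    Runs O ω G countP s fun s' => s'.arr vCnt 0 = I.cnt lab v (s.arr vJ 0) (s.arr vI 0) := by
  unfold countP
  refine Runs.seq (Runs.put ?_)
  refine Runs.forP (N := I.m) (fun i s' => s'.arr vCnt 0 = (Finset.univ.filter fun b : Fin I.m =>
    (b : ℕ) < i ∧ ((v, b) ∈ I.E ∧ (I.f b : ℕ) = s.arr vJ 0 ∧ lab b = s.arr vI 0)).card)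
    rfl rfl (by simp [h.m]) hG.m (by simp) ?_ ?_
  · intro i s₁ hi hf hx hI
    have e1 : s₁.arr 3 (v * I.m + i) = if (v, (⟨i, hi⟩ : Fin I.m)) ∈ I.E then 1 else 0 := by
      rw [hf 3 rfl]; simpa using h.adj v ⟨i, hi⟩
    have e2 : s₁.arr 2 i = I.f ⟨i, hi⟩ := by
      rw [hf 2 rfl]; simpa using h.col ⟨i, hi⟩
    have e3 : s₁.arr aLab i = lab ⟨i, hi⟩ := by
      rw [hf aLab rfl]; simpa using hlab ⟨i, hi⟩
    have e4 : s₁.arr vOff 0 = v * I.m := by rw [hf vOff rfl]; simpa using hoff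
    have e5 : s₁.arr vJ 0 = s.arr vJ 0 := by rw [hf vJ rfl]; simp
    have e6 : s₁.arr vI 0 = s.arr vI 0 := by rw [hf vI rfl]; simp
    have hcond : (eDist (Expr.get 2 (var vB)) (var vJ) +
        eDist (Expr.get aLab (var vB)) (var vI)).eval s₁ <
          (Expr.get 3 (var vOff + var vB)).eval s₁ ↔
        ((v, (⟨i, hi⟩ : Fin I.m)) ∈ I.E ∧ (I.f ⟨i, hi⟩ : ℕ) = s.arr vJ 0 ∧
          lab ⟨i, hi⟩ = s.arr vI 0) := by
      simp only [Expr.eval_add', eval_eDist, Expr.eval_get, eval_var, hx, e1, e2, e3, e4, e5, e6]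
      split_ifs with hE
      · simp only [hE, true_and]; omega
      · simp [hE]
    refine Runs.ite (fun hc => Runs.put ?_) (fun hc => Runs.skip ?_)
    · rw [hcond] at hc
      rw [card_filter_lt_succ _ hi, if_pos hc]
      simp [hI]
    · rw [hcond] at hc
      rw [card_filter_lt_succ _ hi, if_neg hc]
      simp [hI]
  · intro s₁ _ hI
    rw [hI, card_filter_lt_top]
    rfl

theorem runs_codesP (h : Reads I d s) (hG : Big I d G) (hk : 0 < I.k) (hd : 0 < d)
    (hbase : s.arr vBase 0 = I.base d) (hunit : ∀ j < I.r, s.arr aUnit j = I.unit d j)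
    (hlab : ∀ b : Fin I.m, s.arr aLab b = lab b) :
    Runs O ω G codesP s fun s' => ∀ v : Fin I.n, s'.arr aCode v = I.code d lab v := by
  unfold codesP
  refine Runs.forP (N := I.n) (fun i s' => ∀ v : Fin I.n, (v : ℕ) < i →
    s'.arr aCode v = I.code d lab v) rfl rfl (by simp [h.n]) hG.n (by simp) ?_
    fun _ _ hI v => hI v v.2
  intro i s₁ hi hf hx hI
  have h1 : Reads I d s₁ := h.congr (hf 0 rfl) (hf 1 rfl) (hf 2 rfl) (hf 3 rfl)
  set v₀ : Fin I.n := ⟨i, hi⟩ with hv₀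
  set w : ℕ → ℕ := fun p => I.wt d lab v₀ (p / I.k) (p % I.k) with hw
  refine Runs.seq (Runs.mulP rfl rfl rfl ?_ ?_)
  · simp only [eval_var, hx]; exact hi.le.trans hG.n
  refine Runs.seq (Runs.assign ?_)
  refine Runs.forP (N := I.r) (fun j s' => s'.arr aCode i = horner (I.base d) w (j * I.k) ∧
    ∀ a, a ≠ i → s'.arr aCode a = s₁.arr aCode a) rfl rfl (by simp [h1.r]) hG.r ?_ ?_ ?_
  · simp +contextual [horner, hx]
  · rintro j s₂ hj hf2 hx2 ⟨hc2, ho2⟩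
    have h2 : Reads I d s₂ := by
      refine h1.congr ?_ ?_ ?_ ?_ <;> rw [hf2 _ rfl] <;> rfl
    have hV2 : s₂.arr vV 0 = i := by rw [hf2 vV rfl]; simpa using hx
    have hoff2 : s₂.arr vOff 0 = v₀ * I.m := by
      rw [hf2 vOff rfl]; simp [hx, h1.m, hv₀, mul_comm]
    have hlab2 : ∀ b : Fin I.m, s₂.arr aLab b = lab b := by
      intro b; rw [hf2 aLab rfl, ← hlab b, ← hf aLab rfl]; rfl
    have hunit2 : s₂.arr aUnit j = I.unit d j := by
      rw [hf2 aUnit rfl, ← hunit j hj, ← hf aUnit rfl]; rfl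
    have hbase2 : s₂.arr vBase 0 = I.base d := by
      rw [hf2 vBase rfl, ← hbase, ← hf vBase rfl]; rfl
    refine Runs.forP (N := I.k) (fun p s' => s'.arr aCode i = horner (I.base d) w (j * I.k + p) ∧
      ∀ a, a ≠ i → s'.arr aCode a = s₁.arr aCode a) rfl rfl (by simp [h2.k])
      ((Nat.le_add_left _ _).trans hG.k) (by simpa using ⟨hc2, ho2⟩) ?_ ?_
    · rintro p s₃ hp hf3 hx3 ⟨hc3, ho3⟩
      have h3 : Reads I d s₃ := h2.congr (hf3 0 rfl) (hf3 1 rfl) (hf3 2 rfl) (hf3 3 rfl)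
      refine Runs.seq ((runs_countP h3 hG (by rw [hf3 vOff rfl, hoff2])
        (fun b => by rw [hf3 aLab rfl, hlab2])).frame fun s₄ hcnt hf4 _ => ?_)
      have h4 : Reads I d s₄ := h3.congr (hf4 0 rfl) (hf4 1 rfl) (hf4 2 rfl) (hf4 3 rfl)
      have hJ4 : s₄.arr vJ 0 = j := by rw [hf4 vJ rfl, hf3 vJ rfl, hx2]
      have hV4 : s₄.arr vV 0 = i := by rw [hf4 vV rfl, hf3 vV rfl, hV2]
      have hU4 : s₄.arr aUnit j = I.unit d j := by rw [hf4 aUnit rfl, hf3 aUnit rfl, hunit2]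
      have hB4 : s₄.arr vBase 0 = I.base d := by rw [hf4 vBase rfl, hf3 vBase rfl, hbase2]
      have hC4 : s₄.arr aCode = s₃.arr aCode := hf4 aCode rfl
      have hcnt4 : s₄.arr vCnt 0 = I.cnt lab v₀ j p := by
        rw [hcnt, hx3, hf3 vJ rfl, hx2]
      have hcntle : I.cnt lab v₀ j p ≤ G := by
        refine le_trans ?_ hG.m
        exact (Finset.card_le_univ _).trans (by simp)
      have hwp : w (j * I.k + p) = I.wt d lab v₀ j p := by
        have e3 : (j * I.k + p) / I.k = j := by
          rw [mul_comm, Nat.mul_add_div hk, Nat.div_eq_of_lt hp, Nat.add_zero]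
        have e4 : (j * I.k + p) % I.k = p := by
          rw [mul_comm, Nat.mul_add_mod, Nat.mod_eq_of_lt hp]
        simp only [hw, e3, e4]
      have hU0 : 0 < I.unit d j := Inst.unit_pos hk hd j
      refine Runs.seq (Runs.frame (R := fun s' => s'.arr vCnt 0 = min (I.cnt lab v₀ j p) (I.dem j))
        ?_ fun s₅ hmin hf5 _ => ?_)
      · refine Runs.ite (fun hc => Runs.put ?_) (fun hc => Runs.skip ?_)
        · simp [hJ4, h4.dem, hcnt4] at hc
          simp [hJ4, h4.dem, hc.le]
        · simp [hJ4, h4.dem, hcnt4] at hc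
          simp [hcnt4, hc]
      have hJ5 : s₅.arr vJ 0 = j := by rw [hf5 vJ rfl, hJ4]
      have hV5 : s₅.arr vV 0 = i := by rw [hf5 vV rfl, hV4]
      have hU5 : s₅.arr aUnit j = I.unit d j := by rw [hf5 aUnit rfl, hU4]
      have hB5 : s₅.arr vBase 0 = I.base d := by rw [hf5 vBase rfl, hB4]
      have hC5 : s₅.arr aCode = s₃.arr aCode := by rw [hf5 aCode rfl, hC4]
      refine Runs.seq (Runs.divP rfl rfl rfl ?_ ?_ ?_)
      · simpa [hJ5, hU5] using hU0
      · simp only [eval_var, Expr.eval_get, hJ5, hU5, hmin]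
        exact (Nat.div_le_self _ _).trans ((min_le_left _ _).trans hcntle)
      refine Runs.seq (Runs.mulP rfl rfl rfl ?_ (Runs.assign ⟨?_, fun a ha => ?_⟩))
      · simpa [hB5] using hG.base
      · rw [← Nat.add_assoc, horner, hwp, Inst.wt]
        simp [hJ5, hV5, hU5, hB5, hC5, hmin, hc3]
      · simp [hV5, ha, hC5, ho3 a ha]
    · rintro s₃ - ⟨hc3, ho3⟩
      refine ⟨?_, fun a ha => by simpa using ho3 a ha⟩
      simp [hc3, Nat.succ_mul]
  · rintro s₂ - ⟨hc2, ho2⟩ v hv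
    by_cases hvi : (v : ℕ) = i
    · have : v = v₀ := Fin.ext hvi
      subst this
      have hcode : I.code d lab v₀ = horner (I.base d) w (I.r * I.k) := rfl
      rw [hcode]
      simpa [hv₀] using hc2
    · have := ho2 v hvi
      simp [this, hI v (by omega)]

end

/-! ### Computing the layers -/

namespace Inst

variable {I : Inst} {d : ℕ}

/-- The state of the layers when the vertices below `v` have been considered for layer `l + 1`. -/
structure LayerInv (I : Inst) (code lay : Fin I.n → ℕ) (l v : ℕ) : Prop where
  le : ∀ a : Fin I.n, lay a ≤ l ∨ lay a = l + 1 ∧ (a : ℕ) < v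
  adm : ∀ l' κ, 1 ≤ l' → I.Admissible (I.layer code lay l' κ)
  max : ∀ a : Fin I.n, lay a = 0 → ∀ l', 1 ≤ l' → (l' ≤ l ∨ l' = l + 1 ∧ (a : ℕ) < v) →
    ¬ I.Admissible (insert a (I.layer code lay l' (code a)))

theorem layerInv_zero (code : Fin I.n → ℕ) : I.LayerInv code (fun _ => 0) 0 0 where
  le _ := Or.inl le_rfl
  adm l' κ hl := by
    have : I.layer code (fun _ => 0) l' κ = ∅ :=
      Finset.filter_eq_empty_iff.2 fun a _ h => by
        have h0 : 0 = l' := h.1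
        omega
    rw [this]
    exact admissible_empty
  max a _ l' hl h := by omega

theorem LayerInv.next {code lay : Fin I.n → ℕ} {l : ℕ} (h : I.LayerInv code lay l I.n) :
    I.LayerInv code lay (l + 1) 0 where
  le a := by have := h.le a; omega
  adm := h.adm
  max a ha l' hl hl' := h.max a ha l' hl (by have := a.2; omega)

theorem LayerInv.layered {code lay : Fin I.n → ℕ} {l : ℕ} (h : I.LayerInv code lay l 0) :
    I.Layered code lay l where
  le a := by have := h.le a; omega
  adm := h.adm
  max a ha l' hl hl' := h.max a ha l' hl (Or.inl hl')

/-- A vertex is passed over if it is in a layer already or cannot be added to the current one. It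
cannot be added to the completed layer either, since that is larger. -/
theorem LayerInv.skip {code lay : Fin I.n → ℕ} {l : ℕ} {v : Fin I.n}
    (h : I.LayerInv code lay l v)
    (hv : lay v = 0 → ¬ I.Admissible (insert v (I.layer code lay (l + 1) (code v)))) :
    I.LayerInv code lay l (v + 1) where
  le a := by have := h.le a; omega
  adm := h.adm
  max a ha l' hl hl' := by
    by_cases hav : a = v ∧ l' = l + 1
    · obtain ⟨rfl, rfl⟩ := hav
      exact hv ha
    · refine h.max a ha l' hl ?_
      have : (a : ℕ) = v → a = v := Fin.ext
      by_contra hcon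
      have h1 : (a : ℕ) = v := by omega
      exact hav ⟨this h1, by omega⟩

theorem layer_update {code lay : Fin I.n → ℕ} {l l' κ : ℕ} {v : Fin I.n} (hv : lay v = 0)
    (hl' : 1 ≤ l') : I.layer code (Function.update lay v l) l' κ =
      if l' = l ∧ κ = code v then insert v (I.layer code lay l' κ) else I.layer code lay l' κ := by
  ext a
  by_cases ha : a = v
  · subst ha
    split_ifs with hc
    · simp [mem_layer, hc.1, hc.2]
    · simp only [mem_layer, Function.update_self, hv]
      constructor
      · rintro ⟨rfl, rfl⟩; exact absurd ⟨rfl, rfl⟩ hc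
      · rintro ⟨h, -⟩; omega
  · split_ifs <;> simp [mem_layer, ha]

theorem LayerInv.place {code lay : Fin I.n → ℕ} {l : ℕ} {v : Fin I.n}
    (h : I.LayerInv code lay l v) (hv : lay v = 0)
    (hadm : I.Admissible (insert v (I.layer code lay (l + 1) (code v)))) :
    I.LayerInv code (Function.update lay v (l + 1)) l (v + 1) where
  le a := by
    by_cases ha : a = v
    · subst ha; simp
    · rw [Function.update_of_ne ha]
      have := h.le a; omega
  adm l' κ hl' := by
    rw [layer_update hv hl']
    split_ifs with hc
    · rw [hc.1, hc.2]; exact hadm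
    · exact h.adm l' κ hl'
  max a ha l' hl' hc hcon := by
    have hav : a ≠ v := by rintro rfl; simp at ha
    rw [Function.update_of_ne hav] at ha
    have hne : (a : ℕ) ≠ v := fun e => hav (Fin.ext e)
    refine h.max a ha l' hl' (by omega) (hcon.mono (Finset.insert_subset_insert _ ?_))
    rw [layer_update hv hl']
    split_ifs
    · exact Finset.subset_insert _ _
    · exact subset_rfl

/-- The list `lst` of length `len` enumerates the vertices in layers. -/
structure ListInv (I : Inst) (lay : Fin I.n → ℕ) (lst : ℕ → ℕ) (len : ℕ) : Prop where
  card : len = (Finset.univ.filter fun a => lay a ≠ 0).card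
  mem : ∀ a, lay a ≠ 0 → ∃ p < len, lst p = a

theorem listInv_zero (lst : ℕ → ℕ) : I.ListInv (fun _ => 0) lst 0 where
  card := by simp
  mem a ha := absurd rfl ha

theorem ListInv.place {lay : Fin I.n → ℕ} {lst lst' : ℕ → ℕ} {len l : ℕ} (h : I.ListInv lay lst len)
    {v : Fin I.n} (hv : lay v = 0) (hl : l ≠ 0) (hlst : ∀ p < len, lst' p = lst p)
    (hv' : lst' len = v) : I.ListInv (Function.update lay v l) lst' (len + 1) where
  card := by
    have : (Finset.univ.filter fun a => Function.update lay v l a ≠ 0) =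
        insert v (Finset.univ.filter fun a => lay a ≠ 0) := by
      ext a
      by_cases ha : a = v
      · subst ha; simp [hl]
      · simp [ha]
    rw [this, Finset.card_insert_of_notMem (by simp [hv]), h.card]
  mem a ha := by
    by_cases hav : a = v
    · exact ⟨len, Nat.lt_succ_self _, by rw [hv', hav]⟩
    · rw [Function.update_of_ne hav] at ha
      obtain ⟨p, hp, he⟩ := h.mem a ha
      exact ⟨p, by omega, by rw [hlst p hp, he]⟩

/-- A layer contains at most `k` vertices of each type. -/
theorem Layered.card_le {code lay : Fin I.n → ℕ} {L B : ℕ} (h : I.Layered code lay L)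
    (hB : ∀ a, code a < B) :
    (Finset.univ.filter fun a => lay a ≠ 0).card ≤ I.k * L * B := by
  classical
  have hmaps : ∀ a ∈ Finset.univ.filter fun a => lay a ≠ 0,
      (lay a, code a) ∈ Finset.Icc 1 L ×ˢ Finset.range B := by
    intro a ha
    have h0 : lay a ≠ 0 := (Finset.mem_filter.1 ha).2
    rw [Finset.mem_product, Finset.mem_Icc, Finset.mem_range]
    exact ⟨⟨Nat.one_le_iff_ne_zero.2 h0, h.le a⟩, hB a⟩
  refine (Finset.card_le_mul_card_image_of_maps_to hmaps I.k fun y hy => ?_).trans ?_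
  · refine le_trans (Finset.card_le_card fun a ha => ?_)
      (h.adm y.1 y.2 (Finset.mem_Icc.1 (Finset.mem_product.1 hy).1).1).1
    have := (Finset.mem_filter.1 ha).2
    exact mem_layer.2 ⟨congrArg Prod.fst this, congrArg Prod.snd this⟩
  · simp [mul_assoc]

end Inst

/-- Counts the vertices of the current layer that have the type of the current vertex, and queries
the oracle for the set of these vertices together with the current one. -/
def candidateP : Prog :=
  put vCnt (lit 0) ;;
  forP vU eN (Prog.ite
    (eDist (Expr.get aLay (var vU)) (var vL + lit 1) +
      eDist (Expr.get aCode (var vU)) (Expr.get aCode (var vV))) (lit 1)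
    (Prog.assign aQuery (var vU) (lit 1) ;; put vCnt (var vCnt + lit 1))
    (Prog.assign aQuery (var vU) (lit 0))) ;;
  Prog.assign aQuery (var vV) (lit 1) ;;
  Prog.query vAns (lit 0) aQuery

/-- Computes the layers. -/
def layersP : Prog :=
  forP vL (var vDepth) (forP vV eN
    (Prog.ite (lit 0) (Expr.get aLay (var vV)) Prog.skip
      (candidateP ;;
      Prog.ite (var vCnt) eK
        (Prog.ite (lit 0) (var vAns)
          (Prog.assign aLay (var vV) (var vL + lit 1) ;;
            Prog.assign aList (var vLen) (var vV) ;; put vLen (var vLen + lit 1))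
          Prog.skip)
        Prog.skip)))

section

variable {ω : ℕ → Bool} {G : ℕ} {I : Inst} {d : ℕ} {s : State}

open Classical in
theorem oracle_eq {v : ℕ → ℕ} {S : Finset (Fin I.n)} (h : ∀ a : Fin I.n, v a ≠ 0 ↔ a ∈ S) :
    (I.oracle v).toNat = if I.M.Indep (S : Set (Fin I.n)) then 1 else 0 := by
  have : {a : Fin I.n | v a ≠ 0} = (S : Set (Fin I.n)) := by ext a; simp [h]
  unfold Inst.oracle
  rw [this]
  split_ifs with hi <;> simp [hi]

open Classical in
theorem runs_candidateP (h : Reads I d s) (hG : Big I d G) {code lay : Fin I.n → ℕ}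
    (hcode : ∀ a : Fin I.n, s.arr aCode a = code a) (hlay : ∀ a : Fin I.n, s.arr aLay a = lay a)
    {v : Fin I.n} (hv : s.arr vV 0 = v) :
    Runs I.oracle ω G candidateP s fun s' =>
      s'.arr vCnt 0 = (I.layer code lay (s.arr vL 0 + 1) (code v)).card ∧
      s'.arr vAns 0 = if I.M.Indep
        ((insert v (I.layer code lay (s.arr vL 0 + 1) (code v)) : Finset (Fin I.n)) :
          Set (Fin I.n)) then 1 else 0 := by
  unfold candidateP
  refine Runs.seq (Runs.put ?_)
  refine Runs.seq (Runs.forP (N := I.n) (fun i s' =>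
    s'.arr vCnt 0 = (Finset.univ.filter fun a : Fin I.n =>
      (a : ℕ) < i ∧ (lay a = s.arr vL 0 + 1 ∧ code a = code v)).card ∧
    ∀ a : Fin I.n, (a : ℕ) < i →
      (s'.arr aQuery a ≠ 0 ↔ a ∈ I.layer code lay (s.arr vL 0 + 1) (code v)))
    rfl rfl (by simp [h.n]) hG.n (by simp) ?_ ?_)
  · rintro i s₁ hi hf hx ⟨hc, hq⟩
    have e1 : s₁.arr aLay i = lay ⟨i, hi⟩ := by
      rw [hf aLay rfl]; simpa using hlay ⟨i, hi⟩
    have e2 : s₁.arr aCode i = code ⟨i, hi⟩ := by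
      rw [hf aCode rfl]; simpa using hcode ⟨i, hi⟩
    have e3 : s₁.arr aCode v = code v := by
      rw [hf aCode rfl]; simpa using hcode v
    have e4 : s₁.arr vL 0 = s.arr vL 0 := by rw [hf vL rfl]; simp
    have e5 : s₁.arr vV 0 = v := by rw [hf vV rfl]; simpa using hv
    have hcond : (eDist (Expr.get aLay (var vU)) (var vL + lit 1) +
        eDist (Expr.get aCode (var vU)) (Expr.get aCode (var vV))).eval s₁ < (lit 1).eval s₁ ↔
        (lay ⟨i, hi⟩ = s.arr vL 0 + 1 ∧ code ⟨i, hi⟩ = code v) := by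
      simp only [Expr.eval_add', eval_eDist, Expr.eval_get, eval_var, eval_lit, hx, e1, e2, e3, e4,
        e5]
      omega
    have hother : ∀ (a : Fin I.n), (a : ℕ) < i + 1 → (a : ℕ) ≠ i → (a : ℕ) < i := by
      intro a _ _; omega
    refine Runs.ite (fun hc' => ?_) (fun hc' => ?_)
    · rw [hcond] at hc'
      refine Runs.seq (Runs.assign (Runs.put ⟨?_, fun a ha => ?_⟩))
      · rw [card_filter_lt_succ _ hi, if_pos hc']
        simp [hc]
      · by_cases hai : (a : ℕ) = i
        · have : a = ⟨i, hi⟩ := Fin.ext hai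
          subst this
          simp [hx, Inst.mem_layer, hc']
        · simpa [hx, hai] using hq a (by omega)
    · rw [hcond] at hc'
      refine Runs.assign ⟨?_, fun a ha => ?_⟩
      · rw [card_filter_lt_succ _ hi, if_neg hc']
        simp [hc]
      · by_cases hai : (a : ℕ) = i
        · have : a = ⟨i, hi⟩ := Fin.ext hai
          subst this
          simp only [State.set_arr]
          simp [hx, Inst.mem_layer, -not_and, hc']
        · simpa [hx, hai] using hq a (by omega)
  · rintro s₁ hf ⟨hc, hq⟩
    have e5 : s₁.arr vV 0 = v := by rw [hf vV rfl]; simpa using hv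
    refine Runs.seq (Runs.assign (Runs.query ⟨?_, ?_⟩))
    · rw [card_filter_lt_top] at hc
      simp [hc, Inst.layer]
    · simp only [State.set_arr, eval_lit, eval_var, e5]
      simp only [and_self, if_true]
      refine oracle_eq fun a => ?_
      by_cases hav : a = v
      · subst hav; simp
      · have : (a : ℕ) ≠ v := fun e => hav (Fin.ext e)
        simpa [this, hav] using hq a a.2

theorem runs_layersP (h : Reads I d s) (hG : Big I d G) {code : Fin I.n → ℕ}
    (hdepth : s.arr vDepth 0 = I.depth d)
    (hcode : ∀ a : Fin I.n, s.arr aCode a = code a) (hlay : ∀ a, s.arr aLay a = 0)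
    (hlen : s.arr vLen 0 = 0) :
    Runs I.oracle ω G layersP s fun s' =>
      I.Layered code (fun a => s'.arr aLay a) (I.depth d) ∧
      I.ListInv (fun a => s'.arr aLay a) (s'.arr aList) (s'.arr vLen 0) := by
  classical
  unfold layersP
  refine Runs.forP (N := I.depth d) (fun l s' =>
    I.LayerInv code (fun a => s'.arr aLay a) l 0 ∧
    I.ListInv (fun a => s'.arr aLay a) (s'.arr aList) (s'.arr vLen 0)) rfl rfl
    (by simp [hdepth]) hG.depth ?_ ?_ fun _ _ hI => ⟨hI.1.layered, hI.2⟩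
  · simp only [State.set_arr]
    simpa [hlay, hlen] using ⟨Inst.layerInv_zero code, Inst.listInv_zero _⟩
  rintro l s₁ hl hf hx ⟨hL, hI⟩
  have h1 : Reads I d s₁ := h.congr (hf 0 rfl) (hf 1 rfl) (hf 2 rfl) (hf 3 rfl)
  refine Runs.forP (N := I.n) (fun v s' =>
    I.LayerInv code (fun a => s'.arr aLay a) l v ∧
    I.ListInv (fun a => s'.arr aLay a) (s'.arr aList) (s'.arr vLen 0)) rfl rfl
    (by simp [h1.n]) hG.n ?_ ?_ ?_
  · simpa [State.set_arr_ne] using ⟨hL, hI⟩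
  · rintro i s₂ hi hf2 hx2 ⟨hL2, hI2⟩
    have h2 : Reads I d s₂ := h1.congr (hf2 0 rfl) (hf2 1 rfl) (hf2 2 rfl) (hf2 3 rfl)
    set v : Fin I.n := ⟨i, hi⟩ with hv
    refine Runs.ite (fun hc => Runs.skip ?_) (fun hc => ?_)
    · simp [hx2] at hc
      refine ⟨?_, by simpa [State.set_arr_ne] using hI2⟩
      have := hL2.skip (v := v) fun h0 => by simp [hv] at h0; omega
      simpa [State.set_arr_ne] using this
    · simp [hx2] at hc
      have hv0 : s₂.arr aLay v = 0 := hc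
      have hVL2 : s₂.arr vL 0 = l := by rw [hf2 vL rfl, hx]
      have hcode2 : ∀ a : Fin I.n, s₂.arr aCode a = code a := by
        intro a; rw [hf2 aCode rfl, hf aCode rfl, hcode]
      refine Runs.seq ((runs_candidateP h2 hG hcode2 (fun a => rfl) (v := v) hx2).frame
        fun s₃ hQ hf3 _ => ?_)
      rw [hVL2] at hQ
      obtain ⟨hcnt, hans⟩ := hQ
      have hlay3 : s₃.arr aLay = s₂.arr aLay := hf3 aLay rfl
      have hlist3 : s₃.arr aList = s₂.arr aList := hf3 aList rfl
      have hlen3 : s₃.arr vLen = s₂.arr vLen := hf3 vLen rfl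
      have hVL3 : s₃.arr vL 0 = l := by rw [hf3 vL rfl, hVL2]
      have hV3 : s₃.arr vV 0 = i := by rw [hf3 vV rfl, hx2]
      have hk3 : s₃.arr 0 3 = I.k := by rw [hf3 0 rfl, h2.k]
      set P := I.layer code (fun a => s₂.arr aLay a) (l + 1) (code v) with hP
      have hvP : v ∉ P := by simp [hP, Inst.mem_layer, hv0]
      have hskip : ¬ I.Admissible (insert v P) →
          I.LayerInv code (fun a => (s₃.set vV 0 (i + 1)).arr aLay a) l (i + 1) ∧
          I.ListInv (fun a => (s₃.set vV 0 (i + 1)).arr aLay a)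
            ((s₃.set vV 0 (i + 1)).arr aList) ((s₃.set vV 0 (i + 1)).arr vLen 0) := by
        intro hna
        have := hL2.skip (v := v) fun _ => hna
        simpa [State.set_arr_ne, hlay3, hlist3, hlen3] using ⟨this, hI2⟩
      refine Runs.ite (fun hc1 => Runs.ite (fun hc2 => ?_) (fun hc2 => Runs.skip (hskip ?_)))
        (fun hc1 => Runs.skip (hskip ?_))
      · simp only [eval_var, eval_eK, hcnt, hk3] at hc1
        have hind : I.M.Indep ((insert v P : Finset (Fin I.n)) : Set (Fin I.n)) := by
          by_contra hn
          rw [if_neg hn] at hans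
          simp [hans] at hc2
        have hadm : I.Admissible (insert v P) :=
          ⟨by rw [Finset.card_insert_of_notMem hvP]; exact hc1, hind⟩
        refine Runs.seq (Runs.assign (Runs.seq (Runs.assign (Runs.put ?_))))
        have hup : (fun a : Fin I.n => if (a : ℕ) = i then l + 1 else s₂.arr aLay a) =
            Function.update (fun a : Fin I.n => s₂.arr aLay a) v (l + 1) := by
          funext a
          by_cases ha : a = v
          · subst ha; simp [hv]
          · have : (a : ℕ) ≠ i := fun e => ha (Fin.ext e)
            simp [ha, this]
        simp only [State.set_arr, eval_var, eval_lit, Expr.eval_add', hV3, hVL3, hlay3, hlen3]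
        simp only [false_and, if_false, true_and, and_true, if_true, Nat.reduceEqDiff]
        rw [hup]
        refine ⟨hL2.place hv0 hadm, hI2.place hv0 (Nat.succ_ne_zero l) (fun p hp => ?_) ?_⟩
        · simp [hlist3, hp.ne]
        · simp [hv]
      · intro hadm
        rw [if_pos hadm.2] at hans
        simp [hans] at hc2
      · intro hadm
        simp only [eval_var, eval_eK, hcnt, hk3] at hc1
        have := hadm.1
        rw [Finset.card_insert_of_notMem hvP] at this
        omega
  · rintro s₂ - ⟨hL2, hI2⟩
    simpa [State.set_arr_ne] using ⟨hL2.next, hI2⟩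

end

/-! ### Enumerating the tuples of layer vertices -/

/-- Every sequence of digits is the sequence of digits of a number. -/
theorem exists_digits {w : ℕ} : ∀ (k : ℕ) (δ : ℕ → ℕ), (∀ i, δ i < w) →
    ∃ c < w ^ k, ∀ i < k, c / w ^ i % w = δ i
  | 0, _, _ => ⟨0, by simp, fun i hi => absurd hi (Nat.not_lt_zero i)⟩
  | k + 1, δ, h => by
    obtain ⟨c, hc, hd⟩ := exists_digits k (fun i => δ (i + 1)) fun i => h _
    have hw : 0 < w := (Nat.zero_le _).trans_lt (h 0)
    refine ⟨δ 0 + w * c, ?_, fun i hi => ?_⟩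
    · have := h 0
      calc δ 0 + w * c < w * (c + 1) := by rw [Nat.mul_succ]; omega
        _ ≤ w * w ^ k := Nat.mul_le_mul_left _ hc
        _ = w ^ (k + 1) := (pow_succ' w k).symm
    · cases i with
      | zero => simp [Nat.mod_eq_of_lt (h 0)]
      | succ i =>
        rw [pow_succ', ← Nat.div_div_eq_div_mul, Nat.add_mul_div_left _ _ hw,
          Nat.div_eq_of_lt (h 0), zero_add]
        exact hd i (by omega)

namespace Inst

variable {I : Inst} {d : ℕ}

variable (I) in
/-- The set of vertices of a list `lst` of length `len` named by the digits `0, …, p - 1` of `c` in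
base `len + 1`. The digit `len` names no vertex. -/
def pick (lst : ℕ → ℕ) (len c p : ℕ) : Finset (Fin I.n) :=
  Finset.univ.filter fun a => ∃ i < p, c / (len + 1) ^ i % (len + 1) < len ∧
    lst (c / (len + 1) ^ i % (len + 1)) = a

theorem mem_pick {lst : ℕ → ℕ} {len c p : ℕ} {a : Fin I.n} : a ∈ I.pick lst len c p ↔
    ∃ i < p, c / (len + 1) ^ i % (len + 1) < len ∧
      lst (c / (len + 1) ^ i % (len + 1)) = a := by
  simp [pick]

theorem card_pick_le (lst : ℕ → ℕ) (len c p : ℕ) : (I.pick lst len c p).card ≤ p := by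
  classical
  rw [← Finset.card_image_of_injective (I.pick lst len c p) Fin.val_injective]
  refine (Finset.card_le_card (t := (Finset.range p).image fun i =>
    lst (c / (len + 1) ^ i % (len + 1))) fun a ha => ?_).trans
      (Finset.card_image_le.trans (Finset.card_range p).le)
  obtain ⟨b, hb, rfl⟩ := Finset.mem_image.1 ha
  obtain ⟨i, hi, -, he⟩ := mem_pick.1 hb
  exact Finset.mem_image.2 ⟨i, Finset.mem_range.2 hi, he⟩

/-- Every set of at most `k` vertices in layers is named by some number. -/
theorem ListInv.exists_pick {lay : Fin I.n → ℕ} {lst : ℕ → ℕ} {len : ℕ} (h : I.ListInv lay lst len)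
    {p : ℕ} {x : Fin p → Fin I.n} (hx : ∀ i, lay (x i) ≠ 0) {k : ℕ} (hp : p ≤ k) :
    ∃ c < (len + 1) ^ k, I.pick lst len c k = Finset.univ.image x := by
  choose q hq hqx using fun i => h.mem (x i) (hx i)
  obtain ⟨c, hc, hdig⟩ := exists_digits k (fun i => if hi : i < p then q ⟨i, hi⟩ else len)
    (w := len + 1) fun i => by
      split_ifs with hi
      · exact (hq _).trans (Nat.lt_succ_self _)
      · exact Nat.lt_succ_self _
  refine ⟨c, hc, ?_⟩
  ext a
  rw [mem_pick, Finset.mem_image]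
  constructor
  · rintro ⟨i, hi, hlt, he⟩
    rw [hdig i hi] at hlt he
    by_cases hip : i < p
    · simp only [hip, dif_pos] at he
      exact ⟨⟨i, hip⟩, Finset.mem_univ _, Fin.ext (by rw [← he, hqx])⟩
    · simp [hip] at hlt
  · rintro ⟨i, -, rfl⟩
    have hi : (i : ℕ) < k := i.2.trans_le hp
    refine ⟨i, hi, ?_, ?_⟩ <;> rw [hdig i hi] <;> simp [hq, hqx]

/-- `S` is admissible and meets all thresholds. -/
def Meets (I : Inst) (d : ℕ) (S : Finset (Fin I.n)) : Prop :=
  I.Admissible S ∧ ∀ j : Fin I.r, I.thr d j ≤ (I.nbr j S).card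

end Inst

/-- Computes the number of tuples. -/
def tuplesP : Prog :=
  put vWidth (var vLen + lit 1) ;; put vTuples (lit 1) ;;
  forP vI eK (mulP vTmp vAcc (var vTuples) (var vWidth) ;; put vTuples (var vAcc))

/-- Writes the set named by the current number to array `5`. The division leaves the current digit
in `vTmp`. -/
def decodeP : Prog :=
  forP vV eN (Prog.assign 5 (var vV) (lit 0)) ;;
  put vAcc (var vC) ;;
  forP vI eK
    (divP vTmp vRaw (var vAcc) (var vWidth) ;;
    Prog.ite (var vTmp) (var vLen) (Prog.assign 5 (Expr.get aList (var vTmp)) (lit 1)) Prog.skip ;;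
    put vAcc (var vRaw))

/-- Tests whether the current vertex of `B` is covered by the set in array `5`. The entries of
array `5` and of the biadjacency matrix are `0` and `1`, so that their sum exceeds `1` only if both
are `1`. -/
def hitP : Prog :=
  put vCnt (lit 0) ;; put vOff (var vB) ;;
  forP vU eN
    (Prog.ite (lit 1) (Expr.get 5 (var vU) + Expr.get 3 (var vOff)) (put vCnt (lit 1)) Prog.skip ;;
    put vOff (var vOff + eM))

/-- Computes the coverage of all colours by the set in array `5`. -/
def coverP : Prog :=
  forP vJ eR (Prog.assign aCov (var vJ) (lit 0)) ;;
  forP vB eM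
    (hitP ;;
    Prog.assign aCov (Expr.get 2 (var vB)) (Expr.get aCov (Expr.get 2 (var vB)) + var vCnt))

/-- Accepts the set in array `5` if it is independent and meets all thresholds. -/
def acceptP : Prog :=
  put vBad (lit 0) ;;
  forP vJ eR (Prog.ite (Expr.get aCov (var vJ)) (Expr.get aThr (var vJ)) (put vBad (lit 1))
    Prog.skip) ;;
  Prog.query vAns (lit 0) 5 ;;
  Prog.ite (var vBad) (var vAns) (Prog.assign 4 (lit 0) (lit 1)) Prog.skip

/-- Searches for a set of layer vertices that is accepted. -/
def searchP : Prog :=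
  tuplesP ;;
  forP vC (var vTuples) (Prog.ite (lit 0) (Expr.get 4 (lit 0)) Prog.skip
    (decodeP ;; coverP ;; acceptP))

section

variable {O : (ℕ → ℕ) → Bool} {ω : ℕ → Bool} {G : ℕ} {I : Inst} {d : ℕ} {s : State}

/-- Array `5` holds the characteristic vector of `S`. -/
def Holds (S : Finset (Fin I.n)) (s : State) : Prop :=
  ∀ a : Fin I.n, s.arr 5 a = if a ∈ S then 1 else 0

theorem runs_tuplesP (h : Reads I d s) (hG : Big I d G) (hlen : s.arr vLen 0 + 1 ≤ G) :
    Runs O ω G tuplesP s fun s' => s'.arr vWidth 0 = s.arr vLen 0 + 1 ∧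
      s'.arr vTuples 0 = (s.arr vLen 0 + 1) ^ I.k := by
  unfold tuplesP
  refine Runs.seq (Runs.put (Runs.seq (Runs.put ?_)))
  refine Runs.forP (N := I.k) (fun i s' => s'.arr vTuples 0 = (s.arr vLen 0 + 1) ^ i)
    rfl rfl (by simp [h.k]) ((Nat.le_add_left _ _).trans hG.k) (by simp) ?_ ?_
  · intro i s₁ hi hf hx hI
    have hw : s₁.arr vWidth 0 = s.arr vLen 0 + 1 := by rw [hf vWidth rfl]; simp
    refine Runs.seq (Runs.mulP rfl rfl rfl (by simpa [hw] using hlen) (Runs.put ?_))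
    simp [hw, hI, pow_succ]
  · intro s₁ hf hI
    exact ⟨by rw [hf vWidth rfl]; simp, hI⟩

theorem runs_decodeP (h : Reads I d s) (hG : Big I d G) (hC : s.arr vC 0 ≤ G)
    (hw : s.arr vWidth 0 = s.arr vLen 0 + 1) :
    Runs O ω G decodeP s (Holds (I.pick (s.arr aList) (s.arr vLen 0) (s.arr vC 0) I.k)) := by
  unfold decodeP
  refine Runs.seq (Runs.forP (N := I.n) (fun i s' => ∀ a < i, s'.arr 5 a = 0) rfl rfl
    (by simp [h.n]) hG.n (by simp) ?_ ?_)
  · intro i s₁ hi hf hx hI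
    refine Runs.assign fun a ha => ?_
    by_cases hai : a = i
    · simp [hx, hai]
    · simpa [hx, hai] using hI a (by omega)
  intro s₁ hf hI
  have h1 : Reads I d s₁ := h.congr (hf 0 rfl) (hf 1 rfl) (hf 2 rfl) (hf 3 rfl)
  have hC1 : s₁.arr vC = s.arr vC := hf vC rfl
  have hw1 : s₁.arr vWidth = s.arr vWidth := hf vWidth rfl
  have hl1 : s₁.arr aList = s.arr aList := hf aList rfl
  have hn1 : s₁.arr vLen = s.arr vLen := hf vLen rfl
  set len := s.arr vLen 0 with hlen
  set c := s.arr vC 0 with hc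
  refine Runs.seq (Runs.put ?_)
  refine Runs.forP (N := I.k) (fun i s' => s'.arr vAcc 0 = c / (len + 1) ^ i ∧
    Holds (I.pick (s.arr aList) len c i) s') rfl rfl (by simp [h1.k])
    ((Nat.le_add_left _ _).trans hG.k) ?_ ?_ fun _ _ hQ => hQ.2
  · refine ⟨by simp [hC1, hc], fun a => ?_⟩
    simp [Inst.mem_pick, hI a a.2]
  · rintro i s₂ hi hf2 hx2 ⟨ha2, hh2⟩
    have hw2 : s₂.arr vWidth 0 = len + 1 := by rw [hf2 vWidth rfl]; simp [hw1, hw]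
    have hl2 : s₂.arr aList = s.arr aList := by
      rw [hf2 aList rfl, State.set_arr_ne _ _ _ (by decide), hl1]
    have hn2 : s₂.arr vLen 0 = len := by rw [hf2 vLen rfl]; simp [hn1, hlen]
    set q := c / (len + 1) ^ i % (len + 1) with hq
    refine Runs.seq (Runs.divP rfl rfl rfl ?_ ?_ ?_)
    · simp [hw2]
    · simp only [eval_var, ha2]
      exact (Nat.div_le_self _ _).trans ((Nat.div_le_self _ _).trans hC)
    have hmem : ∀ a : Fin I.n, a ∈ I.pick (s.arr aList) len c (i + 1) ↔
        a ∈ I.pick (s.arr aList) len c i ∨ (q < len ∧ s.arr aList q = a) := by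
      intro a
      simp only [Inst.mem_pick]
      constructor
      · rintro ⟨i', hi', h⟩
        rcases Nat.lt_succ_iff_lt_or_eq.1 hi' with hi' | rfl
        · exact Or.inl ⟨i', hi', h⟩
        · exact Or.inr h
      · rintro (⟨i', hi', h⟩ | h)
        · exact ⟨i', by omega, h⟩
        · exact ⟨i, by omega, h⟩
    have hquot : c / (len + 1) ^ i / (len + 1) = c / (len + 1) ^ (i + 1) := by
      rw [pow_succ, Nat.div_div_eq_div_mul]
    refine Runs.seq (Runs.ite (fun hlt => ?_) (fun hlt => ?_))
    · simp [ha2, hw2, hn2, ← hq] at hlt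
      refine Runs.assign (Runs.put ⟨by simp [ha2, hw2, hquot], fun a => ?_⟩)
      have hval : (Expr.get aList (var vTmp)).eval
          ((s₂.set vRaw 0 ((var vAcc).eval s₂ / (var vWidth).eval s₂)).set vTmp 0
            ((var vAcc).eval s₂ % (var vWidth).eval s₂)) = s.arr aList q := by
        simp [ha2, hw2, hl2, ← hq]
      rw [hval]
      by_cases hqa : s.arr aList q = a
      · rw [if_pos ((hmem a).2 (Or.inr ⟨hlt, hqa⟩))]
        simp [hqa]
      · have : (a ∈ I.pick (s.arr aList) len c (i + 1)) ↔ a ∈ I.pick (s.arr aList) len c i := by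
          rw [hmem]; tauto
        simp only [this, ← hh2 a]
        simp [Ne.symm hqa]
    · simp [ha2, hw2, hn2, ← hq] at hlt
      refine Runs.skip (Runs.put ⟨by simp [ha2, hw2, hquot], fun a => ?_⟩)
      have : (a ∈ I.pick (s.arr aList) len c (i + 1)) ↔ a ∈ I.pick (s.arr aList) len c i := by
        rw [hmem]
        refine or_iff_left fun h => ?_
        omega
      simp only [this, ← hh2 a]
      simp

theorem runs_hitP (h : Reads I d s) (hG : Big I d G) {S : Finset (Fin I.n)} (hS : Holds S s)
    {b : Fin I.m} (hb : s.arr vB 0 = b) :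
    Runs O ω G hitP s fun s' => s'.arr vCnt 0 = if ∃ a ∈ S, (a, b) ∈ I.E then 1 else 0 := by
  unfold hitP
  refine Runs.seq (Runs.put (Runs.seq (Runs.put ?_)))
  refine Runs.forP (N := I.n) (fun i s' => s'.arr vOff 0 = i * I.m + b ∧
    s'.arr vCnt 0 = if ∃ a ∈ S, (a : ℕ) < i ∧ (a, b) ∈ I.E then 1 else 0)
    rfl rfl (by simp [h.n]) hG.n (by simp [hb]) ?_ ?_
  · rintro i s₁ hi hf hx ⟨ho, hc⟩
    have e1 : s₁.arr 3 (i * I.m + b) = if ((⟨i, hi⟩ : Fin I.n), b) ∈ I.E then 1 else 0 := by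
      rw [hf 3 rfl]; simpa using h.adj ⟨i, hi⟩ b
    have e2 : s₁.arr 5 i = if (⟨i, hi⟩ : Fin I.n) ∈ S then 1 else 0 := by
      rw [hf 5 rfl]; simpa using hS ⟨i, hi⟩
    have e3 : s₁.arr 0 1 = I.m := by rw [hf 0 rfl]; simpa using h.m
    have hoff : i * I.m + b + I.m = (i + 1) * I.m + b := by ring
    refine Runs.seq (Runs.ite (fun hlt => ?_) (fun hlt => ?_))
    · simp only [eval_lit, Expr.eval_add', Expr.eval_get, eval_var, hx, ho, e1, e2] at hlt
      refine Runs.put (Runs.put ⟨by simp [ho, e3, hoff], ?_⟩)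
      rw [if_pos]
      · simp
      · refine ⟨⟨i, hi⟩, ?_, Nat.lt_succ_self i, ?_⟩ <;> by_contra hn <;>
          simp only [hn, if_false] at hlt <;> split_ifs at hlt <;> omega
    · simp only [eval_lit, Expr.eval_add', Expr.eval_get, eval_var, hx, ho, e1, e2] at hlt
      refine Runs.skip (Runs.put ⟨by simp [ho, e3, hoff], ?_⟩)
      have : (∃ a ∈ S, (a : ℕ) < i + 1 ∧ (a, b) ∈ I.E) ↔ ∃ a ∈ S, (a : ℕ) < i ∧ (a, b) ∈ I.E := by
        constructor
        · rintro ⟨a, ha, hai, hE⟩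
          refine ⟨a, ha, lt_of_le_of_ne (Nat.le_of_lt_succ hai) fun he => hlt ?_, hE⟩
          obtain rfl : a = ⟨i, hi⟩ := Fin.ext he
          simp [ha, hE]
        · rintro ⟨a, ha, hai, hE⟩
          exact ⟨a, ha, by omega, hE⟩
      simp only [this]
      simpa using hc
  · rintro s₁ - ⟨-, hc⟩
    simpa using hc

theorem runs_coverP (h : Reads I d s) (hG : Big I d G) {S : Finset (Fin I.n)} (hS : Holds S s) :
    Runs O ω G coverP s fun s' => ∀ j : Fin I.r, s'.arr aCov j = (I.nbr j S).card := by
  unfold coverP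
  refine Runs.seq (Runs.forP (N := I.r) (fun i s' => ∀ a < i, s'.arr aCov a = 0) rfl rfl
    (by simp [h.r]) hG.r (by simp) ?_ ?_)
  · intro i s₁ hi hf hx hI
    refine Runs.assign fun a ha => ?_
    by_cases hai : a = i
    · simp [hx, hai]
    · simpa [hx, hai] using hI a (by omega)
  intro s₁ hf hI
  have h1 : Reads I d s₁ := h.congr (hf 0 rfl) (hf 1 rfl) (hf 2 rfl) (hf 3 rfl)
  have hS1 : s₁.arr 5 = s.arr 5 := hf 5 rfl
  refine Runs.forP (N := I.m) (fun i s' => ∀ j : Fin I.r, s'.arr aCov j =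
    (Finset.univ.filter fun b : Fin I.m => (b : ℕ) < i ∧
      (I.f b = j ∧ ∃ a ∈ S, (a, b) ∈ I.E)).card) rfl rfl (by simp [h1.m]) hG.m ?_ ?_ ?_
  · intro j
    simpa using hI j j.2
  · intro i s₂ hi hf2 hx2 hI2
    have h2 : Reads I d s₂ := h1.congr (hf2 0 rfl) (hf2 1 rfl) (hf2 2 rfl) (hf2 3 rfl)
    have hS2 : Holds S s₂ := fun a => by rw [hf2 5 rfl, hS1]; exact hS a
    refine Runs.seq ((runs_hitP h2 hG hS2 (b := ⟨i, hi⟩) hx2).frame fun s₃ hhit hf3 _ => ?_)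
    have hcol : s₃.arr 2 i = I.f ⟨i, hi⟩ := by rw [hf3 2 rfl]; exact h2.col ⟨i, hi⟩
    have hB3 : s₃.arr vB 0 = i := by rw [hf3 vB rfl, hx2]
    have hcov3 : s₃.arr aCov = s₂.arr aCov := hf3 aCov rfl
    refine Runs.assign fun j => ?_
    rw [card_filter_lt_succ _ hi, ← hI2 j]
    by_cases hj : I.f ⟨i, hi⟩ = j
    · subst hj
      simp [hB3, hcol, hcov3, hhit]
    · have : (j : ℕ) ≠ I.f ⟨i, hi⟩ := fun e => hj (Fin.ext e.symm)
      simp [hB3, hcol, hcov3, this, hj]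
  · intro s₂ _ hI2 j
    rw [hI2 j, card_filter_lt_top]
    rfl

open Classical in
theorem runs_acceptP (h : Reads I d s) (hG : Big I d G) {S : Finset (Fin I.n)} (hS : Holds S s)
    (hSk : S.card ≤ I.k) (hcov : ∀ j : Fin I.r, s.arr aCov j = (I.nbr j S).card)
    (hthr : ∀ j < I.r, s.arr aThr j = I.thr d j) :
    Runs I.oracle ω G acceptP s fun s' =>
      s'.arr 4 0 = if I.Meets d S then 1 else s.arr 4 0 := by
  unfold acceptP
  refine Runs.seq (Runs.put ?_)
  refine Runs.seq (Runs.forP (N := I.r) (fun i s' =>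
    s'.arr vBad 0 = if ∀ j : Fin I.r, (j : ℕ) < i → I.thr d j ≤ (I.nbr j S).card then 0 else 1)
    rfl rfl (by simp [h.r]) hG.r (by simp) ?_ ?_)
  · intro i s₁ hi hf hx hI
    have e1 : s₁.arr aCov i = (I.nbr ⟨i, hi⟩ S).card := by
      rw [hf aCov rfl]; simpa using hcov ⟨i, hi⟩
    have e2 : s₁.arr aThr i = I.thr d i := by
      rw [hf aThr rfl]; simpa using hthr i hi
    refine Runs.ite (fun hlt => Runs.put ?_) (fun hlt => Runs.skip ?_)
    · simp only [Expr.eval_get, eval_var, hx, e1, e2] at hlt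
      rw [if_neg]
      · simp
      · intro hall
        exact absurd (hall ⟨i, hi⟩ (Nat.lt_succ_self i)) (not_le.2 hlt)
    · simp only [Expr.eval_get, eval_var, hx, e1, e2, not_lt] at hlt
      have : (∀ j : Fin I.r, (j : ℕ) < i + 1 → I.thr d j ≤ (I.nbr j S).card) ↔
          ∀ j : Fin I.r, (j : ℕ) < i → I.thr d j ≤ (I.nbr j S).card := by
        refine ⟨fun H j hj => H j (by omega), fun H j hj => ?_⟩
        rcases Nat.lt_succ_iff_lt_or_eq.1 hj with hj | hj
        · exact H j hj
        · obtain rfl : j = ⟨i, hi⟩ := Fin.ext hj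
          exact hlt
      simp only [this, ← hI]
      simp
  · intro s₁ hf hI
    have e5 : s₁.arr 5 = s.arr 5 := by
      rw [hf 5 rfl, State.set_arr_ne _ _ _ (by decide)]
    have hor : (I.oracle (s₁.arr 5)).toNat =
        if I.M.Indep (S : Set (Fin I.n)) then 1 else 0 := by
      refine oracle_eq fun a => ?_
      rw [e5, hS a]
      split_ifs with ha <;> simp [ha]
    have e4 : s₁.arr 4 0 = s.arr 4 0 := by rw [hf 4 rfl]; simp
    have hI' : s₁.arr vBad 0 = if ∀ j : Fin I.r, I.thr d j ≤ (I.nbr j S).card then 0 else 1 := by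
      rw [hI]; simp
    refine Runs.seq (Runs.query (Runs.ite (fun hlt => Runs.assign ?_) (fun hlt => Runs.skip ?_)))
    · simp only [eval_var, eval_lit, State.set_arr, hor] at hlt
      simp only [Nat.reduceEqDiff, false_and, and_self, if_true, if_false, hI'] at hlt
      have hm : I.Meets d S := by
        refine ⟨⟨hSk, ?_⟩, ?_⟩ <;> by_contra hn <;> simp only [hn, if_false] at hlt <;>
          split_ifs at hlt <;> omega
      simp [hm]
    · simp only [eval_var, eval_lit, State.set_arr, hor] at hlt
      simp only [Nat.reduceEqDiff, false_and, and_self, if_true, if_false, hI'] at hlt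
      have hm : ¬ I.Meets d S := by
        intro hm
        apply hlt
        rw [if_pos hm.1.2, if_pos hm.2]
        exact Nat.one_pos
      simp [hm, e4]

theorem runs_searchP (h : Reads I d s) (hG : Big I d G)
    (hlen : s.arr vLen 0 + 1 ≤ G) (htup : (s.arr vLen 0 + 1) ^ I.k ≤ G)
    (hthr : ∀ j < I.r, s.arr aThr j = I.thr d j) (h4 : s.arr 4 0 = 0) :
    Runs I.oracle ω G searchP s fun s' =>
      (s'.arr 4 0 = 0 ∧ ∀ c < (s.arr vLen 0 + 1) ^ I.k,
        ¬ I.Meets d (I.pick (s.arr aList) (s.arr vLen 0) c I.k)) ∨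
      (s'.arr 4 0 ≠ 0 ∧ ∃ S : Finset (Fin I.n), Holds S s' ∧ I.Meets d S) := by
  classical
  unfold searchP
  refine Runs.seq ((runs_tuplesP h hG hlen).frame fun s₁ hQ hf _ => ?_)
  obtain ⟨hw1, ht1⟩ := hQ
  have h1 : Reads I d s₁ := h.congr (hf 0 rfl) (hf 1 rfl) (hf 2 rfl) (hf 3 rfl)
  refine Runs.forP (N := (s.arr vLen 0 + 1) ^ I.k) (fun i s' =>
    (s'.arr 4 0 = 0 ∧ ∀ c < i,
        ¬ I.Meets d (I.pick (s.arr aList) (s.arr vLen 0) c I.k)) ∨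
      (s'.arr 4 0 ≠ 0 ∧ ∃ S : Finset (Fin I.n), Holds S s' ∧ I.Meets d S))
    rfl rfl (by simp [ht1]) htup (Or.inl (by simp [hf 4 rfl, h4])) ?_ fun _ _ hQ => hQ
  intro i s₂ hi hf2 hx2 hI
  have h2 : Reads I d s₂ := h1.congr (hf2 0 rfl) (hf2 1 rfl) (hf2 2 rfl) (hf2 3 rfl)
  refine Runs.ite (fun hlt => Runs.skip ?_) (fun hlt => ?_)
  · simp at hlt
    rcases hI with hI | ⟨hI, S, hS, hm⟩
    · omega
    · exact Or.inr ⟨by simpa using hI, S, fun a => by simpa using hS a, hm⟩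
  · simp at hlt
    have hno := hI.resolve_right fun hI => hI.1 hlt
    have hlst2 : s₂.arr aList = s.arr aList := by rw [hf2 aList rfl, hf aList rfl]
    have hlen2 : s₂.arr vLen = s.arr vLen := by rw [hf2 vLen rfl, hf vLen rfl]
    refine Runs.seq ((runs_decodeP h2 hG
      (by rw [hx2]; exact hi.le.trans htup) (by rw [hf2 vWidth rfl, hw1, hlen2])).frame
      fun s₃ hS hf3 _ => ?_)
    rw [hlst2, hlen2, hx2] at hS
    set S := I.pick (s.arr aList) (s.arr vLen 0) i I.k with hSdef
    have h3 : Reads I d s₃ := h2.congr (hf3 0 rfl) (hf3 1 rfl) (hf3 2 rfl) (hf3 3 rfl)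
    refine Runs.seq ((runs_coverP h3 hG hS).frame fun s₄ hcov hf4 _ => ?_)
    have h4' : Reads I d s₄ := h3.congr (hf4 0 rfl) (hf4 1 rfl) (hf4 2 rfl) (hf4 3 rfl)
    have hS4 : Holds S s₄ := fun a => by rw [hf4 5 rfl]; exact hS a
    refine (runs_acceptP h4' hG hS4 (Inst.card_pick_le _ _ _ _) hcov
      fun j hj => by rw [hf4 aThr rfl, hf3 aThr rfl, hf2 aThr rfl, hf aThr rfl, hthr j hj]).frame
      fun s₅ hacc hf5 _ => ?_
    have h44 : s₄.arr 4 0 = 0 := by rw [hf4 4 rfl, hf3 4 rfl, hlt]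
    rw [h44] at hacc
    by_cases hm : I.Meets d S
    · refine Or.inr ⟨by simp [hacc, hm], S, fun a => ?_, hm⟩
      have : s₅.arr 5 = s₄.arr 5 := hf5 5 rfl
      simpa [this] using hS4 a
    · refine Or.inl ⟨by simp [hacc, hm], fun c hc => ?_⟩
      rcases Nat.lt_succ_iff_lt_or_eq.1 hc with hc | rfl
      · exact hno.2 c hc
      · exact hm

end

/-! ### The program -/

/-- The search for a solution, for instances with `k, r > 0` and `t_j ≤ m`. -/
def mainP : Prog :=
  paramsP ;; unitsP ;; labelsP ;; codesP ;; layersP ;; searchP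

/-- The algorithm. If a demand exceeds `m`, or is positive for `k = 0`, then the answer is NO.
Otherwise the empty set is a solution for `k = 0` and for `r = 0`. -/
def solveP : Prog :=
  put vAcc eM ;; Prog.ite eK (lit 1) (put vAcc (lit 0)) Prog.skip ;; put vBad (lit 0) ;;
  forP vJ eR (Prog.ite (var vAcc) (Expr.get 1 (var vJ)) (put vBad (lit 1)) Prog.skip) ;;
  Prog.ite (var vBad) (lit 1)
    (Prog.ite (lit 0) eK
      (Prog.ite (lit 0) eR mainP (Prog.assign 4 (lit 0) (lit 1)))
      (Prog.assign 4 (lit 0) (lit 1)))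
    Prog.skip

/-- The random labels agree with the assignment of the witnesses. -/
def Inst.Witness.Agrees {I : Inst} {d : ℕ} (w : I.Witness d) (ω : ℕ → Bool) : Prop :=
  ∀ b ∈ w.W, I.label d ω b = w.idx b

theorem Inst.labelsSmall_label (I : Inst) (d : ℕ) (ω : ℕ → Bool) :
    I.LabelsSmall d (I.label d ω) := fun b hb => by
  rw [Inst.label, if_neg hb]

section

variable {ω : ℕ → Bool} {G : ℕ} {I : Inst} {d : ℕ} {s : State}

/-- Arrays `26` and up are still zero at the start, except for the flag of the preliminary test. -/
theorem runs_mainP (h : Reads I d s) (hG : Big I d G) (hk : 0 < I.k) (hr : 0 < I.r)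
    (hK : I.KFree d) (hdem : ∀ j, I.dem j ≤ I.m) (hcoins : s.coins = 0)
    (hzero : ∀ x, 26 ≤ x → x ≠ vBad → ∀ i, s.arr x i = 0) (h4 : s.arr 4 0 = 0) :
    Runs I.oracle ω G mainP s fun s' =>
      (s'.arr 4 0 = 0 ∧ ∀ w : I.Witness d, ¬ w.Agrees ω) ∨
      (s'.arr 4 0 ≠ 0 ∧ ∃ S : Finset (Fin I.n), Holds S s' ∧ I.Meets d S) := by
  have hd := hK.pos
  unfold mainP
  refine Runs.seq ((runs_paramsP h hG).frame fun s₁ hQ hf1 hc1 => ?_)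
  obtain ⟨hbase, hdepth, hquot, hsmall⟩ := hQ
  have h1 : Reads I d s₁ := h.congr (hf1 0 rfl) (hf1 1 rfl) (hf1 2 rfl) (hf1 3 rfl)
  refine Runs.seq ((runs_unitsP h1 hG hk hdem hquot hsmall).frame fun s₂ hu hf2 hc2 => ?_)
  have h2 : Reads I d s₂ := h1.congr (hf2 0 rfl) (hf2 1 rfl) (hf2 2 rfl) (hf2 3 rfl)
  refine Runs.seq ((runs_labelsP h2 hG (by rw [hc2 rfl, hc1 rfl, hcoins])
    (fun b => by rw [hf2 aLab rfl, hf1 aLab rfl, hzero _ (by decide) (by decide)])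
    fun j hj => (hu j hj).2.2).frame fun s₃ hlab hf3 _ => ?_)
  have h3 : Reads I d s₃ := h2.congr (hf3 0 rfl) (hf3 1 rfl) (hf3 2 rfl) (hf3 3 rfl)
  refine Runs.seq ((runs_codesP h3 hG hk hd (by rw [hf3 vBase rfl, hf2 vBase rfl, hbase])
    (fun j hj => by rw [hf3 aUnit rfl]; exact (hu j hj).1) hlab).frame fun s₄ hcode hf4 _ => ?_)
  have h4' : Reads I d s₄ := h3.congr (hf4 0 rfl) (hf4 1 rfl) (hf4 2 rfl) (hf4 3 rfl)
  refine Runs.seq ((runs_layersP h4' hG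
    (by rw [hf4 vDepth rfl, hf3 vDepth rfl, hf2 vDepth rfl, hdepth]) hcode
    (fun a => by rw [hf4 aLay rfl, hf3 aLay rfl, hf2 aLay rfl, hf1 aLay rfl,
      hzero _ (by decide) (by decide)])
    (by rw [hf4 vLen rfl, hf3 vLen rfl, hf2 vLen rfl, hf1 vLen rfl,
      hzero _ (by decide) (by decide)])).frame fun s₅ hQ hf5 _ => ?_)
  obtain ⟨hlayered, hlist⟩ := hQ
  have h5 : Reads I d s₅ := h4'.congr (hf5 0 rfl) (hf5 1 rfl) (hf5 2 rfl) (hf5 3 rfl)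
  have hlen : s₅.arr vLen 0 ≤ I.k * I.depth d * I.base d ^ (I.r * I.k) := by
    rw [hlist.card]
    exact hlayered.card_le fun a => Inst.code_lt hk hr hd _ a
  have htup : (s₅.arr vLen 0 + 1) ^ I.k ≤ G :=
    (Nat.pow_le_pow_left (Nat.succ_le_succ hlen) _).trans hG.tuples
  refine (runs_searchP h5 hG ((Nat.le_self_pow hk.ne' _).trans htup) htup
    (fun j hj => by rw [hf5 aThr rfl, hf4 aThr rfl, hf3 aThr rfl]; exact (hu j hj).2.1)
    (by rw [hf5 4 rfl, hf4 4 rfl, hf3 4 rfl, hf2 4 rfl, hf1 4 rfl, h4])).mono fun s₆ hQ => ?_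
  refine hQ.imp (fun hQ => ⟨hQ.1, fun w hw => ?_⟩) id
  obtain ⟨x, hx, hadm, hthr⟩ := w.exists_thr_le hk hr hK (I.labelsSmall_label d ω) hw hlayered
  obtain ⟨c, hc, hpick⟩ := hlist.exists_pick hx w.p_le
  exact hQ.2 c hc (by rw [hpick]; exact ⟨hadm, hthr⟩)

theorem output_of_holds {S : Finset (Fin I.n)} (h : Holds S s) (h4 : s.arr 4 0 ≠ 0) :
    I.output s = some S := by
  rw [Inst.output, if_neg h4]
  congr 1
  ext a
  simp [h a]

theorem runs_solveP (hr : I.r ≤ G) (hG : 0 < I.k → 0 < I.r → Big I d G) (hK : I.KFree d) :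
    Runs I.oracle ω G solveP (I.init d) fun s' =>
      (I.output s' = none ∧
        (I.IsYes → 0 < I.k ∧ 0 < I.r ∧ ∀ w : I.Witness d, ¬ w.Agrees ω)) ∨
      ∃ S, I.output s' = some S ∧ I.Good d S := by
  have hd := hK.pos
  have h := reads_init I d
  unfold solveP
  refine Runs.seq (Runs.put (Runs.seq ?_))
  refine Runs.frame (R := fun s' => s'.arr vAcc 0 = if I.k < 1 then 0 else I.m) ?_
    fun s₁ hacc hf1 hc1 => Runs.seq (Runs.put ?_)
  · refine Runs.ite (fun hc => Runs.put ?_) (fun hc => Runs.skip ?_)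
    · simp only [eval_eK, eval_lit, State.set_arr] at hc
      simp [h.k] at hc
      simp [hc]
    · simp only [eval_eK, eval_lit, State.set_arr] at hc
      simp [h.k] at hc
      simp [hc, h.m]
  have hst : ∀ y, y ≠ vAcc → y ≠ vBad → (s₁.set vBad 0 0).arr y = (I.init d).arr y := by
    intro y hy hy'
    rw [State.set_arr_ne _ _ _ hy', hf1 y (by simpa [Prog.writes, put] using Ne.symm hy),
      State.set_arr_ne _ _ _ hy]
  rw [eval_lit]
  refine Runs.seq (Runs.frame (R := fun s' => s'.arr vBad 0 =
    if ∀ j < I.r, I.dem j ≤ if I.k < 1 then 0 else I.m then 0 else 1) ?_ ?_)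
  · refine Runs.forP (N := I.r) (fun i s' => s'.arr vBad 0 =
      if ∀ j < i, I.dem j ≤ if I.k < 1 then 0 else I.m then 0 else 1) rfl rfl ?_ hr (by simp) ?_
      fun _ _ hQ => hQ
    · rw [eval_eR, hst 0 (by decide) (by decide), h.r]
    · intro i s₂ hi hf2 hx2 hI
      have e1 : s₂.arr vAcc 0 = if I.k < 1 then 0 else I.m := by
        rw [hf2 vAcc rfl, ← hacc]; simp
      have e2 : s₂.arr 1 i = I.dem i := by
        rw [hf2 1 rfl, hst 1 (by decide) (by decide), h.dem]
      refine Runs.ite (fun hc => Runs.put ?_) (fun hc => Runs.skip ?_)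
      · simp only [eval_var, Expr.eval_get, hx2, e1, e2] at hc
        rw [if_neg fun hall => absurd (hall i (Nat.lt_succ_self i)) (not_le.2 hc)]
        simp
      · simp only [eval_var, Expr.eval_get, hx2, e1, e2, not_lt] at hc
        have : (∀ j < i + 1, I.dem j ≤ if I.k < 1 then 0 else I.m) ↔
            ∀ j < i, I.dem j ≤ if I.k < 1 then 0 else I.m := by
          refine ⟨fun H j hj => H j (by omega), fun H j hj => ?_⟩
          rcases Nat.lt_succ_iff_lt_or_eq.1 hj with hj | rfl
          · exact H j hj
          · exact hc
        simp only [this, ← hI]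
        simp
  intro s₂ hbad hf2 hc2
  have hst2 : ∀ y, y ≠ vAcc → y ≠ vBad → y ≠ vJ → s₂.arr y = (I.init d).arr y := by
    intro y hy hy' hy''
    rw [hf2 y (by simp [forP, Prog.writes, put, Ne.symm hy', Ne.symm hy'']), hst y hy hy']
  have h2 : Reads I d s₂ := h.congr (hst2 0 (by decide) (by decide) (by decide))
    (hst2 1 (by decide) (by decide) (by decide)) (hst2 2 (by decide) (by decide) (by decide))
    (hst2 3 (by decide) (by decide) (by decide))
  have hz2 : ∀ x, 4 ≤ x → x ≠ vAcc → x ≠ vBad → x ≠ vJ → ∀ i, s₂.arr x i = 0 := by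
    intro x hx h1 h2 h3 i
    rw [hst2 x h1 h2 h3]
    obtain ⟨y, rfl⟩ := Nat.exists_eq_add_of_le' hx
    rfl
  -- the empty set is the output if one of `k` and `r` is zero and all demands are met
  have hempty : (∀ j : Fin I.r, I.dem j = 0) →
      (∃ S, I.output (s₂.set 4 0 1) = some S ∧ I.Good d S) := by
    intro hdem0
    refine ⟨∅, output_of_holds (fun a => ?_) (by simp), Inst.admissible_empty, fun j _ => ?_,
      fun j _ => ?_⟩
    · simp [hz2 5 (by decide) (by decide) (by decide) (by decide)]
    · have : I.t j = 0 := by simpa [Inst.dem] using hdem0 j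
      simp [Inst.ApproxCovers, this]
    · have : I.t j = 0 := by simpa [Inst.dem] using hdem0 j
      simp [this]
  refine Runs.ite (fun hc => ?_) (fun hc => Runs.skip (Or.inl ⟨?_, fun hyes => ?_⟩))
  · have hdem : ∀ j < I.r, I.dem j ≤ if I.k < 1 then 0 else I.m := by
      by_contra hn
      rw [if_neg hn] at hbad
      simp [hbad] at hc
    refine Runs.ite (fun hk => ?_) (fun hk => Runs.assign (Or.inr (hempty fun j => ?_)))
    · simp [h2.k] at hk
      refine Runs.ite (fun hr => ?_) (fun hr => Runs.assign (Or.inr (hempty fun j => ?_)))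
      · simp [h2.r] at hr
        have hdem' : ∀ j, I.dem j ≤ I.m := by
          intro j
          by_cases hj : j < I.r
          · have := hdem j hj
            rwa [if_neg (by omega)] at this
          · simp [Inst.dem, hj]
        refine (runs_mainP h2 (hG hk hr) hk hr hK hdem' ?_
          (fun x hx hx' => hz2 x (by omega) (by omega) hx' (by omega))
          (hz2 4 (by decide) (by decide) (by decide) (by decide) 0)).mono fun s₃ hQ => ?_
        · rw [hc2 rfl, State.set_coins, hc1 rfl]
          rfl
        · rcases hQ with ⟨h40, hw⟩ | ⟨h40, S, hS, hm⟩
          · exact Or.inl ⟨by rw [Inst.output, if_pos h40], fun _ => ⟨hk, hr, hw⟩⟩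
          · exact Or.inr ⟨S, output_of_holds hS h40, Inst.good_of_thr_le hk hd hm.1 hm.2⟩
      · simp [h2.r] at hr
        exact absurd j.2 (by omega)
    · simp [h2.k] at hk
      have := hdem j j.2
      rw [if_pos (by omega)] at this
      omega
  · rw [Inst.output, if_pos (hz2 4 (by decide) (by decide) (by decide) (by decide) 0)]
  · exfalso
    obtain ⟨S, hS, hcov⟩ := hyes
    refine hc ?_
    rw [eval_var, eval_lit, hbad, if_pos]
    · exact Nat.one_pos
    intro j hj
    have h1 := hcov ⟨j, hj⟩
    have h2 : I.dem j = I.t ⟨j, hj⟩ := by simp [Inst.dem, hj]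
    rw [h2]
    refine h1.trans ?_
    split_ifs with hk
    · have : S = ∅ := Finset.card_eq_zero.1 (by have := hS.1; omega)
      simp [this, Inst.nbr]
    · exact (Finset.card_le_univ _).trans (by simp)

end

/-! ### The running time -/

/-- The bound on the number of iterations of all loops. -/
def Inst.iter (I : Inst) (d : ℕ) : ℕ :=
  (I.n + I.m + 1) * (I.k * I.depth d * I.base d ^ (I.r * I.k) + 1) ^ I.k

theorem Inst.r_le_m (I : Inst) : I.r ≤ I.m := by
  simpa using Fintype.card_le_of_surjective _ I.f_surj

theorem Inst.iter_pos (I : Inst) (d : ℕ) : 0 < I.iter d :=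
  Nat.mul_pos (Nat.succ_pos _) (Nat.pow_pos (Nat.succ_pos _))

theorem Inst.le_iter (I : Inst) (d : ℕ) : I.n + I.m + 1 ≤ I.iter d :=
  Nat.le_mul_of_pos_right _ (Nat.pow_pos (Nat.succ_pos _))

theorem big_iter (I : Inst) {d : ℕ} (hd : 0 < d) (hk : 0 < I.k) (hr : 0 < I.r) :
    Big I d (I.iter d) := by
  have h1 := I.le_iter d
  have h2 := I.r_le_m
  have h3 : (I.k * I.depth d * I.base d ^ (I.r * I.k) + 1) ^ I.k ≤ I.iter d :=
    Nat.le_mul_of_pos_left _ (Nat.succ_pos _)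
  have h4 : I.k * I.depth d * I.base d ^ (I.r * I.k) ≤ I.iter d :=
    (Nat.le_succ _).trans ((Nat.le_self_pow hk.ne' _).trans h3)
  have hX := I.inv_pos
  have hb0 : 0 < I.base d := by unfold Inst.base; omega
  have hdep : 0 < I.depth d := Nat.pow_pos two_pos
  have h5 : I.base d ≤ I.iter d := by
    refine le_trans ?_ h4
    refine (Nat.le_self_pow (Nat.mul_pos hr hk).ne' _).trans ?_
    exact Nat.le_mul_of_pos_left _ (Nat.mul_pos hk hdep)
  have h6 : I.depth d ≤ I.iter d := by
    refine le_trans ?_ h4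
    rw [mul_comm I.k, mul_assoc]
    exact Nat.le_mul_of_pos_right _ (Nat.mul_pos hk (Nat.pow_pos hb0))
  have h7 : 0 < I.scale d := Nat.mul_pos (Nat.mul_pos (Nat.mul_pos hr hk) hd) hX
  have h8 : I.scale d ≤ I.scale d * I.k := Nat.le_mul_of_pos_right _ hk
  have h9 : I.k ≤ I.scale d * I.k := Nat.le_mul_of_pos_left _ h7
  have h10 : d ≤ I.scale d := by
    have : I.scale d = I.r * I.k * I.inv * d := by unfold Inst.scale; ring
    rw [this]
    exact Nat.le_mul_of_pos_left _ (Nat.mul_pos (Nat.mul_pos hr hk) hX)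
  have h11 : I.inv ≤ I.scale d :=
    Nat.le_mul_of_pos_left _ (Nat.mul_pos (Nat.mul_pos hr hk) hd)
  have h12 : I.base d = 1 + 4 * (I.scale d * I.k) := rfl
  exact ⟨by omega, by omega, by omega, by omega, by omega,
    (Nat.lt_two_pow_self.le : 6 * I.scale d ≤ I.depth d).trans h6, h6, h5, by omega, h3⟩

theorem Inst.eps_real (I : Inst) : (I.ε : ℝ) = (I.ε.num.toNat : ℝ) / I.ε.den := by
  have h := congrArg (fun q : ℚ => (q : ℝ)) (Inst.eps_eq (I := I))
  simpa using h

theorem Inst.inv_le (I : Inst) : (I.inv : ℝ) ≤ 2 / (I.ε : ℝ) := by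
  have h0 : (0 : ℝ) < I.ε := by exact_mod_cast I.ε_pos
  have h1 : (I.ε : ℝ) < 1 := by exact_mod_cast I.ε_lt_one
  have h2 : ((I.ε.den / I.ε.num.toNat : ℕ) : ℝ) ≤ 1 / (I.ε : ℝ) := by
    refine Nat.cast_div_le.trans (le_of_eq ?_)
    rw [I.eps_real, one_div_div]
  have h3 : (1 : ℝ) ≤ 1 / I.ε := by rw [le_div_iff₀ h0]; linarith
  unfold Inst.inv
  push_cast
  calc ((I.ε.den / I.ε.num.toNat : ℕ) : ℝ) + 1 ≤ 1 / I.ε + 1 / I.ε := add_le_add h2 h3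
    _ = 2 / I.ε := by ring

/-- The parameter in the exponent of the running time. -/
noncomputable def Inst.expo (I : Inst) (d : ℕ) : ℝ :=
  (I.k : ℝ) ^ 3 * I.r * d * Real.logb 2 ((I.r : ℝ) + 1) / (I.ε : ℝ)

theorem Inst.logb_nonneg (I : Inst) : 0 ≤ Real.logb 2 ((I.r : ℝ) + 1) :=
  Real.logb_nonneg one_lt_two (by linarith [Nat.cast_nonneg (α := ℝ) I.r])

theorem Inst.expo_nonneg (I : Inst) (d : ℕ) : 0 ≤ I.expo d := by
  have h0 : (0 : ℝ) < I.ε := by exact_mod_cast I.ε_pos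
  have := I.logb_nonneg
  unfold Inst.expo
  positivity

theorem natCast_le_two_rpow (x : ℕ) : (x : ℝ) ≤ (2 : ℝ) ^ (x : ℝ) := by
  rw [Real.rpow_natCast]
  exact_mod_cast Nat.lt_two_pow_self.le

/-- The number of tuples is within the exponential factor of the running time. -/
theorem Inst.tuples_le (I : Inst) {d : ℕ} (hd : 0 < d) (hk : 0 < I.k) (hr : 0 < I.r) :
    (((I.k * I.depth d * I.base d ^ (I.r * I.k) + 1) ^ I.k : ℕ) : ℝ) ≤
      (2 : ℝ) ^ (32 * I.expo d) := by
  have h0 : (0 : ℝ) < I.ε := by exact_mod_cast I.ε_pos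
  have h1 : (I.ε : ℝ) < 1 := by exact_mod_cast I.ε_lt_one
  set k : ℝ := (I.k : ℝ) with hkdef
  set r : ℝ := (I.r : ℝ) with hrdef
  set δ : ℝ := (d : ℝ) with hddef
  set X : ℝ := (I.inv : ℝ) with hXdef
  set l : ℝ := Real.logb 2 (r + 1) with hldef
  set E : ℝ := 2 / I.ε with hEdef
  have k1 : 1 ≤ k := by rw [hkdef]; exact_mod_cast hk
  have r1 : 1 ≤ r := by rw [hrdef]; exact_mod_cast hr
  have d1 : 1 ≤ δ := by rw [hddef]; exact_mod_cast hd
  have X1 : 1 ≤ X := by rw [hXdef]; exact_mod_cast I.inv_pos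
  have E1 : 1 ≤ E := by rw [hEdef, le_div_iff₀ h0]; linarith
  have l1 : 1 ≤ l := by
    rw [hldef, Real.le_logb_iff_rpow_le one_lt_two (by linarith), Real.rpow_one]
    linarith
  have hXE : X ≤ E := I.inv_le
  have two : (1 : ℝ) ≤ 2 := one_le_two
  -- every monomial that occurs in the exponent divides `k³ r d l E`
  have mon : ∀ a b c e f : ℕ, a ≤ 3 → b ≤ 1 → c ≤ 1 → e ≤ 1 → f ≤ 1 →
      k ^ a * r ^ b * δ ^ c * l ^ e * E ^ f ≤ k ^ 3 * r ^ 1 * δ ^ 1 * l ^ 1 * E ^ 1 := by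
    intro a b c e f ha hb hc he hf
    gcongr
  have hscale : ((I.scale d : ℕ) : ℝ) = r * k * δ * X := by
    simp [Inst.scale, hkdef, hrdef, hddef, hXdef]
  have hdepth : ((I.depth d : ℕ) : ℝ) = (2 : ℝ) ^ (6 * (r * k * δ * X)) := by
    rw [← hscale, Inst.depth]
    push_cast
    rw [← Real.rpow_natCast]
    push_cast
    rfl
  have hr2 : r ≤ (2 : ℝ) ^ l := by
    rw [hldef, Real.rpow_logb two_pos (by norm_num) (by linarith)]
    linarith
  have hk2 : k ≤ (2 : ℝ) ^ k := natCast_le_two_rpow I.k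
  have hd2 : δ ≤ (2 : ℝ) ^ δ := natCast_le_two_rpow d
  have hX2 : X ≤ (2 : ℝ) ^ X := natCast_le_two_rpow I.inv
  have hbase : ((I.base d : ℕ) : ℝ) ≤ (2 : ℝ) ^ (3 + l + 2 * k + δ + X) := by
    have e1 : ((I.base d : ℕ) : ℝ) = 1 + 4 * (r * k * δ * X * k) := by
      rw [← hscale]; simp [Inst.base, hkdef]
    have e2 : 1 ≤ r * k * δ * X * k := by
      have : (1 : ℝ) = 1 * 1 * 1 * 1 * 1 := by norm_num
      rw [this]
      gcongr
    calc ((I.base d : ℕ) : ℝ) ≤ (2 : ℝ) ^ (3 : ℝ) * (r * k * δ * X * k) := by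
          rw [e1]; norm_num; linarith
      _ ≤ (2 : ℝ) ^ (3 : ℝ) *
          ((2 : ℝ) ^ l * (2 : ℝ) ^ k * (2 : ℝ) ^ δ * (2 : ℝ) ^ X * (2 : ℝ) ^ k) := by gcongr
      _ = _ := by
          simp only [← Real.rpow_add two_pos]
          congr 1; ring
  have hbase1 : (1 : ℝ) ≤ I.base d := by
    have : 1 ≤ I.base d := by unfold Inst.base; omega
    exact_mod_cast this
  have hvert : ((I.k * I.depth d * I.base d ^ (I.r * I.k) + 1 : ℕ) : ℝ) ≤
      (2 : ℝ) ^ (1 + k + 6 * (r * k * δ * X) + r * k * (3 + l + 2 * k + δ + X)) := by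
    push_cast
    rw [hdepth]
    have e1 : (I.base d : ℝ) ^ (I.r * I.k) ≤ (2 : ℝ) ^ (r * k * (3 + l + 2 * k + δ + X)) := by
      calc (I.base d : ℝ) ^ (I.r * I.k) ≤ ((2 : ℝ) ^ (3 + l + 2 * k + δ + X)) ^ (I.r * I.k) := by
            gcongr
        _ = _ := by
            rw [← Real.rpow_natCast, ← Real.rpow_mul two_pos.le]
            push_cast
            congr 1; ring
    have e2 : 1 ≤ k * (2 : ℝ) ^ (6 * (r * k * δ * X)) * (I.base d : ℝ) ^ (I.r * I.k) := by
      have e3 : (1 : ℝ) ≤ (2 : ℝ) ^ (6 * (r * k * δ * X)) :=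
        Real.one_le_rpow one_le_two (by positivity)
      have e4 : (1 : ℝ) ≤ (I.base d : ℝ) ^ (I.r * I.k) := one_le_pow₀ hbase1
      have : (1 : ℝ) = 1 * 1 * 1 := by norm_num
      rw [this]
      gcongr
    calc k * (2 : ℝ) ^ (6 * (r * k * δ * X)) * (I.base d : ℝ) ^ (I.r * I.k) + 1
        ≤ (2 : ℝ) ^ (1 : ℝ) *
          (k * (2 : ℝ) ^ (6 * (r * k * δ * X)) * (I.base d : ℝ) ^ (I.r * I.k)) := by
          rw [Real.rpow_one]; linarith
      _ ≤ (2 : ℝ) ^ (1 : ℝ) * ((2 : ℝ) ^ k * (2 : ℝ) ^ (6 * (r * k * δ * X)) *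
          (2 : ℝ) ^ (r * k * (3 + l + 2 * k + δ + X))) := by gcongr
      _ = _ := by
          simp only [← Real.rpow_add two_pos]
          congr 1; ring
  rw [Nat.cast_pow]
  calc ((I.k * I.depth d * I.base d ^ (I.r * I.k) + 1 : ℕ) : ℝ) ^ I.k
      ≤ ((2 : ℝ) ^ (1 + k + 6 * (r * k * δ * X) + r * k * (3 + l + 2 * k + δ + X))) ^ I.k := by
        gcongr
    _ = (2 : ℝ) ^ ((1 + k + 6 * (r * k * δ * X) + r * k * (3 + l + 2 * k + δ + X)) * k) := by
        rw [← Real.rpow_natCast, ← Real.rpow_mul two_pos.le]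
    _ ≤ (2 : ℝ) ^ (32 * I.expo d) := by
        refine Real.rpow_le_rpow_of_exponent_le one_le_two ?_
        have hexpo : 32 * I.expo d = 16 * (k ^ 3 * r ^ 1 * δ ^ 1 * l ^ 1 * E ^ 1) := by
          simp only [Inst.expo, hEdef, pow_one]
          ring
        rw [hexpo]
        have m1 := mon 1 0 0 0 0
          (by norm_num) (by norm_num) (by norm_num) (by norm_num) (by norm_num)
        have m2 := mon 2 0 0 0 0
          (by norm_num) (by norm_num) (by norm_num) (by norm_num) (by norm_num)
        have m3 := mon 2 1 1 0 1 (by norm_num) le_rfl le_rfl (by norm_num) le_rfl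
        have m4 := mon 2 1 0 0 0 (by norm_num) le_rfl (by norm_num) (by norm_num) (by norm_num)
        have m5 := mon 2 1 0 1 0 (by norm_num) le_rfl (by norm_num) le_rfl (by norm_num)
        have m6 := mon 3 1 0 0 0 le_rfl le_rfl (by norm_num) (by norm_num) (by norm_num)
        have m7 := mon 2 1 1 0 0 (by norm_num) le_rfl le_rfl (by norm_num) (by norm_num)
        have m8 := mon 2 1 0 0 1 (by norm_num) le_rfl (by norm_num) (by norm_num) le_rfl
        simp only [pow_zero, mul_one, pow_one] at m1 m2 m3 m4 m5 m6 m7 m8 ⊢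
        calc (1 + k + 6 * (r * k * δ * X) + r * k * (3 + l + 2 * k + δ + X)) * k
            ≤ (1 + k + 6 * (r * k * δ * E) + r * k * (3 + l + 2 * k + δ + E)) * k := by gcongr
          _ = k + k ^ 2 + 6 * (k ^ 2 * r * δ * E) + 3 * (k ^ 2 * r) + k ^ 2 * r * l +
              2 * (k ^ 3 * r) + k ^ 2 * r * δ + k ^ 2 * r * E := by ring
          _ ≤ _ := by linarith

/-! ### Probability and conclusion -/

/-- The probability that the coins in a finite set show prescribed values. -/
theorem fairCoins_cylinder (J : Finset ℕ) (v : ℕ → Bool) :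
    fairCoins.real {ω | ∀ p ∈ J, ω p = v p} = (1 / 2 : ℝ) ^ J.card := by
  have h : {ω : ℕ → Bool | ∀ p ∈ J, ω p = v p} = Set.pi (J : Set ℕ) fun p => {v p} := by
    ext ω; simp
  rw [MeasureTheory.measureReal_def, h, fairCoins, MeasureTheory.Measure.infinitePi_pi]
  · simp
  · intros; exact MeasurableSet.singleton _

instance : MeasureTheory.IsProbabilityMeasure fairCoins := by
  unfold fairCoins; infer_instance

/-- The coins that determine the labels of the witnesses. -/
def Inst.Witness.coins {I : Inst} {d : ℕ} (w : I.Witness d) : Finset ℕ :=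
  (w.W ×ˢ Finset.range I.k).image fun q => (q.1 : ℕ) * I.k + q.2

theorem Inst.Witness.card_coins_le {I : Inst} {d : ℕ} (w : I.Witness d) :
    w.coins.card ≤ I.k * w.W.card :=
  Finset.card_image_le.trans (by simp [mul_comm])

/-- With probability at least `2 ^ (-k |W|)` the labels agree with the assignment of the
witnesses `W`. -/
theorem Inst.Witness.le_prob {I : Inst} {d : ℕ} (w : I.Witness d) :
    (1 / 2 : ℝ) ^ (I.k * w.W.card) ≤ fairCoins.real {ω | w.Agrees ω} := by
  set v : ℕ → Bool := fun p =>
    if h : p / I.k < I.m then decide (p % I.k = w.idx ⟨p / I.k, h⟩) else false with hv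
  calc (1 / 2 : ℝ) ^ (I.k * w.W.card) ≤ (1 / 2 : ℝ) ^ w.coins.card :=
        pow_le_pow_of_le_one (by norm_num) (by norm_num) w.card_coins_le
    _ = fairCoins.real {ω | ∀ p ∈ w.coins, ω p = v p} := (fairCoins_cylinder _ _).symm
    _ ≤ _ := by
        refine MeasureTheory.measureReal_mono fun ω hω b hb => ?_
        obtain ⟨i, hi, -⟩ := w.idx_spec b hb
        have hik : w.idx b < I.k := hi ▸ i.2.trans_le w.p_le
        rw [Inst.label, if_pos (w.small b hb)]
        refine lastHead_eq hik fun q hq => ?_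
        rw [hω _ (Finset.mem_image.2 ⟨(b, q), Finset.mem_product.2
          ⟨hb, Finset.mem_range.2 hq⟩, rfl⟩)]
        have hk : 0 < I.k := (Nat.zero_le _).trans_lt hq
        have e1 : ((b : ℕ) * I.k + q) / I.k = b := by
          rw [mul_comm, Nat.mul_add_div hk, Nat.div_eq_of_lt hq, Nat.add_zero]
        have e2 : ((b : ℕ) * I.k + q) % I.k = q := by
          rw [mul_comm, Nat.mul_add_mod, Nat.mod_eq_of_lt hq]
        simp only [hv, e1, e2, b.2, dif_pos]

theorem Inst.Witness.exp_le_prob {I : Inst} {d : ℕ} (w : I.Witness d) (hk : 0 < I.k)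
    (hd : 0 < d) :
    Real.exp (-(2 * (I.k : ℝ) ^ 3 * d * I.r / (I.ε : ℝ))) ≤ fairCoins.real {ω | w.Agrees ω} := by
  have h1 : ((I.k * w.W.card : ℕ) : ℝ) ≤ 2 * (I.k : ℝ) ^ 3 * d * I.r / (I.ε : ℝ) := by
    exact_mod_cast w.card_mul_le hk hd
  refine le_trans ?_ w.le_prob
  calc Real.exp (-(2 * (I.k : ℝ) ^ 3 * d * I.r / (I.ε : ℝ)))
      ≤ Real.exp (-((I.k * w.W.card : ℕ) : ℝ)) := Real.exp_le_exp.2 (neg_le_neg h1)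
    _ = Real.exp (-1) ^ (I.k * w.W.card) := by
        rw [← Real.exp_nat_mul]; congr 1; ring
    _ ≤ (1 / 2 : ℝ) ^ (I.k * w.W.card) := by
        refine pow_le_pow_left₀ (Real.exp_pos _).le ?_ _
        rw [Real.exp_neg, one_div]
        refine inv_anti₀ two_pos ?_
        linarith [Real.add_one_le_exp (1 : ℝ)]

/-- A bound on the number of iterations of all loops, within the claimed running time. For `k = 0`
or `r = 0` the exponent vanishes, and only the loop of the preliminary test is executed. -/
theorem Inst.exists_iterations (I : Inst) {d : ℕ} (hd : 0 < d) : ∃ G : ℕ, 1 ≤ G ∧ I.r ≤ G ∧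
    (0 < I.k → 0 < I.r → Big I d G) ∧
    (G : ℝ) ≤ (2 : ℝ) ^ (32 * I.expo d) * ((I.n : ℝ) + I.m + 1) := by
  have hr := I.r_le_m
  by_cases h : 0 < I.k ∧ 0 < I.r
  · refine ⟨I.iter d, I.iter_pos d, by have := I.le_iter d; omega,
      fun hk hr => big_iter I hd hk hr, ?_⟩
    rw [Inst.iter, Nat.cast_mul, mul_comm]
    push_cast
    have := I.tuples_le hd h.1 h.2
    push_cast at this
    gcongr
  · refine ⟨I.n + I.m + 1, by omega, by omega, fun hk hr => absurd ⟨hk, hr⟩ h, ?_⟩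
    push_cast
    refine le_mul_of_one_le_left (by positivity) ?_
    exact Real.one_le_rpow one_le_two (mul_nonneg (by norm_num) (I.expo_nonneg d))

end MFCov

theorem mainTheorem6 :
    ∃ (P : MFCov.Prog) (C : ℕ), ∀ (I : MFCov.Inst) (d : ℕ), I.KFree d →
      ∃ T : ℕ,
        (T : ℝ) ≤ C * (2 : ℝ) ^ ((C : ℝ) *
            ((I.k : ℝ) ^ 3 * I.r * d * Real.logb 2 ((I.r : ℝ) + 1) / (I.ε : ℝ))) *
            ((I.n : ℝ) + I.m + 1) ^ C ∧
        (∀ ω : ℕ → Bool, ∃ o, I.Outputs d P T ω o) ∧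
        (I.IsYes →
          Real.exp (-(2 * (I.k : ℝ) ^ 3 * d * I.r / (I.ε : ℝ))) ≤
            MFCov.fairCoins.real {ω | ∃ S, I.Outputs d P T ω (some S) ∧ I.Good d S}) ∧
        (¬ I.IsYes → ∀ ω : ℕ → Bool,
          I.Outputs d P T ω none ∨
            ∃ S, I.Outputs d P T ω (some S) ∧ I.Admissible S ∧ ∀ j, I.ApproxCovers S j) := by
  obtain ⟨c, hc⟩ := MFCov.solveP.exists_bnd_le
  refine ⟨MFCov.solveP, 32 * c + c, fun I d hK => ?_⟩
  have hd := hK.pos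
  obtain ⟨G, hG1, hGr, hbig, hG⟩ := I.exists_iterations hd
  have hrun : ∀ ω : ℕ → Bool,
      (I.Outputs d MFCov.solveP (MFCov.solveP.bnd G) ω none ∧
        (I.IsYes → 0 < I.k ∧ 0 < I.r ∧ ∀ w : I.Witness d, ¬ w.Agrees ω)) ∨
      ∃ S, I.Outputs d MFCov.solveP (MFCov.solveP.bnd G) ω (some S) ∧ I.Good d S := by
    intro ω
    obtain ⟨t, s, ht, he, ⟨ho, hw⟩ | ⟨S, ho, hS⟩⟩ := MFCov.runs_solveP (ω := ω) hGr hbig hK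
    · exact Or.inl ⟨⟨t, s, ht, he, ho⟩, hw⟩
    · exact Or.inr ⟨S, ⟨t, s, ht, he, ho⟩, hS⟩
  refine ⟨MFCov.solveP.bnd G, ?_, fun ω => ?_, fun hyes => ?_, fun hno ω => ?_⟩
  · have hx := I.expo_nonneg d
    change _ ≤ ((32 * c + c : ℕ) : ℝ) * (2 : ℝ) ^ (((32 * c + c : ℕ) : ℝ) * I.expo d) * _
    have hN : (1 : ℝ) ≤ (I.n : ℝ) + I.m + 1 := by
      have h1 := Nat.cast_nonneg (α := ℝ) I.n
      have h2 := Nat.cast_nonneg (α := ℝ) I.m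
      linarith
    calc ((MFCov.solveP.bnd G : ℕ) : ℝ) ≤ ((c * G ^ c : ℕ) : ℝ) := by exact_mod_cast hc G hG1
      _ = c * (G : ℝ) ^ c := by push_cast; rfl
      _ ≤ c * ((2 : ℝ) ^ (32 * I.expo d) * ((I.n : ℝ) + I.m + 1)) ^ c := by gcongr
      _ = c * (2 : ℝ) ^ ((32 * c : ℝ) * I.expo d) * ((I.n : ℝ) + I.m + 1) ^ c := by
          rw [mul_pow, ← Real.rpow_natCast ((2 : ℝ) ^ _), ← Real.rpow_mul two_pos.le, ← mul_assoc]
          congr 3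
          ring
      _ ≤ _ := by
          have h1 : (c : ℝ) ≤ ((32 * c + c : ℕ) : ℝ) := by exact_mod_cast Nat.le_add_left _ _
          have h2 : (32 * c : ℝ) ≤ ((32 * c + c : ℕ) : ℝ) := by
            exact_mod_cast Nat.le_add_right _ _
          gcongr
          · exact one_le_two
          · omega
  · rcases hrun ω with ⟨ho, -⟩ | ⟨S, ho, -⟩
    exacts [⟨_, ho⟩, ⟨_, ho⟩]
  · obtain ⟨w⟩ := MFCov.Inst.IsYes.nonempty_witness (d := d) hyes
    by_cases hk : 0 < I.k
    · refine (w.exp_le_prob hk hd).trans (MeasureTheory.measureReal_mono fun ω hω => ?_)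
      exact (hrun ω).resolve_left fun h => (h.2 hyes).2.2 w hω
    · have huniv : {ω | ∃ S, I.Outputs d MFCov.solveP (MFCov.solveP.bnd G) ω (some S) ∧
          I.Good d S} = Set.univ :=
        Set.eq_univ_of_forall fun ω => (hrun ω).resolve_left fun h => hk (h.2 hyes).1
      rw [huniv, MeasureTheory.probReal_univ, Real.exp_le_one_iff, neg_nonpos]
      have h0 : (0 : ℝ) < I.ε := by exact_mod_cast I.ε_pos
      positivity
  · rcases hrun ω with ⟨ho, -⟩ | ⟨S, ho, hS⟩
    · exact Or.inl ho
    · exact Or.inr ⟨S, ho, hS.1, fun j => hS.approxCovers j⟩
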